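/- Let $F(t^1,t^2,t^3)=\frac12(t^1)^2t^3+\frac12t^1(t^2)^2-\frac1{24}(t^2)^4+t^2e^{t^3}$ be the potential of the extended affine Weyl group $A_2^{(1)}$, with metric $\eta_{\alpha\beta}=\partial_{t^1}\partial_{t^\alpha}\partial_{t^\beta}F$, i.e. $\eta_{13}=\eta_{22}=\eta_{31}=1$ and all other entries $0$, and $(\eta^{\alpha\beta})=\eta^{-1}$. The open WDVV equations associated to $F$, for a function $F^o(t^1,t^2,t^3,s)$, are, for all $1\le\alpha,\beta,\gamma\le 3$ (summation over repeated $\mu,\nu$), $$\frac{\partial^3F}{\partial t^\alpha\partial t^\beta\partial t^\mu}\eta^{\mu\nu}\frac{\partial^2F^o}{\partial t^\nu\partial t^\gamma}+\frac{\partial^2F^o}{\partial t^\alpha\partial t^\beta}\frac{\partial^2F^o}{\partial s\,\partial t^\gamma}=\frac{\partial^3F}{\partial t^\gamma\partial t^\beta\partial t^\mu}\eta^{\mu\nu}\frac{\partial^2F^o}{\partial t^\nu\partial t^\alpha}+\frac{\partial^2F^o}{\partial t^\gamma\partial t^\beta}\frac{\partial^2F^o}{\partial s\,\partial t^\alpha},$$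 $$\frac{\partial^3F}{\partial t^\alpha\partial t^\beta\partial t^\mu}\eta^{\mu\nu}\frac{\partial^2F^o}{\partial t^\nu\partial s}+\frac{\partial^2F^o}{\partial t^\alpha\partial t^\beta}\frac{\partial^2F^o}{\partial s^2}=\frac{\partial^2F^o}{\partial s\,\partial t^\beta}\frac{\partial^2F^o}{\partial s\,\partial t^\alpha}.$$ Consider complex numbers $b_{i,j},d_{i,j}$ $(1\le i\le j)$ with $b_{1,1}=-8$, $d_{1,1}=1$ that satisfy, for all integers $k,q\ge0$, $$\begin{aligned} \tilde{A}_{k,q}&+\sum_{j=0}^q\sum_{r=2}^{k+1}\sum_{m=1}^r\tilde{B}_{k,q,m,r,j}d_{m,r}+\sum_{i=0}^k\sum_{j=0}^q\sum_{t=1}^{k+1-i}\sum_{s=1}^t\tilde{C}_{k,q,s,t,i,j}b_{s,t}+\sum_{i=0}^k\sum_{j=0}^q\sum_{t=1}^i\sum_{s=1}^t\tilde{D}_{k,q,s,t,i,j}b_{s,t}\\ &+\sum_{i=0}^k\sum_{j=0}^q\sum_{t=1}^{k+1-i}\sum_{s=1}^t\sum_{r=2}^{i+1}\sum_{m=1}^r\tilde{E}_{k,q,s,t,m,r,i,j}b_{s,t}d_{m,r}+\sum_{i=0}^k\sum_{j=0}^q\sum_{t=1}^i\sum_{s=1}^t\sum_{r=2}^{k+2-i}\sum_{m=1}^r\tilde{F}_{k,q,s,t,m,r,i,j}b_{s,t}d_{m,r}=0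 \end{aligned}$$ and $$\begin{aligned} &\sum_{j=0}^q\sum_{r=1}^{k+1}\sum_{m=1}^r\tilde{G}_{k,q,m,r,j}b_{m,r}+\sum_{i=0}^k\sum_{j=0}^q\sum_{r=2}^{i+1}\sum_{m=1}^r\tilde{H}_{k,q,m,r,i,j}d_{m,r}+\sum_{i=0}^k\sum_{j=0}^q\sum_{t=2}^{k+2-i}\sum_{s=1}^t\tilde{I}_{k,q,s,t,i,j}d_{s,t}\\ &+\sum_{i=0}^k\sum_{j=0}^q\sum_{r=1}^{i+1}\sum_{t=1}^{k+1-i}\sum_{m=1}^r\sum_{s=1}^t\tilde{J}_{k,q,m,r,s,t,i,j}b_{m,r}b_{s,t}+\sum_{i=0}^k\sum_{j=0}^q\sum_{r=2}^{i+1}\sum_{t=2}^{k+2-i}\sum_{m=1}^r\sum_{s=1}^t\tilde{K}_{k,q,m,r,s,t,i,j}d_{m,r}d_{s,t}=0, \end{aligned}$$ where $$\tilde{A}_{k,q}=\sum_{j=0}^q\frac{(-1)^k2^{-j+2k-2}}{j!(2k)!(q-j)!},\qquad \tilde{B}_{k,q,m,r,j}=\frac{(36r^2-72r+35)(2r-1)^j(-1)^{k+m}2^{-j+2k-2r+3}(2m-1)^{2k-2r+4}}{j!(2k)!(q-j)!},$$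 $$\tilde{C}_{k,q,s,t,i,j}=\frac{(-1)^{k+1}(1-2t)(-2i+2k+1)2^{-2i-j+4k-5}t^{q-j}s^{-2(i-k+t-2)}}{(2i)!\,j!\,(-2i+2k+1)!\,(q-j)!},$$ $$\tilde{D}_{k,q,s,t,i,j}=\frac{(-1)^{k+1}(2t-1)(-i+k+1)t^{j+1}s^{2i-2t+2}2^{2i+j+2k-q-5}}{(2i-1)!\,j!\,(-2i+2k+2)!\,(q-j)!},$$ $$\tilde{E}_{k,q,s,t,m,r,i,j}=\frac{(-1)^{k+m}(2r-2t-1)(-2i+2k+1)(2r-1)^{j+1}(2m-1)^{2i-2r+4}2^{-2i-j+4k-2r}s^{-2(i-k+t-2)}t^{q-j}}{(2i)!\,j!\,(-2i+2k+1)!\,(q-j)!},$$ $$\tilde{F}_{k,q,s,t,m,r,i,j}=\frac{(-1)^{k+m}(-2r+2t+1)(-i+k+1)(2r-1)^{q-j}(2m-1)^{-2i+2k-2r+6}2^{2i+j+2k-q-2r}s^{2i-2t+2}t^{j+1}}{(2i-1)!\,j!\,(-2i+2k+2)!\,(q-j)!},$$ $$\tilde{G}_{k,q,m,r,j}=\frac{(-1)^{k+1}16^{k-1}(9r^2-9r+2)r^jm^{2k-2r+4}}{j!(2k+1)!(q-j)!},$$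 $$\tilde{H}_{k,q,m,r,i,j}=\frac{(-1)^{k+m+1}2^{2k-q-2r+8}(r-1)(-i+k+1)(2r-1)^{j+1}(2m-1)^{2i-2r+4}}{(2i)!\,j!\,(-2i+2k+2)!\,(q-j)!},$$ $$\tilde{I}_{k,q,s,t,i,j}=\frac{(-1)^{k+s+1}2^{2k-q-2t+8}(1-t)(-i+k+1)(2t-1)^{q-j}(2s-1)^{-2i+2k-2t+6}}{(2i)!\,j!\,(-2i+2k+2)!\,(q-j)!},$$ $$\tilde{J}_{k,q,m,r,s,t,i,j}=\frac{(-1)^{k+1}2^{4k-7}(r-t)r^{j+1}m^{2i-2r+4}t^{q-j}s^{-2(i-k+t-2)}}{(2i+1)!\,j!\,(2k-2i)!\,(q-j)!},$$ $$\tilde{K}_{k,q,m,r,s,t,i,j}=\frac{(-1)^{k+m+s}2^{2k-q-2r-2t+13}(r-t)(-i+k+1)(2r-1)^{j+1}(2m-1)^{2i-2r+4}(2t-1)^{q-j}(2s-1)^{-2i+2k-2t+6}}{(2i)!\,j!\,(-2i+2k+2)!\,(q-j)!}.$$ Such numbers $b_{i,j},d_{i,j}$ $(1\le i\le j)$ exist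 and are unique. With them, put, for $p,q\ge0$, $$a_{p,q}=\begin{cases}\dfrac{(-1)^{\frac{p-1}2}2^{2p-6}}{p!\,q!}\displaystyle\sum_{j=1}^{\frac{p+1}2}j^q\sum_{i=1}^ji^{-2j+p+3}b_{i,j},&p\text{ odd},\\[3mm] \dfrac{(-1)^{p/2}}{2^{q-1}p!\,q!}\left(\displaystyle\sum_{j=2}^{\frac p2+1}(2j-1)^q\sum_{i=1}^j(-1)^{i+1}(4i-2)^{-2j+p+4}d_{i,j}+2^{p-1}\right),&p\text{ even}.\end{cases}$$ Then the power series $\sum_{p,q\ge0}a_{p,q}s^px^q$ converges absolutely in a neighbourhood of $(s,x)=(0,0)$, and $$F^o(t^1,t^2,t^3,s)=s\,t^1+(t^2)^2\sum_{p,q\ge0}a_{p,q}\,s^p\,(t^3-3\log t^2)^q$$ is an analytic solution of the open WDVV equations associated to $F$. More precisely, whenever $\sum_{p,q}|a_{p,q}|\sigma^p\rho^q<\infty$ with $\sigma,\rho>0$, and $\log$ is a continuous branch of the logarithm on an open set $U\subset\mathbb{C}$, this holds on the open set of all $(t^1,t^2,t^3,s)\in\mathbb{C}^4$ with $t^2\in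 U$, $|s|<\sigma$, $|t^3-3\log t^2|<\rho$. On this set $F^o$ also satisfies $$t^1\frac{\partial F^o}{\partial t^1}+\frac12t^2\frac{\partial F^o}{\partial t^2}+\frac32\frac{\partial F^o}{\partial t^3}=F^o,\qquad\frac{\partial^2F^o}{\partial t^1\partial t^\alpha}=0\ (1\le\alpha\le3),\qquad\frac{\partial^2F^o}{\partial t^1\partial s}=1.$$ -/

import Mathlib

open scoped Nat

noncomputable section

namespace OpenWDVV

/-- Partial derivative `∂F/∂t^α` of a function of `t = (t^1, …, t^N)`
(the index `α : Fin N` is zero-based, so `t^1` is `t 0`). -/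
def pd {N : ℕ} (α : Fin N) (F : (Fin N → ℂ) → ℂ) : (Fin N → ℂ) → ℂ :=
  fun t => deriv (fun z => F (Function.update t α z)) (t α)

/-- Partial derivative `∂G/∂t^α` of a function `G(t, s)`. -/
def pdt {N : ℕ} (α : Fin N) (G : (Fin N → ℂ) → ℂ → ℂ) : (Fin N → ℂ) → ℂ → ℂ :=
  fun t s => deriv (fun z => G (Function.update t α z) s) (t α)

/-- Partial derivative `∂G/∂s` of a function `G(t, s)`. -/
def pds {N : ℕ} (G : (Fin N → ℂ) → ℂ → ℂ) : (Fin N → ℂ) → ℂ → ℂ :=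
  fun t s => deriv (fun z => G t z) s

/-- `G` is an analytic solution, on the open set `D` of points `(t, s)`, of the open WDVV equations
associated to the potential `F` and the constant metric `η`. -/
structure IsOpenWDVVSolutionOn {N : ℕ} (η : Matrix (Fin N) (Fin N) ℂ) (F : (Fin N → ℂ) → ℂ)
    (G : (Fin N → ℂ) → ℂ → ℂ) (D : Set ((Fin N → ℂ) × ℂ)) : Prop where
  isOpen : IsOpen D
  analytic : AnalyticOnNhd ℂ (fun y : (Fin N → ℂ) × ℂ => G y.1 y.2) D
  eq_tt : ∀ t s, (t, s) ∈ D → ∀ α β γ : Fin N,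
    (∑ μ, ∑ ν, pd α (pd β (pd μ F)) t * η⁻¹ μ ν * pdt ν (pdt γ G) t s)
        + pdt α (pdt β G) t s * pds (pdt γ G) t s
      = (∑ μ, ∑ ν, pd γ (pd β (pd μ F)) t * η⁻¹ μ ν * pdt ν (pdt α G) t s)
        + pdt γ (pdt β G) t s * pds (pdt α G) t s
  eq_ts : ∀ t s, (t, s) ∈ D → ∀ α β : Fin N,
    (∑ μ, ∑ ν, pd α (pd β (pd μ F)) t * η⁻¹ μ ν * pdt ν (pds G) t s)
        + pdt α (pdt β G) t s * pds (pds G) t s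
      = pds (pdt β G) t s * pds (pdt α G) t s

/-- The potential
`F = (t^1)^2 t^3 / 2 + t^1 (t^2)^2 / 2 - (t^2)^4 / 24 + t^2 e^{t^3}` of `A_2^{(1)}`. -/
def potentialA2 (t : Fin 3 → ℂ) : ℂ :=
  (t 0) ^ 2 * t 2 / 2 + t 0 * (t 1) ^ 2 / 2 - (t 1) ^ 4 / 24 + t 1 * Complex.exp (t 2)

/-- The flat metric `η_{αβ} = ∂_1 ∂_α ∂_β F` of `potentialA2`: `η_{13} = η_{22} = η_{31} = 1`, and
the other entries vanish (see `pd_potentialA2_eq_metricA2`). -/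
def metricA2 : Matrix (Fin 3) (Fin 3) ℂ := !![0, 0, 1; 0, 1, 0; 1, 0, 0]

/-- The entries of `metricA2` are the third derivatives `∂_1 ∂_α ∂_β` of `potentialA2`. -/
theorem pd_potentialA2_eq_metricA2 (t : Fin 3 → ℂ) (α β : Fin 3) :
    pd 0 (pd α (pd β potentialA2)) t = metricA2 α β := by
  have h0 : pd 0 potentialA2 = fun t => t 0 * t 2 + (t 1) ^ 2 / 2 := by
    funext t
    have h : HasDerivAt (fun z : ℂ => z ^ 2 * t 2 / 2 + z * (t 1) ^ 2 / 2 - (t 1) ^ 4 / 24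
        + t 1 * Complex.exp (t 2)) (t 0 * t 2 + (t 1) ^ 2 / 2) (t 0) := by
      have h := (((((hasDerivAt_id (t 0)).pow 2).mul_const (t 2 / 2)).add
        ((hasDerivAt_id (t 0)).mul_const ((t 1) ^ 2 / 2))).add_const
          (-((t 1) ^ 4 / 24) + t 1 * Complex.exp (t 2)))
      refine (h.congr_deriv (by simp; try ring)).congr_of_eventuallyEq
        (Filter.Eventually.of_forall fun z => ?_)
      simp; ring
    simpa [pd, potentialA2] using h.deriv
  have h1 : pd 1 potentialA2 = fun t => t 0 * t 1 - (t 1) ^ 3 / 6 + Complex.exp (t 2) := by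
    funext t
    have h : HasDerivAt (fun z : ℂ => (t 0) ^ 2 * t 2 / 2 + t 0 * z ^ 2 / 2 - z ^ 4 / 24
        + z * Complex.exp (t 2)) (t 0 * t 1 - (t 1) ^ 3 / 6 + Complex.exp (t 2)) (t 1) := by
      have h := (((((hasDerivAt_id (t 1)).pow 2).mul_const (t 0 / 2)).sub
        (((hasDerivAt_id (t 1)).pow 4).mul_const (1 / 24))).add
          ((hasDerivAt_id (t 1)).mul_const (Complex.exp (t 2)))).add_const ((t 0) ^ 2 * t 2 / 2)
      refine (h.congr_deriv (by simp; try ring)).congr_of_eventuallyEq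
        (Filter.Eventually.of_forall fun z => ?_)
      simp; ring
    simpa [pd, potentialA2] using h.deriv
  have h2 : pd 2 potentialA2 = fun t => (t 0) ^ 2 / 2 + t 1 * Complex.exp (t 2) := by
    funext t
    have h : HasDerivAt (fun z : ℂ => (t 0) ^ 2 * z / 2 + t 0 * (t 1) ^ 2 / 2 - (t 1) ^ 4 / 24
        + t 1 * Complex.exp z) ((t 0) ^ 2 / 2 + t 1 * Complex.exp (t 2)) (t 2) := by
      have h := (((hasDerivAt_id (t 2)).mul_const ((t 0) ^ 2 / 2)).add
        ((Complex.hasDerivAt_exp (t 2)).const_mul (t 1))).add_const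
          (t 0 * (t 1) ^ 2 / 2 - (t 1) ^ 4 / 24)
      refine (h.congr_deriv (by simp; try ring)).congr_of_eventuallyEq
        (Filter.Eventually.of_forall fun z => ?_)
      simp; ring
    simpa [pd, potentialA2] using h.deriv
  have e : ∀ x y : ℂ, deriv (fun z : ℂ => x * z - z ^ 3 / 6) y = x - y ^ 2 / 2 := by
    intro x y
    have h := ((hasDerivAt_id y).const_mul x).sub (((hasDerivAt_id y).pow 3).div_const 6)
    refine HasDerivAt.deriv ((h.congr_deriv ?_).congr_of_eventuallyEq
        (Filter.Eventually.of_forall fun z => ?_))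
    · simp; ring
    · simp
  fin_cases α <;> fin_cases β <;>
    simp [h0, h1, h2] <;>
    simp [pd, metricA2, e]

/-! ### The coefficients of the quadratic recursions -/

def cA (k q : ℕ) : ℂ :=
  ∑ j ∈ Finset.range (q + 1),
    (-1) ^ k * (2 : ℂ) ^ (-(j : ℤ) + 2 * k - 2) / (j ! * (2 * k)! * (q - j)!)

def cB (k q m r j : ℕ) : ℂ :=
  (36 * (r : ℂ) ^ 2 - 72 * r + 35) * (2 * (r : ℂ) - 1) ^ j * (-1) ^ (k + m)
    * (2 : ℂ) ^ (-(j : ℤ) + 2 * k - 2 * r + 3) * (2 * (m : ℂ) - 1) ^ (2 * (k : ℤ) - 2 * r + 4)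
    / (j ! * (2 * k)! * (q - j)!)

def cC (k q s t i j : ℕ) : ℂ :=
  (-1) ^ (k + 1) * (1 - 2 * (t : ℂ)) * (-2 * (i : ℂ) + 2 * k + 1)
    * (2 : ℂ) ^ (-2 * (i : ℤ) - j + 4 * k - 5) * (t : ℂ) ^ (q - j)
    * (s : ℂ) ^ (-2 * ((i : ℤ) - k + t - 2))
    / ((2 * i)! * j ! * (2 * k + 1 - 2 * i)! * (q - j)!)

def cD (k q s t i j : ℕ) : ℂ :=
  (-1) ^ (k + 1) * (2 * (t : ℂ) - 1) * (-(i : ℂ) + k + 1) * (t : ℂ) ^ (j + 1)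
    * (s : ℂ) ^ (2 * (i : ℤ) - 2 * t + 2) * (2 : ℂ) ^ (2 * (i : ℤ) + j + 2 * k - q - 5)
    / ((2 * i - 1)! * j ! * (2 * k + 2 - 2 * i)! * (q - j)!)

def cE (k q s t m r i j : ℕ) : ℂ :=
  (-1) ^ (k + m) * (2 * (r : ℂ) - 2 * t - 1) * (-2 * (i : ℂ) + 2 * k + 1)
    * (2 * (r : ℂ) - 1) ^ (j + 1) * (2 * (m : ℂ) - 1) ^ (2 * (i : ℤ) - 2 * r + 4)
    * (2 : ℂ) ^ (-2 * (i : ℤ) - j + 4 * k - 2 * r) * (s : ℂ) ^ (-2 * ((i : ℤ) - k + t - 2))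
    * (t : ℂ) ^ (q - j)
    / ((2 * i)! * j ! * (2 * k + 1 - 2 * i)! * (q - j)!)

def cF (k q s t m r i j : ℕ) : ℂ :=
  (-1) ^ (k + m) * (-2 * (r : ℂ) + 2 * t + 1) * (-(i : ℂ) + k + 1)
    * (2 * (r : ℂ) - 1) ^ (q - j) * (2 * (m : ℂ) - 1) ^ (-2 * (i : ℤ) + 2 * k - 2 * r + 6)
    * (2 : ℂ) ^ (2 * (i : ℤ) + j + 2 * k - q - 2 * r) * (s : ℂ) ^ (2 * (i : ℤ) - 2 * t + 2)
    * (t : ℂ) ^ (j + 1)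
    / ((2 * i - 1)! * j ! * (2 * k + 2 - 2 * i)! * (q - j)!)

def cG (k q m r j : ℕ) : ℂ :=
  (-1) ^ (k + 1) * (16 : ℂ) ^ ((k : ℤ) - 1) * (9 * (r : ℂ) ^ 2 - 9 * r + 2) * (r : ℂ) ^ j
    * (m : ℂ) ^ (2 * (k : ℤ) - 2 * r + 4)
    / (j ! * (2 * k + 1)! * (q - j)!)

def cH (k q m r i j : ℕ) : ℂ :=
  (-1) ^ (k + m + 1) * (2 : ℂ) ^ (2 * (k : ℤ) - q - 2 * r + 8) * ((r : ℂ) - 1)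
    * (-(i : ℂ) + k + 1) * (2 * (r : ℂ) - 1) ^ (j + 1)
    * (2 * (m : ℂ) - 1) ^ (2 * (i : ℤ) - 2 * r + 4)
    / ((2 * i)! * j ! * (2 * k + 2 - 2 * i)! * (q - j)!)

def cI (k q s t i j : ℕ) : ℂ :=
  (-1) ^ (k + s + 1) * (2 : ℂ) ^ (2 * (k : ℤ) - q - 2 * t + 8) * (1 - (t : ℂ))
    * (-(i : ℂ) + k + 1) * (2 * (t : ℂ) - 1) ^ (q - j)
    * (2 * (s : ℂ) - 1) ^ (-2 * (i : ℤ) + 2 * k - 2 * t + 6)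
    / ((2 * i)! * j ! * (2 * k + 2 - 2 * i)! * (q - j)!)

def cJ (k q m r s t i j : ℕ) : ℂ :=
  (-1) ^ (k + 1) * (2 : ℂ) ^ (4 * (k : ℤ) - 7) * ((r : ℂ) - t) * (r : ℂ) ^ (j + 1)
    * (m : ℂ) ^ (2 * (i : ℤ) - 2 * r + 4) * (t : ℂ) ^ (q - j)
    * (s : ℂ) ^ (-2 * ((i : ℤ) - k + t - 2))
    / ((2 * i + 1)! * j ! * (2 * k - 2 * i)! * (q - j)!)

def cK (k q m r s t i j : ℕ) : ℂ :=
  (-1) ^ (k + m + s) * (2 : ℂ) ^ (2 * (k : ℤ) - q - 2 * r - 2 * t + 13) * ((r : ℂ) - t)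
    * (-(i : ℂ) + k + 1) * (2 * (r : ℂ) - 1) ^ (j + 1)
    * (2 * (m : ℂ) - 1) ^ (2 * (i : ℤ) - 2 * r + 4) * (2 * (t : ℂ) - 1) ^ (q - j)
    * (2 * (s : ℂ) - 1) ^ (-2 * (i : ℤ) + 2 * k - 2 * t + 6)
    / ((2 * i)! * j ! * (2 * k + 2 - 2 * i)! * (q - j)!)

/-- The left-hand side of the relation for `p = 2k`. -/
def evenRelation (b d : ℕ → ℕ → ℂ) (k q : ℕ) : ℂ :=
  cA k q
  + ∑ j ∈ Finset.range (q + 1), ∑ r ∈ Finset.Icc 2 (k + 1), ∑ m ∈ Finset.Icc 1 r,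
      cB k q m r j * d m r
  + ∑ i ∈ Finset.range (k + 1), ∑ j ∈ Finset.range (q + 1),
      ∑ t ∈ Finset.Icc 1 (k + 1 - i), ∑ s ∈ Finset.Icc 1 t,
      cC k q s t i j * b s t
  + ∑ i ∈ Finset.range (k + 1), ∑ j ∈ Finset.range (q + 1),
      ∑ t ∈ Finset.Icc 1 i, ∑ s ∈ Finset.Icc 1 t,
      cD k q s t i j * b s t
  + ∑ i ∈ Finset.range (k + 1), ∑ j ∈ Finset.range (q + 1),
      ∑ t ∈ Finset.Icc 1 (k + 1 - i), ∑ s ∈ Finset.Icc 1 t,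
      ∑ r ∈ Finset.Icc 2 (i + 1), ∑ m ∈ Finset.Icc 1 r,
      cE k q s t m r i j * b s t * d m r
  + ∑ i ∈ Finset.range (k + 1), ∑ j ∈ Finset.range (q + 1),
      ∑ t ∈ Finset.Icc 1 i, ∑ s ∈ Finset.Icc 1 t,
      ∑ r ∈ Finset.Icc 2 (k + 2 - i), ∑ m ∈ Finset.Icc 1 r,
      cF k q s t m r i j * b s t * d m r

/-- The left-hand side of the relation for `p = 2k + 1`. -/
def oddRelation (b d : ℕ → ℕ → ℂ) (k q : ℕ) : ℂ :=
  ∑ j ∈ Finset.range (q + 1), ∑ r ∈ Finset.Icc 1 (k + 1), ∑ m ∈ Finset.Icc 1 r,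
      cG k q m r j * b m r
  + ∑ i ∈ Finset.range (k + 1), ∑ j ∈ Finset.range (q + 1),
      ∑ r ∈ Finset.Icc 2 (i + 1), ∑ m ∈ Finset.Icc 1 r,
      cH k q m r i j * d m r
  + ∑ i ∈ Finset.range (k + 1), ∑ j ∈ Finset.range (q + 1),
      ∑ t ∈ Finset.Icc 2 (k + 2 - i), ∑ s ∈ Finset.Icc 1 t,
      cI k q s t i j * d s t
  + ∑ i ∈ Finset.range (k + 1), ∑ j ∈ Finset.range (q + 1),
      ∑ r ∈ Finset.Icc 1 (i + 1), ∑ t ∈ Finset.Icc 1 (k + 1 - i),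
      ∑ m ∈ Finset.Icc 1 r, ∑ s ∈ Finset.Icc 1 t,
      cJ k q m r s t i j * b m r * b s t
  + ∑ i ∈ Finset.range (k + 1), ∑ j ∈ Finset.range (q + 1),
      ∑ r ∈ Finset.Icc 2 (i + 1), ∑ t ∈ Finset.Icc 2 (k + 2 - i),
      ∑ m ∈ Finset.Icc 1 r, ∑ s ∈ Finset.Icc 1 t,
      cK k q m r s t i j * d m r * d s t

/-- The arrays `b_{i,j}`, `d_{i,j}` satisfy the recursion. Only entries with `1 ≤ i ≤ j` occur. -/
structure SatisfiesRecursion (b d : ℕ → ℕ → ℂ) : Prop where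
  b_one_one : b 1 1 = -8
  d_one_one : d 1 1 = 1
  even : ∀ k q : ℕ, evenRelation b d k q = 0
  odd : ∀ k q : ℕ, oddRelation b d k q = 0

/-- The coefficients `a_{p,q}`. -/
def aCoeff (b d : ℕ → ℕ → ℂ) (p q : ℕ) : ℂ :=
  if Odd p then
    (-1) ^ ((p - 1) / 2) * (2 : ℂ) ^ (2 * (p : ℤ) - 6)
      * (∑ j ∈ Finset.Icc 1 ((p + 1) / 2),
          (j : ℂ) ^ q * ∑ i ∈ Finset.Icc 1 j, (i : ℂ) ^ (-2 * (j : ℤ) + p + 3) * b i j)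
      / (p ! * q !)
  else
    (-1) ^ (p / 2)
      * ((∑ j ∈ Finset.Icc 2 (p / 2 + 1),
          (2 * (j : ℂ) - 1) ^ q * ∑ i ∈ Finset.Icc 1 j,
            (-1) ^ (i + 1) * (4 * (i : ℂ) - 2) ^ (-2 * (j : ℤ) + p + 4) * d i j)
          + (2 : ℂ) ^ ((p : ℤ) - 1))
      / ((2 : ℂ) ^ ((q : ℤ) - 1) * p ! * q !)

/-- `s t^1 + (t^2)^2 ∑_{p,q ≥ 0} a_{p,q} s^p (t^3 - 3 log t^2)^q`, where `L` is the branch of the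
logarithm that is used. -/
def openPotentialA2 (b d : ℕ → ℕ → ℂ) (L : ℂ → ℂ) (t : Fin 3 → ℂ) (s : ℂ) : ℂ :=
  s * t 0 + (t 1) ^ 2 *
    ∑' pq : ℕ × ℕ, aCoeff b d pq.1 pq.2 * s ^ pq.1 * (t 2 - 3 * L (t 1)) ^ pq.2

/-- The points `(t, s)` with `t^2 ∈ U`, `|s| < σ` and `|t^3 - 3 log t^2| < ρ`. -/
def domainA2 (U : Set ℂ) (L : ℂ → ℂ) (σ ρ : ℝ) : Set ((Fin 3 → ℂ) × ℂ) :=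
  {y | y.1 1 ∈ U ∧ ‖y.2‖ < σ ∧ ‖y.1 2 - 3 * L (y.1 1)‖ < ρ}

/-- Absolute convergence of `∑ a_{p,q} s^p x^q` for `|s| ≤ σ`, `|x| ≤ ρ`. -/
def ConvergesAt (b d : ℕ → ℕ → ℂ) (σ ρ : ℝ) : Prop :=
  Summable fun pq : ℕ × ℕ => ‖aCoeff b d pq.1 pq.2‖ * σ ^ pq.1 * ρ ^ pq.2

/-- `L` is a branch of the logarithm on the open set `U` (so `0 ∉ U`). -/
structure IsLogBranchOn (L : ℂ → ℂ) (U : Set ℂ) : Prop where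
  isOpen : IsOpen U
  continuousOn : ContinuousOn L U
  exp_eq : ∀ z ∈ U, Complex.exp (L z) = z

end OpenWDVV

end

open scoped Nat

noncomputable section

namespace OpenWDVV

/-! ### Coefficients in x read off through y = e^(x/2), and the polynomials multiplying s^p. -/

section


/-! Put x = t^3 - 3 log t^2, y = e^(x/2) and Ψ(s, x) = ∑ a_{p,q} s^p x^q. Since e^(t^3) = (t^2)^3
e^x, a power of t^2 factors out of every open WDVV equation for s t^1 + (t^2)^2 Ψ, and what remains
is the symmetry of the mixed partials together with five equations for Ψ (`ReducedEquations`).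

The recursion encodes only one of the five, `eq₅`, which can be written e^x (9 Ψ_xx - 9 Ψ_x + 2 Ψ) +
2 (Ψ_xx Ψ_s - Ψ_x Ψ_xs) = 0. Indeed a_{p,q} is the coefficient of x^q in a polynomial f_p(y)
(`sPoly`), and each relation is, up to sign, one coefficient in s and x of that equation
(`evenRelation_eq`, `oddRelation_eq`). Exponentials e^(nx/2) are independent, so letting q vary
gives identities of polynomials in y (`satisfiesRecursion_iff`).

Uniqueness: f_0 = y, and the s^p coefficient of the equation contains f_{p+1} only through y
(f_{p+1} - y f_{p+1}'). This fixes every coefficient of f_{p+1} except that of y, which is built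
into `sPoly` as the expansion of cos 2s (`pdeCoeff_unique`). The arrays b, d are then recovered from
the f_p by a Vandermonde argument.

Existence: let v solve v - v^3 = u with v(0) = 1, and let h be the primitive of v with h(0) = 0. A
quadratic differential identity for h (`euler_identity`) makes cot(2s) h(y sin 2s) a solution
(`pdeCoeff_yPoly`). Its y^n coefficient h_n sin(2s)^(n-1) cos 2s is a finite combination of the
sin(4is) or of the cos((4i-2)s), and these combinations define b and d (`exists_recursion`).

By uniqueness Ψ is this solution. With W = v(y sin 2s) it reads Ψ = y cos(2s) (1 + 3 W^2) / (4 W). A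
weighted ℓ¹ estimate gives convergence near 0, where all partial derivatives are rational in W, y
and cos 2s, so every reduced equation becomes algebraic (`eventually_reducedEquations`). The
identity theorem carries the equations to any polydisc of absolute convergence. -/

open Polynomial in
/-- The functional `y ^ n ↦ (n / 2) ^ q / q!`: the coefficient of `x ^ q` after substituting
`y = e ^ (x / 2)`. -/
def moment (q : ℕ) : ℂ[X] →ₗ[ℂ] ℂ :=
  Polynomial.lsum fun n => (((n : ℂ) / 2) ^ q / q !) • LinearMap.id

open Polynomial in
/-- The Euler operator `y d/dy`. -/
def euler : ℂ[X] →ₗ[ℂ] ℂ[X] :=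
  (LinearMap.mulLeft ℂ X).comp Polynomial.derivative

open Polynomial in
theorem moment_C_mul_X_pow (q n : ℕ) (a : ℂ) :
    moment q (C a * X ^ n) = a * (((n : ℂ) / 2) ^ q / q !) := by
  rw [C_mul_X_pow_eq_monomial, moment, Polynomial.lsum_apply, Polynomial.sum_monomial_index] <;>
  simp [mul_comm]

open Polynomial in
theorem euler_C_mul_X_pow (n : ℕ) (a : ℂ) :
    euler (C a * X ^ n) = C (n * a) * X ^ n := by
  cases n with
  | zero => simp [euler]
  | succ n => simp [euler]; ring

open Polynomial in
theorem coeff_euler (f : ℂ[X]) (n : ℕ) : (euler f).coeff n = n * f.coeff n := by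
  cases n with
  | zero => simp [euler]
  | succ n => simp [euler, coeff_derivative]; ring

open Polynomial in
/-- The coefficient of `s ^ p` in `e ^ x (9 f_xx - 9 f_x + 2 f) + 2 (f_xx f_s - f_x f_xs)`,
where `f = ∑ f_p s ^ p`, `y = e ^ (x / 2)`. -/
def pdeCoeff (f : ℕ → ℂ[X]) (p : ℕ) : ℂ[X] :=
  C (1 / 4) * X ^ 2 * (9 * euler (euler (f p)) - 18 * euler (f p) + 8 * f p)
    + ∑ ij ∈ Finset.HasAntidiagonal.antidiagonal p, C (((ij.2 : ℂ) + 1) / 2)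
      * (euler (euler (f ij.1)) * f (ij.2 + 1) - euler (f ij.1) * euler (f (ij.2 + 1)))

theorem exp_coeff_add (q : ℕ) (x y : ℂ) :
    (x + y) ^ q / q ! = ∑ j ∈ Finset.range (q + 1), x ^ j * y ^ (q - j) / (j ! * (q - j)!) := by
  rw [add_pow, Finset.sum_div]
  refine Finset.sum_congr rfl fun j hj => ?_
  have hj' : j ≤ q := Nat.lt_succ_iff.mp (Finset.mem_range.mp hj)
  rw [Nat.cast_choose ℂ hj']
  have := Nat.factorial_ne_zero q
  field_simp

open Polynomial in
-- On monomials y^a, y^b the bilinear expression is a (a - b) y^(a+b). The sum over j of the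
-- recursion is the binomial expansion of ((a + b)/2)^q.
theorem moment_bilinear (q : ℕ) (R T : Finset ℕ) (a b : ℕ → ℕ) (D B : ℕ → ℂ) (w : ℂ) :
    moment q (C w * (euler (euler (∑ r ∈ R, C (D r) * X ^ a r)) * (∑ t ∈ T, C (B t) * X ^ b t)
      - euler (∑ r ∈ R, C (D r) * X ^ a r) * euler (∑ t ∈ T, C (B t) * X ^ b t)))
    = ∑ r ∈ R, ∑ t ∈ T, ∑ j ∈ Finset.range (q + 1), w * D r * B t * a r * ((a r : ℂ) - b t)
        * (((a r : ℂ) / 2) ^ j * ((b t : ℂ) / 2) ^ (q - j) / (j ! * (q - j)!)) := by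
  simp only [map_sum, euler_C_mul_X_pow]
  rw [Finset.sum_mul_sum, Finset.sum_mul_sum]
  simp only [← Finset.sum_sub_distrib, Finset.mul_sum, map_sum]
  refine Finset.sum_congr rfl fun r _ => Finset.sum_congr rfl fun t _ => ?_
  have : C w * (C ((a r : ℂ) * (a r * D r)) * X ^ a r * (C (B t) * X ^ b t)
      - C (a r * D r) * X ^ a r * (C (b t * B t) * X ^ b t))
      = C (w * D r * B t * a r * ((a r : ℂ) - b t)) * X ^ (a r + b t) := by
    simp only [C_mul, C_sub, pow_add]; ring
  rw [this, moment_C_mul_X_pow, ← Finset.mul_sum, ← exp_coeff_add]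
  push_cast; rw [add_div]

open Polynomial in
-- The symbol factors as 9a^2 - 18a + 8 = (3a - 2)(3a - 4), and the factor y^2 = e^x replaces a/2 by
-- a/2 + 1, expanded binomially in j.
theorem moment_linear (q : ℕ) (R : Finset ℕ) (a : ℕ → ℕ) (D : ℕ → ℂ) :
    moment q (C (1 / 4) * X ^ 2 * (9 * euler (euler (∑ r ∈ R, C (D r) * X ^ a r))
      - 18 * euler (∑ r ∈ R, C (D r) * X ^ a r) + 8 * ∑ r ∈ R, C (D r) * X ^ a r))
    = ∑ r ∈ R, ∑ j ∈ Finset.range (q + 1), 1 / 4 * (3 * (a r : ℂ) - 2) * (3 * (a r : ℂ) - 4) * D r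
        * (((a r : ℂ) / 2) ^ j / (j ! * (q - j)!)) := by
  simp only [map_sum, euler_C_mul_X_pow, Finset.mul_sum, ← Finset.sum_sub_distrib,
    ← Finset.sum_add_distrib]
  refine Finset.sum_congr rfl fun r _ => ?_
  have : C (1 / 4 : ℂ) * X ^ 2 * (9 * (C ((a r : ℂ) * (a r * D r)) * X ^ a r)
      - 18 * (C (a r * D r) * X ^ a r) + 8 * (C (D r) * X ^ a r))
      = C (1 / 4 * (3 * (a r : ℂ) - 2) * (3 * (a r : ℂ) - 4) * D r) * X ^ (a r + 2) := by
    have h : (1 / 4 * (3 * (a r : ℂ) - 2) * (3 * (a r : ℂ) - 4) * D r)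
      = 1 / 4 * (9 * (a r * (a r * D r)) - 18 * (a r * D r) + 8 * D r) := by ring
    rw [h]; simp only [C_mul, C_sub, C_add, pow_add, C_ofNat]; ring
  rw [this, moment_C_mul_X_pow, ← Finset.mul_sum]
  congr 1
  push_cast
  rw [add_div, div_self two_ne_zero, exp_coeff_add]
  simp

/-- The coefficient of `y ^ (2 r - 1) s ^ (2 l)`. -/
def dPart (d : ℕ → ℕ → ℂ) (r l : ℕ) : ℂ :=
  if r = 1 then (-1) ^ l * 2 ^ (2 * l) / (2 * l)! else
    (-1) ^ (l + 1) * (2 : ℂ) ^ (2 * (l : ℤ) + 5 - 2 * r) / (2 * l)!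
      * ∑ m ∈ Finset.Icc 1 r, (-1) ^ m * (2 * (m : ℂ) - 1) ^ (2 * (l : ℤ) - 2 * r + 4) * d m r

/-- The coefficient of `y ^ (2 t) s ^ (2 l + 1)`. -/
def bPart (b : ℕ → ℕ → ℂ) (t l : ℕ) : ℂ :=
  (-1) ^ l * (2 : ℂ) ^ (4 * (l : ℤ) - 4) / (2 * l + 1)!
    * ∑ s ∈ Finset.Icc 1 t, (s : ℂ) ^ (2 * (l : ℤ) - 2 * t + 4) * b s t

open Polynomial in
/-- The polynomial in `y` multiplying `s ^ p`. -/
def sPoly (b d : ℕ → ℕ → ℂ) (p : ℕ) : ℂ[X] :=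
  if Even p then ∑ r ∈ Finset.Icc 1 (p / 2 + 1), C (dPart d r (p / 2)) * X ^ (2 * r - 1)
  else ∑ t ∈ Finset.Icc 1 (p / 2 + 1), C (bPart b t (p / 2)) * X ^ (2 * t)

open Polynomial in
theorem sPoly_even (b d : ℕ → ℕ → ℂ) (l : ℕ) :
    sPoly b d (2 * l) = ∑ r ∈ Finset.Icc 1 (l + 1), C (dPart d r l) * X ^ (2 * r - 1) := by
  simp [sPoly]

open Polynomial in
theorem sPoly_odd (b d : ℕ → ℕ → ℂ) (l : ℕ) :
    sPoly b d (2 * l + 1) = ∑ t ∈ Finset.Icc 1 (l + 1), C (bPart b t l) * X ^ (2 * t) := by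
  have : (2 * l + 1) / 2 = l := by omega
  simp [sPoly, this]

end

/-! ### Each coefficient family of the recursion as a product of coefficients of the f_p. -/

section


/-- The sum over `m` in `dPart`. -/
def dSum (d : ℕ → ℕ → ℂ) (r l : ℕ) : ℂ :=
  ∑ m ∈ Finset.Icc 1 r, (-1) ^ m * (2 * (m : ℂ) - 1) ^ (2 * (l : ℤ) - 2 * r + 4) * d m r

/-- The sum over `s` in `bPart`. -/
def bSum (b : ℕ → ℕ → ℂ) (t l : ℕ) : ℂ :=
  ∑ s ∈ Finset.Icc 1 t, (s : ℂ) ^ (2 * (l : ℤ) - 2 * t + 4) * b s t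

theorem dSum_def (d : ℕ → ℕ → ℂ) (r l : ℕ) : dSum d r l =
    ∑ m ∈ Finset.Icc 1 r, (-1) ^ m * (2 * (m : ℂ) - 1) ^ (2 * (l : ℤ) - 2 * r + 4) * d m r :=
  rfl

theorem bSum_def (b : ℕ → ℕ → ℂ) (t l : ℕ) : bSum b t l =
    ∑ s ∈ Finset.Icc 1 t, (s : ℂ) ^ (2 * (l : ℤ) - 2 * t + 4) * b s t :=
  rfl

theorem dPart_one (d : ℕ → ℕ → ℂ) (l : ℕ) : dPart d 1 l = (-1) ^ l * 2 ^ (2 * l) / (2 * l)! :=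
  if_pos rfl

theorem dPart_of_ne_one (d : ℕ → ℕ → ℂ) {r : ℕ} (hr : r ≠ 1) (l : ℕ) :
    dPart d r l = (-1) ^ (l + 1) * (2 : ℂ) ^ (2 * (l : ℤ) + 5 - 2 * r) / (2 * l)! * dSum d r l :=
  if_neg hr

theorem bPart_eq (b : ℕ → ℕ → ℂ) (t l : ℕ) :
    bPart b t l = (-1) ^ l * (2 : ℂ) ^ (4 * (l : ℤ) - 4) / (2 * l + 1)! * bSum b t l :=
  rfl

/-- Differentiating s^(2l+1) lowers the factorial; the family `cJ` is written with (2l)! in this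
way. -/
theorem mul_bPart (b : ℕ → ℕ → ℂ) (t l : ℕ) : (2 * (l : ℂ) + 1) * bPart b t l
    = (-1) ^ l * (2 : ℂ) ^ (4 * (l : ℤ) - 4) / (2 * l)! * bSum b t l := by
  have h1 : (2 * (l : ℂ) + 1) ≠ 0 := by exact_mod_cast Nat.succ_ne_zero (2 * l)
  have h3 : ((2 * l)! : ℂ) ≠ 0 := by exact_mod_cast (2 * l).factorial_ne_zero
  rw [bPart_eq, Nat.factorial_succ]
  push_cast
  rw [mul_comm (2 * (l : ℂ) + 1) ((2 * l)! : ℂ), ← div_div]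
  field_simp

theorem cA_eq_sum (d : ℕ → ℕ → ℂ) (k q : ℕ) :
    cA k q = -∑ j ∈ Finset.range (q + 1), 1 / 4 * (3 * 1 - 2) * (3 * 1 - 4) * dPart d 1 k
      * ((1 / 2) ^ j / (j ! * (q - j)!)) := by
  rw [cA, ← Finset.sum_neg_distrib]
  refine Finset.sum_congr rfl fun j _ => ?_
  rw [dPart_one]
  have h2 : (2 : ℂ) ≠ 0 := two_ne_zero
  simp only [zpow_add₀ h2, zpow_sub₀ h2, zpow_neg, zpow_mul, zpow_natCast, zpow_ofNat,
    div_pow, pow_mul, one_pow]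
  field_simp
  ring

theorem sum_cB_mul (d : ℕ → ℕ → ℂ) (k q j r : ℕ) (hr : r ≠ 1) :
    ∑ m ∈ Finset.Icc 1 r, cB k q m r j * d m r
      = -(1 / 4 * (3 * (2 * (r : ℂ) - 1) - 2) * (3 * (2 * (r : ℂ) - 1) - 4) * dPart d r k
        * (((2 * (r : ℂ) - 1) / 2) ^ j / (j ! * (q - j)!))) := by
  have h : ∀ m : ℕ, cB k q m r j * d m r
      = ((36 * (r : ℂ) ^ 2 - 72 * r + 35) * (2 * (r : ℂ) - 1) ^ j * (-1) ^ k
        * (2 : ℂ) ^ (-(j : ℤ) + 2 * k - 2 * r + 3) / (j ! * (2 * k)! * (q - j)!))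
            * (((-1) ^ m * (2 * (m : ℂ) - 1) ^ (2 * ((k : ℕ) : ℤ) - 2 * r + 4) * d m r)) := by
    intro m
    rw [cB, pow_add (-1 : ℂ) k m]; ring
  simp only [h, ← Finset.mul_sum]
  rw [← dSum_def d r k, dPart_of_ne_one d hr]
  generalize dSum d r k = w0
  have h2 : (2 : ℂ) ≠ 0 := two_ne_zero
  simp only [zpow_add₀ h2, zpow_sub₀ h2, zpow_neg, zpow_mul, zpow_natCast, zpow_ofNat, div_pow,
      pow_add,
    pow_one]
  ring

/-- Writing k = i + l and q = j + e removes the truncated subtractions. `cC` and `cE` pair y^(2r-1)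
from f_{2i} with y^(2t) from f_{2l+1}; `cC` is the case r = 1, where the coefficient is explicit. -/
theorem sum_cC_mul (b d : ℕ → ℕ → ℂ) (i l j e t : ℕ) :
    ∑ s ∈ Finset.Icc 1 t, cC (i + l) (j + e) s t i j * b s t
      = -((2 * (l : ℂ) + 1) / 2 * dPart d 1 i * bPart b t l * 1 * (1 - 2 * t)
        * ((1 / 2) ^ j * (2 * (t : ℂ) / 2) ^ e / (j ! * e !))) := by
  have ht : 2 * (t : ℂ) / 2 = t := by ring
  rw [ht]
  have h : ∀ s : ℕ, cC (i + l) (j + e) s t i j * b s t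
      = ((-1) ^ (i + l + 1) * (1 - 2 * (t : ℂ)) * (2 * l + 1)
        * (2 : ℂ) ^ (2 * (i : ℤ) - j + 4 * l - 5) * t ^ e / ((2 * i)! * j ! * (2 * l + 1)! * e !))
            * (((s : ℂ) ^ (2 * ((l : ℕ) : ℤ) - 2 * t + 4) * b s t)) := by
    intro s
    have e1 : 2 * (i + l) + 1 - 2 * i = 2 * l + 1 := by omega
    have e2 : j + e - j = e := by omega
    have e3 : -2 * ((i : ℤ) - ((i + l : ℕ) : ℤ) + t - 2) = 2 * (l : ℤ) - 2 * t
        + 4 := by push_cast; ring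
    have e4 : -2 * (i : ℤ) - j + 4 * ((i + l : ℕ) : ℤ) - 5 = 2 * (i : ℤ) - j + 4 * l
        - 5 := by push_cast; ring
    rw [cC, e1, e2, e3, e4]
    push_cast; ring
  simp only [h, ← Finset.mul_sum]
  rw [← bSum_def b t l, dPart_one, bPart_eq]
  generalize bSum b t l = w0
  have h2 : (2 : ℂ) ≠ 0 := two_ne_zero
  simp only [zpow_add₀ h2, zpow_sub₀ h2, zpow_mul, zpow_natCast, zpow_ofNat, div_pow, pow_add,
      pow_mul,
    one_pow, pow_one]
  ring

theorem sum_cE_mul (b d : ℕ → ℕ → ℂ) (i l j e t r : ℕ) (hr : r ≠ 1) :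
    ∑ s ∈ Finset.Icc 1 t, ∑ m ∈ Finset.Icc 1 r, cE (i + l) (j + e) s t m r i j * b s t * d m r
      = -((2 * (l : ℂ) + 1) / 2 * dPart d r i * bPart b t l * (2 * (r : ℂ) - 1)
        * ((2 * (r : ℂ) - 1) - 2 * t)
        * (((2 * (r : ℂ) - 1) / 2) ^ j * (2 * (t : ℂ) / 2) ^ e / (j ! * e !))) := by
  have ht : 2 * (t : ℂ) / 2 = t := by ring
  rw [ht]
  have h : ∀ s m : ℕ, cE (i + l) (j + e) s t m r i j * b s t * d m r
      = ((-1) ^ (i + l) * (2 * (r : ℂ) - 2 * t - 1) * (2 * l + 1) * (2 * (r : ℂ) - 1) ^ (j + 1)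
        * (2 : ℂ) ^ (2 * (i : ℤ) - j + 4 * l - 2 * r) * t ^ e
        / ((2 * i)! * j ! * (2 * l + 1)! * e !)) * (((s : ℂ) ^ (2 * ((l : ℕ) : ℤ) - 2 * t + 4)
            * b s t) * ((-1) ^ m * (2 * (m : ℂ) - 1) ^ (2 * ((i : ℕ) : ℤ) - 2 * r + 4)
            * d m r)) := by
    intro s m
    have e1 : 2 * (i + l) + 1 - 2 * i = 2 * l + 1 := by omega
    have e2 : j + e - j = e := by omega
    have e3 : -2 * ((i : ℤ) - ((i + l : ℕ) : ℤ) + t - 2) = 2 * (l : ℤ) - 2 * t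
        + 4 := by push_cast; ring
    have e4 : -2 * (i : ℤ) - j + 4 * ((i + l : ℕ) : ℤ) - 2 * r = 2 * (i : ℤ) - j + 4 * l - 2
        * r := by push_cast; ring
    rw [cE, e1, e2, e3, e4, pow_add (-1 : ℂ) (i + l) m]
    push_cast; ring
  simp only [h, ← Finset.mul_sum, ← Finset.sum_mul]
  rw [← bSum_def b t l, ← dSum_def d r i, dPart_of_ne_one d hr, bPart_eq]
  generalize bSum b t l = w0
  generalize dSum d r i = w1
  have h2 : (2 : ℂ) ≠ 0 := two_ne_zero
  simp only [zpow_add₀ h2, zpow_sub₀ h2, zpow_mul, zpow_natCast, zpow_ofNat, div_pow, pow_add,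
    pow_one]
  ring

/-- The recursion's index is i + 1 here: `cD` and `cF` pair y^(2t) from f_{2i+1} with y^(2r-1) from
f_{2l}, with r = 1 for `cD`. -/
theorem sum_cD_mul (b d : ℕ → ℕ → ℂ) (i l j e t : ℕ) :
    ∑ s ∈ Finset.Icc 1 t, cD (i + l) (j + e) s t (i + 1) j * b s t
      = -((l : ℂ) * bPart b t i * dPart d 1 l * (2 * t) * (2 * t - 1)
        * ((2 * (t : ℂ) / 2) ^ j * (1 / 2) ^ e / (j ! * e !))) := by
  have ht : 2 * (t : ℂ) / 2 = t := by ring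
  rw [ht]
  have h : ∀ s : ℕ, cD (i + l) (j + e) s t (i + 1) j * b s t
      = ((-1) ^ (i + l + 1) * (2 * (t : ℂ) - 1) * l * (t : ℂ) ^ (j + 1)
        * (2 : ℂ) ^ (4 * (i : ℤ) + 2 * l - e - 3) / ((2 * i + 1)! * j ! * (2 * l)! * e !))
            * (((s : ℂ) ^ (2 * ((i : ℕ) : ℤ) - 2 * t + 4) * b s t)) := by
    intro s
    have e0 : 2 * (i + 1) - 1 = 2 * i + 1 := by omega
    have e1 : 2 * (i + l) + 2 - 2 * (i + 1) = 2 * l := by omega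
    have e2 : j + e - j = e := by omega
    have e3 : 2 * ((i + 1 : ℕ) : ℤ) - 2 * t + 2 = 2 * (i : ℤ) - 2 * t + 4 := by push_cast; ring
    have e4 : 2 * ((i + 1 : ℕ) : ℤ) + j + 2 * ((i + l : ℕ) : ℤ) - ((j + e : ℕ) : ℤ) - 5 = 4
        * (i : ℤ) + 2 * l - e - 3 := by push_cast; ring
    rw [cD, e0, e1, e2, e3, e4]
    push_cast; ring
  simp only [h, ← Finset.mul_sum]
  rw [← bSum_def b t i, dPart_one, bPart_eq]
  generalize bSum b t i = w0
  have h2 : (2 : ℂ) ≠ 0 := two_ne_zero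
  simp only [zpow_add₀ h2, zpow_sub₀ h2, zpow_mul, zpow_natCast, zpow_ofNat, div_pow, pow_add,
      pow_mul,
    one_pow, pow_one]
  ring

theorem sum_cF_mul (b d : ℕ → ℕ → ℂ) (i l j e t r : ℕ) (hr : r ≠ 1) :
    ∑ s ∈ Finset.Icc 1 t, ∑ m ∈ Finset.Icc 1 r,
      cF (i + l) (j + e) s t m r (i + 1) j * b s t * d m r
      = -((l : ℂ) * bPart b t i * dPart d r l * (2 * t) * (2 * t - (2 * (r : ℂ) - 1))
        * ((2 * (t : ℂ) / 2) ^ j * ((2 * (r : ℂ) - 1) / 2) ^ e / (j ! * e !))) := by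
  have ht : 2 * (t : ℂ) / 2 = t := by ring
  rw [ht]
  have h : ∀ s m : ℕ, cF (i + l) (j + e) s t m r (i + 1) j * b s t * d m r
      = ((-1) ^ (i + l) * (-2 * (r : ℂ) + 2 * t + 1) * l * (2 * (r : ℂ) - 1) ^ e * (t : ℂ) ^ (j + 1)
        * (2 : ℂ) ^ (4 * (i : ℤ) + 2 * l - e - 2 * r + 2) / ((2 * i + 1)! * j ! * (2 * l)! * e !))
            * (((s : ℂ) ^ (2 * ((i : ℕ) : ℤ) - 2 * t + 4) * b s t)
            * ((-1) ^ m * (2 * (m : ℂ) - 1) ^ (2 * ((l : ℕ) : ℤ) - 2 * r + 4) * d m r)) := by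
    intro s m
    have e0 : 2 * (i + 1) - 1 = 2 * i + 1 := by omega
    have e1 : 2 * (i + l) + 2 - 2 * (i + 1) = 2 * l := by omega
    have e2 : j + e - j = e := by omega
    have e3 : 2 * ((i + 1 : ℕ) : ℤ) - 2 * t + 2 = 2 * (i : ℤ) - 2 * t + 4 := by push_cast; ring
    have e5 : -2 * ((i + 1 : ℕ) : ℤ) + 2 * ((i + l : ℕ) : ℤ) - 2 * r + 6 = 2 * (l : ℤ) - 2 * r
        + 4 := by push_cast; ring
    have e4 : 2 * ((i + 1 : ℕ) : ℤ) + j + 2 * ((i + l : ℕ) : ℤ) - ((j + e : ℕ) : ℤ) - 2 * r = 4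
        * (i : ℤ) + 2 * l - e - 2 * r + 2 := by push_cast; ring
    rw [cF, e0, e1, e2, e3, e4, e5, pow_add (-1 : ℂ) (i + l) m]
    push_cast; ring
  simp only [h, ← Finset.mul_sum, ← Finset.sum_mul]
  rw [← bSum_def b t i, ← dSum_def d r l, dPart_of_ne_one d hr, bPart_eq]
  generalize bSum b t i = w0
  generalize dSum d r l = w1
  have h2 : (2 : ℂ) ≠ 0 := two_ne_zero
  simp only [zpow_add₀ h2, zpow_sub₀ h2, zpow_mul, zpow_natCast, zpow_ofNat, div_pow, pow_add,
    pow_one]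
  ring

theorem sum_cG_mul (b : ℕ → ℕ → ℂ) (k q j r : ℕ) :
    ∑ m ∈ Finset.Icc 1 r, cG k q m r j * b m r
      = -(1 / 4 * (3 * (2 * (r : ℂ)) - 2) * (3 * (2 * (r : ℂ)) - 4) * bPart b r k
        * ((2 * (r : ℂ) / 2) ^ j / (j ! * (q - j)!))) := by
  have hr : 2 * (r : ℂ) / 2 = r := by ring
  rw [hr]
  have h : ∀ m : ℕ, cG k q m r j * b m r
      = ((-1) ^ (k + 1) * (16 : ℂ) ^ ((k : ℤ) - 1) * (9 * (r : ℂ) ^ 2 - 9 * r + 2) * (r : ℂ) ^ j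
        / (j ! * (2 * k + 1)! * (q - j)!)) * (((m : ℂ) ^ (2 * ((k : ℕ) : ℤ) - 2 * r + 4)
            * b m r)) := by
    intro m
    rw [cG]; ring
  simp only [h, ← Finset.mul_sum]
  rw [← bSum_def b r k, bPart_eq]
  generalize bSum b r k = w0
  have h2 : (2 : ℂ) ≠ 0 := two_ne_zero
  have h16 : (16 : ℂ) ≠ 0 := by norm_num
  simp only [zpow_sub₀ h2, zpow_sub₀ h16, zpow_mul, zpow_natCast, zpow_ofNat, pow_add,
    pow_one]
  ring

/-- `cH`, `cI` and `cK` share the product of f_{2i} with f_{2l+2}, according to which of the two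
factors contributes its explicit y^1 term. -/
theorem sum_cH_mul (d : ℕ → ℕ → ℂ) (i l j e r : ℕ) (hr : r ≠ 1) :
    ∑ m ∈ Finset.Icc 1 r, cH (i + l) (j + e) m r i j * d m r
      = -(((l : ℂ) + 1) * dPart d r i * dPart d 1 (l + 1) * (2 * (r : ℂ) - 1)
        * ((2 * (r : ℂ) - 1) - 1)
        * (((2 * (r : ℂ) - 1) / 2) ^ j * (1 / 2) ^ e / (j ! * e !))) := by
  have h : ∀ m : ℕ, cH (i + l) (j + e) m r i j * d m r
      = ((-1) ^ (i + l + 1) * (2 : ℂ) ^ (2 * (i : ℤ) + 2 * l - j - e - 2 * r + 8) * ((r : ℂ) - 1)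
        * (l + 1) * (2 * (r : ℂ) - 1) ^ (j + 1)
        / ((2 * i)! * j ! * (2 * (l + 1))! * e !))
            * (((-1) ^ m * (2 * (m : ℂ) - 1) ^ (2 * ((i : ℕ) : ℤ) - 2 * r + 4) * d m r)) := by
    intro m
    have e1 : 2 * (i + l) + 2 - 2 * i = 2 * (l + 1) := by omega
    have e2 : j + e - j = e := by omega
    have e4 : 2 * ((i + l : ℕ) : ℤ) - ((j + e : ℕ) : ℤ) - 2 * r + 8 = 2 * (i : ℤ) + 2 * l - j - e
        - 2 * r + 8 := by push_cast; ring
    rw [cH, e1, e2, e4, add_right_comm, pow_add (-1 : ℂ) (i + l + 1) m]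
    push_cast; ring
  simp only [h, ← Finset.mul_sum]
  rw [← dSum_def d r i, dPart_of_ne_one d hr, dPart_one]
  generalize dSum d r i = w0
  have h2 : (2 : ℂ) ≠ 0 := two_ne_zero
  simp only [zpow_add₀ h2, zpow_sub₀ h2, zpow_mul, zpow_natCast, zpow_ofNat, div_pow, pow_add,
      pow_mul,
    one_pow, pow_one]
  ring

theorem sum_cI_mul (d : ℕ → ℕ → ℂ) (i l j e t : ℕ) (ht : t ≠ 1) :
    ∑ s ∈ Finset.Icc 1 t, cI (i + l) (j + e) s t i j * d s t
      = -(((l : ℂ) + 1) * dPart d 1 i * dPart d t (l + 1) * 1 * (1 - (2 * (t : ℂ) - 1))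
        * ((1 / 2) ^ j * ((2 * (t : ℂ) - 1) / 2) ^ e / (j ! * e !))) := by
  have h : ∀ s : ℕ, cI (i + l) (j + e) s t i j * d s t
      = ((-1) ^ (i + l + 1) * (2 : ℂ) ^ (2 * (i : ℤ) + 2 * l - j - e - 2 * t + 8) * (1 - (t : ℂ))
        * (l + 1) * (2 * (t : ℂ) - 1) ^ e
        / ((2 * i)! * j ! * (2 * (l + 1))! * e !))
            * (((-1) ^ s * (2 * (s : ℂ) - 1) ^ (2 * ((l + 1 : ℕ) : ℤ) - 2 * t + 4) * d s t)) := by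
    intro s
    have e1 : 2 * (i + l) + 2 - 2 * i = 2 * (l + 1) := by omega
    have e2 : j + e - j = e := by omega
    have e5 : -2 * (i : ℤ) + 2 * ((i + l : ℕ) : ℤ) - 2 * t + 6 = 2 * ((l + 1 : ℕ) : ℤ) - 2 * t
        + 4 := by push_cast; ring
    have e4 : 2 * ((i + l : ℕ) : ℤ) - ((j + e : ℕ) : ℤ) - 2 * t + 8 = 2 * (i : ℤ) + 2 * l - j - e
        - 2 * t + 8 := by push_cast; ring
    rw [cI, e1, e2, e4, e5, add_right_comm, pow_add (-1 : ℂ) (i + l + 1) s]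
    push_cast; ring
  simp only [h, ← Finset.mul_sum]
  rw [← dSum_def d t (l + 1), dPart_of_ne_one d ht, dPart_one]
  generalize dSum d t (l + 1) = w0
  have h2 : (2 : ℂ) ≠ 0 := two_ne_zero
  simp only [zpow_add₀ h2, zpow_sub₀ h2, zpow_mul, zpow_natCast, zpow_ofNat, div_pow, pow_add,
      pow_mul,
    one_pow, pow_one]
  ring

theorem sum_cJ_mul (b : ℕ → ℕ → ℂ) (i l j e r t : ℕ) :
    ∑ m ∈ Finset.Icc 1 r, ∑ s ∈ Finset.Icc 1 t, cJ (i + l) (j + e) m r s t i j * b m r * b s t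
      = -((2 * (l : ℂ) + 1) / 2 * bPart b r i * bPart b t l * (2 * r) * (2 * r - 2 * t)
        * ((2 * (r : ℂ) / 2) ^ j * (2 * (t : ℂ) / 2) ^ e / (j ! * e !))) := by
  have hr : 2 * (r : ℂ) / 2 = r := by ring
  have ht : 2 * (t : ℂ) / 2 = t := by ring
  rw [hr, ht]
  have h : ∀ m s : ℕ, cJ (i + l) (j + e) m r s t i j * b m r * b s t
      = ((-1) ^ (i + l + 1) * (2 : ℂ) ^ (4 * (i : ℤ) + 4 * l - 7) * ((r : ℂ) - t) * (r : ℂ) ^ (j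
          + 1)
        * (t : ℂ) ^ e / ((2 * i + 1)! * j ! * (2 * l)! * e !))
            * (((m : ℂ) ^ (2 * ((i : ℕ) : ℤ) - 2 * r + 4) * b m r) * ((s : ℂ) ^ (2 * ((l : ℕ) : ℤ)
            - 2 * t + 4) * b s t)) := by
    intro m s
    have e1 : 2 * (i + l) - 2 * i = 2 * l := by omega
    have e2 : j + e - j = e := by omega
    have e5 : -2 * ((i : ℤ) - ((i + l : ℕ) : ℤ) + t - 2) = 2 * (l : ℤ) - 2 * t
        + 4 := by push_cast; ring
    have e4 : 4 * ((i + l : ℕ) : ℤ) - 7 = 4 * (i : ℤ) + 4 * l - 7 := by push_cast; ring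
    rw [cJ, e1, e2, e4, e5]
    ring
  simp only [h, ← Finset.mul_sum, ← Finset.sum_mul]
  rw [← bSum_def b r i, ← bSum_def b t l]
  trans -(1 / 2 * bPart b r i * ((2 * (l : ℂ) + 1) * bPart b t l) * (2 * r) * (2 * r - 2 * t)
    * ((r : ℂ) ^ j * (t : ℂ) ^ e / (j ! * e !)))
  · rw [mul_bPart, bPart_eq]
    generalize bSum b r i = w0
    generalize bSum b t l = w1
    have h2 : (2 : ℂ) ≠ 0 := two_ne_zero
    simp only [zpow_add₀ h2, zpow_sub₀ h2, zpow_mul, zpow_natCast, zpow_ofNat, pow_add,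
      pow_one]
    ring
  · ring

theorem sum_cK_mul (d : ℕ → ℕ → ℂ) (i l j e r t : ℕ) (hr : r ≠ 1) (ht : t ≠ 1) :
    ∑ m ∈ Finset.Icc 1 r, ∑ s ∈ Finset.Icc 1 t, cK (i + l) (j + e) m r s t i j * d m r * d s t
      = -(((l : ℂ) + 1) * dPart d r i * dPart d t (l + 1) * (2 * (r : ℂ) - 1)
        * ((2 * (r : ℂ) - 1) - (2 * (t : ℂ) - 1))
        * (((2 * (r : ℂ) - 1) / 2) ^ j * ((2 * (t : ℂ) - 1) / 2) ^ e / (j ! * e !))) := by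
  have h : ∀ m s : ℕ, cK (i + l) (j + e) m r s t i j * d m r * d s t
      = ((-1) ^ (i + l) * (2 : ℂ) ^ (2 * (i : ℤ) + 2 * l - j - e - 2 * r - 2 * t + 13)
          * ((r : ℂ) - t)
        * (l + 1) * (2 * (r : ℂ) - 1) ^ (j + 1) * (2 * (t : ℂ) - 1) ^ e
        / ((2 * i)! * j ! * (2 * (l + 1))! * e !))
            * (((-1) ^ m * (2 * (m : ℂ) - 1) ^ (2 * ((i : ℕ) : ℤ) - 2 * r + 4) * d m r)
            * ((-1) ^ s * (2 * (s : ℂ) - 1) ^ (2 * ((l + 1 : ℕ) : ℤ) - 2 * t + 4) * d s t)) := by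
    intro m s
    have e1 : 2 * (i + l) + 2 - 2 * i = 2 * (l + 1) := by omega
    have e2 : j + e - j = e := by omega
    have e5 : -2 * (i : ℤ) + 2 * ((i + l : ℕ) : ℤ) - 2 * t + 6 = 2 * ((l + 1 : ℕ) : ℤ) - 2 * t
        + 4 := by push_cast; ring
    have e4 : 2 * ((i + l : ℕ) : ℤ) - ((j + e : ℕ) : ℤ) - 2 * r - 2 * t + 13 = 2 * (i : ℤ) + 2 * l
        - j - e - 2 * r - 2 * t + 13 := by push_cast; ring
    rw [cK, e1, e2, e4, e5, add_assoc, add_comm m s, ← add_assoc, pow_add (-1 : ℂ) (i + l + s) m,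
      pow_add (-1 : ℂ) (i + l) s]
    push_cast; ring
  simp only [h, ← Finset.mul_sum, ← Finset.sum_mul]
  rw [← dSum_def d r i, ← dSum_def d t (l + 1), dPart_of_ne_one d hr, dPart_of_ne_one d ht]
  generalize dSum d r i = w0
  generalize dSum d t (l + 1) = w1
  have h2 : (2 : ℂ) ≠ 0 := two_ne_zero
  simp only [zpow_add₀ h2, zpow_sub₀ h2, zpow_mul, zpow_natCast, zpow_ofNat, div_pow, pow_add,
    pow_one]
  ring

end

/-! ### The even relations as coefficients of the differential equation. -/

section


theorem sum_range_two_mul_add_one (F : ℕ → ℂ) (k : ℕ) :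
    ∑ x ∈ Finset.range (2 * k + 1), F x
      = ∑ i ∈ Finset.range (k + 1), F (2 * i) + ∑ i ∈ Finset.range k, F (2 * i + 1) := by
  induction k with
  | zero => simp
  | succ k ih =>
    rw [Finset.sum_range_succ _ k, Finset.sum_range_succ _ (k + 1), mul_add, mul_one,
      show 2 * k + 2 + 1 = (2 * k + 1) + 1 + 1 by ring, Finset.sum_range_succ,
      Finset.sum_range_succ, ih]
    ring_nf

theorem sum_Icc_one_succ (f : ℕ → ℂ) (n : ℕ) :
    ∑ r ∈ Finset.Icc 1 (n + 1), f r = f 1 + ∑ r ∈ Finset.Icc 2 (n + 1), f r := by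
  have : Finset.Icc 1 (n + 1) = insert 1 (Finset.Icc 2 (n + 1)) := by
    ext x; simp only [Finset.mem_Icc, Finset.mem_insert]; omega
  rw [this, Finset.sum_insert (by simp)]

theorem cast_two_mul_sub_one {r : ℕ} (hr : 1 ≤ r) : ((2 * r - 1 : ℕ) : ℂ) = 2 * r - 1 := by
  rw [Nat.cast_sub (by omega)]; push_cast; ring

theorem ne_one_of_mem_Icc_two {r n : ℕ} (hr : r ∈ Finset.Icc 2 n) : r ≠ 1 := by
  have := (Finset.mem_Icc.mp hr).1; omega

theorem moment_linear_even (d : ℕ → ℕ → ℂ) (k q : ℕ) :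
    cA k q + ∑ j ∈ Finset.range (q + 1), ∑ r ∈ Finset.Icc 2 (k + 1), ∑ m ∈ Finset.Icc 1 r,
      cB k q m r j * d m r
    = -∑ r ∈ Finset.Icc 1 (k + 1), ∑ j ∈ Finset.range (q + 1),
      1 / 4 * (3 * ((2 * r - 1 : ℕ) : ℂ) - 2) * (3 * ((2 * r - 1 : ℕ) : ℂ) - 4) * dPart d r k
        * ((((2 * r - 1 : ℕ) : ℂ) / 2) ^ j / (j ! * (q - j)!)) := by
  rw [sum_Icc_one_succ, neg_add, cA_eq_sum d, Finset.sum_comm]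
  congr 1
  · congr 1
    refine Finset.sum_congr rfl fun j _ => ?_
    norm_num
  · rw [← Finset.sum_neg_distrib]
    refine Finset.sum_congr rfl fun r hr => ?_
    rw [← Finset.sum_neg_distrib]
    refine Finset.sum_congr rfl fun j _ => ?_
    rw [sum_cB_mul d k q j r (ne_one_of_mem_Icc_two hr),
      cast_two_mul_sub_one (by have := (Finset.mem_Icc.mp hr).1; omega)]

theorem sum_cC_add_sum_cE (b d : ℕ → ℕ → ℂ) (i l q : ℕ) :
    ∑ j ∈ Finset.range (q + 1), ∑ t ∈ Finset.Icc 1 (l + 1), ∑ s ∈ Finset.Icc 1 t,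
      cC (i + l) q s t i j * b s t
    + ∑ j ∈ Finset.range (q + 1), ∑ t ∈ Finset.Icc 1 (l + 1), ∑ s ∈ Finset.Icc 1 t,
      ∑ r ∈ Finset.Icc 2 (i + 1), ∑ m ∈ Finset.Icc 1 r,
      cE (i + l) q s t m r i j * b s t * d m r
    = -∑ r ∈ Finset.Icc 1 (i + 1), ∑ t ∈ Finset.Icc 1 (l + 1), ∑ j ∈ Finset.range (q + 1),
      (2 * (l : ℂ) + 1) / 2 * dPart d r i * bPart b t l * ((2 * r - 1 : ℕ) : ℂ)
        * (((2 * r - 1 : ℕ) : ℂ) - ((2 * t : ℕ) : ℂ))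
        * ((((2 * r - 1 : ℕ) : ℂ) / 2) ^ j * (((2 * t : ℕ) : ℂ) / 2) ^ (q - j)
          / (j ! * (q - j)!)) := by
  rw [sum_Icc_one_succ, neg_add]
  congr 1
  · rw [Finset.sum_comm, ← Finset.sum_neg_distrib]
    refine Finset.sum_congr rfl fun t _ => ?_
    rw [← Finset.sum_neg_distrib]
    refine Finset.sum_congr rfl fun j hj => ?_
    obtain ⟨e, rfl⟩ := Nat.exists_eq_add_of_le (Nat.lt_succ_iff.mp (Finset.mem_range.mp hj))
    rw [sum_cC_mul b d, Nat.add_sub_cancel_left]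
    simp
  · simp only [← Finset.sum_neg_distrib]
    rw [Finset.sum_comm (s := Finset.range (q + 1))]
    rw [Finset.sum_comm (s := Finset.Icc 2 (i + 1))]
    refine Finset.sum_congr rfl fun t _ => ?_
    rw [Finset.sum_comm (s := Finset.Icc 2 (i + 1))]
    refine Finset.sum_congr rfl fun j hj => ?_
    rw [Finset.sum_comm]
    refine Finset.sum_congr rfl fun r hr => ?_
    obtain ⟨e, rfl⟩ := Nat.exists_eq_add_of_le (Nat.lt_succ_iff.mp (Finset.mem_range.mp hj))
    rw [sum_cE_mul b d _ _ _ _ _ _ (ne_one_of_mem_Icc_two hr), Nat.add_sub_cancel_left,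
      cast_two_mul_sub_one (by have := (Finset.mem_Icc.mp hr).1; omega)]
    push_cast; rfl

theorem sum_cD_add_sum_cF (b d : ℕ → ℕ → ℂ) (i l q : ℕ) :
    ∑ j ∈ Finset.range (q + 1), ∑ t ∈ Finset.Icc 1 (i + 1), ∑ s ∈ Finset.Icc 1 t,
      cD (i + l) q s t (i + 1) j * b s t
    + ∑ j ∈ Finset.range (q + 1), ∑ t ∈ Finset.Icc 1 (i + 1), ∑ s ∈ Finset.Icc 1 t,
      ∑ r ∈ Finset.Icc 2 (l + 1), ∑ m ∈ Finset.Icc 1 r,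
      cF (i + l) q s t m r (i + 1) j * b s t * d m r
    = -∑ t ∈ Finset.Icc 1 (i + 1), ∑ r ∈ Finset.Icc 1 (l + 1), ∑ j ∈ Finset.range (q + 1),
      (l : ℂ) * bPart b t i * dPart d r l * ((2 * t : ℕ) : ℂ)
        * (((2 * t : ℕ) : ℂ) - ((2 * r - 1 : ℕ) : ℂ))
        * ((((2 * t : ℕ) : ℂ) / 2) ^ j * (((2 * r - 1 : ℕ) : ℂ) / 2) ^ (q - j)
          / (j ! * (q - j)!)) := by
  rw [Finset.sum_comm, Finset.sum_comm (s := Finset.range (q + 1)), ← Finset.sum_add_distrib,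
    ← Finset.sum_neg_distrib]
  refine Finset.sum_congr rfl fun t _ => ?_
  rw [sum_Icc_one_succ, neg_add]
  congr 1
  · rw [← Finset.sum_neg_distrib]
    refine Finset.sum_congr rfl fun j hj => ?_
    obtain ⟨e, rfl⟩ := Nat.exists_eq_add_of_le (Nat.lt_succ_iff.mp (Finset.mem_range.mp hj))
    rw [sum_cD_mul b d, Nat.add_sub_cancel_left]
    simp
  · rw [Finset.sum_comm (s := Finset.Icc 2 (l + 1)), ← Finset.sum_neg_distrib]
    refine Finset.sum_congr rfl fun j hj => ?_
    rw [Finset.sum_comm, ← Finset.sum_neg_distrib]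
    refine Finset.sum_congr rfl fun r hr => ?_
    obtain ⟨e, rfl⟩ := Nat.exists_eq_add_of_le (Nat.lt_succ_iff.mp (Finset.mem_range.mp hj))
    rw [sum_cF_mul b d _ _ _ _ _ _ (ne_one_of_mem_Icc_two hr), Nat.add_sub_cancel_left,
      cast_two_mul_sub_one (by have := (Finset.mem_Icc.mp hr).1; omega)]
    push_cast; rfl

theorem moment_pdeCoeff (f : ℕ → Polynomial ℂ) (p q : ℕ) :
    moment q (pdeCoeff f p)
      = moment q (Polynomial.C (1 / 4) * Polynomial.X ^ 2
          * (9 * euler (euler (f p)) - 18 * euler (f p) + 8 * f p))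
        + ∑ x ∈ Finset.range (p + 1), moment q (Polynomial.C ((((p - x : ℕ) : ℂ) + 1) / 2)
          * (euler (euler (f x)) * f (p - x + 1) - euler (f x) * euler (f (p - x + 1)))) := by
  rw [pdeCoeff, map_add, map_sum]
  congr 1
  exact Finset.Nat.sum_antidiagonal_eq_sum_range_succ_mk _ p

theorem evenRelation_eq (b d : ℕ → ℕ → ℂ) (k q : ℕ) :
    evenRelation b d k q = -moment q (pdeCoeff (sPoly b d) (2 * k)) := by
  rw [moment_pdeCoeff, sPoly_even, moment_linear, sum_range_two_mul_add_one, neg_add, neg_add,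
    ← moment_linear_even d, ← Finset.sum_neg_distrib, ← Finset.sum_neg_distrib]
  have h1 : ∑ i ∈ Finset.range (k + 1), -moment q (Polynomial.C ((((2 * k - 2 * i : ℕ) : ℂ) + 1)
      / 2)
          * (euler (euler (sPoly b d (2 * i))) * sPoly b d (2 * k - 2 * i + 1)
            - euler (sPoly b d (2 * i)) * euler (sPoly b d (2 * k - 2 * i + 1))))
      = ∑ i ∈ Finset.range (k + 1), ∑ j ∈ Finset.range (q + 1),
      ∑ t ∈ Finset.Icc 1 (k + 1 - i), ∑ s ∈ Finset.Icc 1 t,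
      cC k q s t i j * b s t + ∑ i ∈ Finset.range (k + 1), ∑ j ∈ Finset.range (q + 1),
      ∑ t ∈ Finset.Icc 1 (k + 1 - i), ∑ s ∈ Finset.Icc 1 t,
      ∑ r ∈ Finset.Icc 2 (i + 1), ∑ m ∈ Finset.Icc 1 r,
      cE k q s t m r i j * b s t * d m r := by
    rw [← Finset.sum_add_distrib]
    refine Finset.sum_congr rfl fun i hi => ?_
    obtain ⟨l, rfl⟩ := Nat.exists_eq_add_of_le (Nat.lt_succ_iff.mp (Finset.mem_range.mp hi))
    have e1 : 2 * (i + l) - 2 * i = 2 * l := by omega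
    have e2 : i + l + 1 - i = l + 1 := by omega
    rw [e1, e2, sPoly_even, sPoly_odd, moment_bilinear, sum_cC_add_sum_cE]
    push_cast; rfl
  have h2 : ∑ i ∈ Finset.range k, -moment q (Polynomial.C ((((2 * k - (2 * i + 1) : ℕ) : ℂ) + 1)
      / 2)
          * (euler (euler (sPoly b d (2 * i + 1))) * sPoly b d (2 * k - (2 * i + 1) + 1)
            - euler (sPoly b d (2 * i + 1)) * euler (sPoly b d (2 * k - (2 * i + 1) + 1))))
      = ∑ i ∈ Finset.range (k + 1), ∑ j ∈ Finset.range (q + 1),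
      ∑ t ∈ Finset.Icc 1 i, ∑ s ∈ Finset.Icc 1 t,
      cD k q s t i j * b s t + ∑ i ∈ Finset.range (k + 1), ∑ j ∈ Finset.range (q + 1),
      ∑ t ∈ Finset.Icc 1 i, ∑ s ∈ Finset.Icc 1 t,
      ∑ r ∈ Finset.Icc 2 (k + 2 - i), ∑ m ∈ Finset.Icc 1 r,
      cF k q s t m r i j * b s t * d m r := by
    -- The i = 0 summand, where 2i - 1 truncates to 0, carries an empty sum over t, so it drops out
    -- and the index shifts by one.
    rw [← Finset.sum_add_distrib, Finset.sum_range_succ']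
    simp only [Finset.Icc_eq_empty (show ¬ (1 : ℕ) ≤ 0 by norm_num), Finset.sum_empty,
      Finset.sum_const_zero, add_zero]
    refine Finset.sum_congr rfl fun i hi => ?_
    obtain ⟨l, rfl⟩ := Nat.exists_eq_add_of_le (Finset.mem_range.mp hi).le
    have hl : i < i + l := Finset.mem_range.mp hi
    have e0 : 2 * (i + l) - (2 * i + 1) = 2 * l - 1 := by omega
    have e1 : 2 * l - 1 + 1 = 2 * l := by omega
    have e2 : i + l + 2 - (i + 1) = l + 1 := by omega
    have e3 : (((2 * l - 1 : ℕ) : ℂ) + 1) / 2 = l := by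
      rw [← Nat.cast_add_one, e1]; push_cast; ring
    rw [e0, e1, e2, e3, sPoly_even, sPoly_odd, moment_bilinear, sum_cD_add_sum_cF]
  rw [h1, h2, evenRelation]
  ring

end

/-! ### The odd relations, and the recursion as identities of polynomials in y. -/

section


theorem sum_range_two_mul_add_two (F : ℕ → ℂ) (k : ℕ) :
    ∑ x ∈ Finset.range (2 * k + 1 + 1), F x
      = ∑ i ∈ Finset.range (k + 1), F (2 * i) + ∑ i ∈ Finset.range (k + 1), F (2 * i + 1) := by
  rw [Finset.sum_range_succ, sum_range_two_mul_add_one, Finset.sum_range_succ _ k, add_assoc,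
    ← Finset.sum_range_succ (fun i => F (2 * i + 1))]

theorem moment_linear_odd (b : ℕ → ℕ → ℂ) (k q : ℕ) :
    ∑ j ∈ Finset.range (q + 1), ∑ r ∈ Finset.Icc 1 (k + 1), ∑ m ∈ Finset.Icc 1 r,
      cG k q m r j * b m r
    = -∑ r ∈ Finset.Icc 1 (k + 1), ∑ j ∈ Finset.range (q + 1),
      1 / 4 * (3 * ((2 * r : ℕ) : ℂ) - 2) * (3 * ((2 * r : ℕ) : ℂ) - 4) * bPart b r k
        * ((((2 * r : ℕ) : ℂ) / 2) ^ j / (j ! * (q - j)!)) := by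
  rw [Finset.sum_comm, ← Finset.sum_neg_distrib]
  refine Finset.sum_congr rfl fun r _ => ?_
  rw [← Finset.sum_neg_distrib]
  refine Finset.sum_congr rfl fun j _ => ?_
  rw [sum_cG_mul b k q j r]
  push_cast; rfl

theorem sum_cJ (b : ℕ → ℕ → ℂ) (i l q : ℕ) :
    ∑ j ∈ Finset.range (q + 1), ∑ r ∈ Finset.Icc 1 (i + 1), ∑ t ∈ Finset.Icc 1 (l + 1),
      ∑ m ∈ Finset.Icc 1 r, ∑ s ∈ Finset.Icc 1 t,
      cJ (i + l) q m r s t i j * b m r * b s t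
    = -∑ r ∈ Finset.Icc 1 (i + 1), ∑ t ∈ Finset.Icc 1 (l + 1), ∑ j ∈ Finset.range (q + 1),
      (2 * (l : ℂ) + 1) / 2 * bPart b r i * bPart b t l * ((2 * r : ℕ) : ℂ)
        * (((2 * r : ℕ) : ℂ) - ((2 * t : ℕ) : ℂ))
        * ((((2 * r : ℕ) : ℂ) / 2) ^ j * (((2 * t : ℕ) : ℂ) / 2) ^ (q - j)
          / (j ! * (q - j)!)) := by
  rw [Finset.sum_comm, ← Finset.sum_neg_distrib]
  refine Finset.sum_congr rfl fun r _ => ?_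
  rw [Finset.sum_comm, ← Finset.sum_neg_distrib]
  refine Finset.sum_congr rfl fun t _ => ?_
  rw [← Finset.sum_neg_distrib]
  refine Finset.sum_congr rfl fun j hj => ?_
  obtain ⟨e, rfl⟩ := Nat.exists_eq_add_of_le (Nat.lt_succ_iff.mp (Finset.mem_range.mp hj))
  rw [sum_cJ_mul b, Nat.add_sub_cancel_left]
  push_cast; rfl

theorem sum_cH_add_sum_cI_add_sum_cK (d : ℕ → ℕ → ℂ) (i l q : ℕ) :
    ∑ j ∈ Finset.range (q + 1), ∑ r ∈ Finset.Icc 2 (i + 1), ∑ m ∈ Finset.Icc 1 r,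
      cH (i + l) q m r i j * d m r
    + ∑ j ∈ Finset.range (q + 1), ∑ t ∈ Finset.Icc 2 (l + 2), ∑ s ∈ Finset.Icc 1 t,
      cI (i + l) q s t i j * d s t
    + ∑ j ∈ Finset.range (q + 1), ∑ r ∈ Finset.Icc 2 (i + 1), ∑ t ∈ Finset.Icc 2 (l + 2),
      ∑ m ∈ Finset.Icc 1 r, ∑ s ∈ Finset.Icc 1 t,
      cK (i + l) q m r s t i j * d m r * d s t
    = -∑ r ∈ Finset.Icc 1 (i + 1), ∑ t ∈ Finset.Icc 1 (l + 1 + 1), ∑ j ∈ Finset.range (q + 1),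
      ((l : ℂ) + 1) * dPart d r i * dPart d t (l + 1) * ((2 * r - 1 : ℕ) : ℂ)
        * (((2 * r - 1 : ℕ) : ℂ) - ((2 * t - 1 : ℕ) : ℂ))
        * ((((2 * r - 1 : ℕ) : ℂ) / 2) ^ j * (((2 * t - 1 : ℕ) : ℂ) / 2) ^ (q - j)
          / (j ! * (q - j)!)) := by
  have hH : ∑ j ∈ Finset.range (q + 1), ∑ r ∈ Finset.Icc 2 (i + 1), ∑ m ∈ Finset.Icc 1 r,
      cH (i + l) q m r i j * d m r
      = -∑ r ∈ Finset.Icc 2 (i + 1), ∑ j ∈ Finset.range (q + 1),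
      ((l : ℂ) + 1) * dPart d r i * dPart d 1 (l + 1) * ((2 * r - 1 : ℕ) : ℂ)
        * (((2 * r - 1 : ℕ) : ℂ) - ((2 * 1 - 1 : ℕ) : ℂ))
        * ((((2 * r - 1 : ℕ) : ℂ) / 2) ^ j * (((2 * 1 - 1 : ℕ) : ℂ) / 2) ^ (q - j)
          / (j ! * (q - j)!)) := by
    rw [Finset.sum_comm, ← Finset.sum_neg_distrib]
    refine Finset.sum_congr rfl fun r hr => ?_
    rw [← Finset.sum_neg_distrib]
    refine Finset.sum_congr rfl fun j hj => ?_
    obtain ⟨e, rfl⟩ := Nat.exists_eq_add_of_le (Nat.lt_succ_iff.mp (Finset.mem_range.mp hj))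
    rw [sum_cH_mul d _ _ _ _ _ (ne_one_of_mem_Icc_two hr), Nat.add_sub_cancel_left,
      cast_two_mul_sub_one (by have := (Finset.mem_Icc.mp hr).1; omega)]
    simp
  have hI : ∑ j ∈ Finset.range (q + 1), ∑ t ∈ Finset.Icc 2 (l + 2), ∑ s ∈ Finset.Icc 1 t,
      cI (i + l) q s t i j * d s t
      = -∑ t ∈ Finset.Icc 1 (l + 1 + 1), ∑ j ∈ Finset.range (q + 1),
      ((l : ℂ) + 1) * dPart d 1 i * dPart d t (l + 1) * ((2 * 1 - 1 : ℕ) : ℂ)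
        * (((2 * 1 - 1 : ℕ) : ℂ) - ((2 * t - 1 : ℕ) : ℂ))
        * ((((2 * 1 - 1 : ℕ) : ℂ) / 2) ^ j * (((2 * t - 1 : ℕ) : ℂ) / 2) ^ (q - j)
          / (j ! * (q - j)!)) := by
    -- The pair r = t = 1 has equal exponents and the factor a - b kills it; this is why the sum for
    -- `cI` may start at t = 2.
    rw [sum_Icc_one_succ]
    simp only [sub_self, mul_zero, zero_mul, Finset.sum_const_zero, zero_add]
    rw [Finset.sum_comm, ← Finset.sum_neg_distrib]
    refine Finset.sum_congr rfl fun t ht => ?_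
    rw [← Finset.sum_neg_distrib]
    refine Finset.sum_congr rfl fun j hj => ?_
    obtain ⟨e, rfl⟩ := Nat.exists_eq_add_of_le (Nat.lt_succ_iff.mp (Finset.mem_range.mp hj))
    rw [sum_cI_mul d _ _ _ _ _ (ne_one_of_mem_Icc_two ht), Nat.add_sub_cancel_left,
      cast_two_mul_sub_one le_rfl, cast_two_mul_sub_one
        (one_le_two.trans (Finset.mem_Icc.mp ht).1)]
    norm_num
  have hK : ∑ j ∈ Finset.range (q + 1), ∑ r ∈ Finset.Icc 2 (i + 1), ∑ t ∈ Finset.Icc 2 (l + 2),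
      ∑ m ∈ Finset.Icc 1 r, ∑ s ∈ Finset.Icc 1 t,
      cK (i + l) q m r s t i j * d m r * d s t
      = -∑ r ∈ Finset.Icc 2 (i + 1), ∑ t ∈ Finset.Icc 2 (l + 1 + 1), ∑ j ∈ Finset.range (q + 1),
      ((l : ℂ) + 1) * dPart d r i * dPart d t (l + 1) * ((2 * r - 1 : ℕ) : ℂ)
        * (((2 * r - 1 : ℕ) : ℂ) - ((2 * t - 1 : ℕ) : ℂ))
        * ((((2 * r - 1 : ℕ) : ℂ) / 2) ^ j * (((2 * t - 1 : ℕ) : ℂ) / 2) ^ (q - j)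
          / (j ! * (q - j)!)) := by
    rw [Finset.sum_comm, ← Finset.sum_neg_distrib]
    refine Finset.sum_congr rfl fun r hr => ?_
    rw [Finset.sum_comm, ← Finset.sum_neg_distrib]
    refine Finset.sum_congr rfl fun t ht => ?_
    rw [← Finset.sum_neg_distrib]
    refine Finset.sum_congr rfl fun j hj => ?_
    obtain ⟨e, rfl⟩ := Nat.exists_eq_add_of_le (Nat.lt_succ_iff.mp (Finset.mem_range.mp hj))
    rw [sum_cK_mul d _ _ _ _ _ _ (ne_one_of_mem_Icc_two hr) (ne_one_of_mem_Icc_two ht),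
      Nat.add_sub_cancel_left,
      cast_two_mul_sub_one (by have := (Finset.mem_Icc.mp hr).1; omega),
      cast_two_mul_sub_one (by have := (Finset.mem_Icc.mp ht).1; omega)]
  rw [hH, hI, hK, sum_Icc_one_succ _ i, add_comm (-_), neg_add, add_assoc, ← neg_add,
    ← Finset.sum_add_distrib]
  congr 2

theorem oddRelation_eq (b d : ℕ → ℕ → ℂ) (k q : ℕ) :
    oddRelation b d k q = -moment q (pdeCoeff (sPoly b d) (2 * k + 1)) := by
  rw [moment_pdeCoeff, sPoly_odd, moment_linear, sum_range_two_mul_add_two, neg_add, neg_add,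
    ← moment_linear_odd b, ← Finset.sum_neg_distrib, ← Finset.sum_neg_distrib]
  have h1 : ∑ i ∈ Finset.range (k + 1),
        -moment q (Polynomial.C ((((2 * k + 1 - 2 * i : ℕ) : ℂ) + 1) / 2)
          * (euler (euler (sPoly b d (2 * i))) * sPoly b d (2 * k + 1 - 2 * i + 1)
            - euler (sPoly b d (2 * i)) * euler (sPoly b d (2 * k + 1 - 2 * i + 1))))
      = ∑ i ∈ Finset.range (k + 1), ∑ j ∈ Finset.range (q + 1),
      ∑ r ∈ Finset.Icc 2 (i + 1), ∑ m ∈ Finset.Icc 1 r,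
      cH k q m r i j * d m r
  + ∑ i ∈ Finset.range (k + 1), ∑ j ∈ Finset.range (q + 1),
      ∑ t ∈ Finset.Icc 2 (k + 2 - i), ∑ s ∈ Finset.Icc 1 t,
      cI k q s t i j * d s t
  + ∑ i ∈ Finset.range (k + 1), ∑ j ∈ Finset.range (q + 1),
      ∑ r ∈ Finset.Icc 2 (i + 1), ∑ t ∈ Finset.Icc 2 (k + 2 - i),
      ∑ m ∈ Finset.Icc 1 r, ∑ s ∈ Finset.Icc 1 t,
      cK k q m r s t i j * d m r * d s t := by
    rw [← Finset.sum_add_distrib, ← Finset.sum_add_distrib]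
    refine Finset.sum_congr rfl fun i hi => ?_
    obtain ⟨l, rfl⟩ := Nat.exists_eq_add_of_le (Nat.lt_succ_iff.mp (Finset.mem_range.mp hi))
    have e1 : 2 * (i + l) + 1 - 2 * i = 2 * l + 1 := by omega
    have e2 : i + l + 2 - i = l + 2 := by omega
    have e3 : 2 * l + 1 + 1 = 2 * (l + 1) := by ring
    have e4 : (((2 * l + 1 : ℕ) : ℂ) + 1) / 2 = (l : ℂ) + 1 := by push_cast; ring
    rw [e1, e2, e3, e4, sPoly_even, sPoly_even, moment_bilinear, sum_cH_add_sum_cI_add_sum_cK]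
  have h2 : ∑ i ∈ Finset.range (k + 1),
        -moment q (Polynomial.C ((((2 * k + 1 - (2 * i + 1) : ℕ) : ℂ) + 1) / 2)
          * (euler (euler (sPoly b d (2 * i + 1))) * sPoly b d (2 * k + 1 - (2 * i + 1) + 1)
            - euler (sPoly b d (2 * i + 1)) * euler (sPoly b d (2 * k + 1 - (2 * i + 1) + 1))))
      = ∑ i ∈ Finset.range (k + 1), ∑ j ∈ Finset.range (q + 1),
      ∑ r ∈ Finset.Icc 1 (i + 1), ∑ t ∈ Finset.Icc 1 (k + 1 - i),
      ∑ m ∈ Finset.Icc 1 r, ∑ s ∈ Finset.Icc 1 t,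
      cJ k q m r s t i j * b m r * b s t := by
    refine Finset.sum_congr rfl fun i hi => ?_
    obtain ⟨l, rfl⟩ := Nat.exists_eq_add_of_le (Nat.lt_succ_iff.mp (Finset.mem_range.mp hi))
    have e1 : 2 * (i + l) + 1 - (2 * i + 1) = 2 * l := by omega
    have e2 : i + l + 1 - i = l + 1 := by omega
    rw [e1, e2, sPoly_odd, sPoly_odd, moment_bilinear, sum_cJ]
    push_cast; rfl
  rw [h1, h2, oddRelation]
  ring

/-- Vandermonde: if all power moments of a measure on finitely many distinct nodes vanish, it
annihilates every polynomial, in particular the one vanishing at all nodes but one. -/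
theorem eq_zero_of_forall_sum_pow (s : Finset ℕ) (x c : ℕ → ℂ) (hx : Set.InjOn x s)
    (h : ∀ q : ℕ, ∑ n ∈ s, c n * x n ^ q = 0) : ∀ n ∈ s, c n = 0 := by
  classical
  have hP : ∀ P : Polynomial ℂ, ∑ n ∈ s, c n * P.eval (x n) = 0 := by
    intro P
    simp only [Polynomial.eval_eq_sum_range, Finset.mul_sum]
    rw [Finset.sum_comm]
    refine Finset.sum_eq_zero fun q _ => ?_
    have := congrArg (fun z => P.coeff q * z) (h q)
    simp only [Finset.mul_sum, mul_zero] at this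
    rw [← this]
    exact Finset.sum_congr rfl fun n _ => by ring
  intro n hn
  have h1 := hP (∏ m ∈ s.erase n, (Polynomial.X - Polynomial.C (x m)))
  rw [Finset.sum_eq_single_of_mem n hn] at h1
  · refine (mul_eq_zero.mp h1).resolve_right ?_
    rw [Polynomial.eval_prod]
    refine Finset.prod_ne_zero_iff.mpr ?_
    intro m hm
    rw [Finset.mem_erase] at hm
    simpa [sub_eq_zero] using fun h => hm.1 (hx hm.2 hn h.symm)
  · intro m hm hmn
    rw [Polynomial.eval_prod, Finset.prod_eq_zero (Finset.mem_erase.mpr ⟨hmn, hm⟩), mul_zero]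
    simp

/-- Linear independence of the exponentials e^(nx/2), seen on Taylor coefficients at x = 0. -/
theorem eq_zero_of_forall_moment (f : Polynomial ℂ) (h : ∀ q, moment q f = 0) : f = 0 := by
  have key := eq_zero_of_forall_sum_pow f.support (fun n => (n : ℂ) / 2) f.coeff
    (fun a _ b _ hab => by simpa using hab) fun q => by
      have hq := h q
      have h3 : (q ! : ℂ) ≠ 0 := by exact_mod_cast q.factorial_ne_zero
      rw [moment, Polynomial.lsum_apply, Polynomial.sum_def] at hq
      have := congrArg (fun z => (q ! : ℂ) * z) hq
      simp only [Finset.mul_sum, mul_zero] at this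
      rw [← this]
      refine Finset.sum_congr rfl fun n _ => ?_
      simp only [LinearMap.smul_apply, LinearMap.id_coe, id_eq, smul_eq_mul]
      field_simp
  ext n
  by_cases hn : n ∈ f.support
  · simpa using key n hn
  · simpa using hn

theorem satisfiesRecursion_iff (b d : ℕ → ℕ → ℂ) :
    SatisfiesRecursion b d ↔ b 1 1 = -8 ∧ d 1 1 = 1 ∧ ∀ p, pdeCoeff (sPoly b d) p = 0 := by
  constructor
  · intro h
    refine ⟨h.b_one_one, h.d_one_one, fun p => eq_zero_of_forall_moment _ fun q => ?_⟩
    rcases Nat.even_or_odd' p with ⟨k, rfl | rfl⟩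
    · simpa [evenRelation_eq] using h.even k q
    · simpa [oddRelation_eq] using h.odd k q
  · rintro ⟨h1, h2, h⟩
    exact ⟨h1, h2, fun k q => by rw [evenRelation_eq, h]; simp,
      fun k q => by rw [oddRelation_eq, h]; simp⟩

end

/-! ### Uniqueness of the polynomials f_p and of the arrays b, d. -/

section


open Polynomial in
theorem pdeCoeff_unique (f g : ℕ → ℂ[X]) (hf0 : f 0 = X) (hg0 : g 0 = X)
    (h1 : ∀ p, (f p).coeff 1 = (g p).coeff 1)
    (hf : ∀ p, pdeCoeff f p = 0) (hg : ∀ p, pdeCoeff g p = 0) : ∀ p, f p = g p := by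
  intro p
  induction p using Nat.strong_induction_on with
  | _ p ih =>
    cases p with
    | zero => rw [hf0, hg0]
    | succ p =>
      have hX : euler (X : ℂ[X]) = X := by simp [euler]
      -- All antidiagonal terms except (0, p) involve indices at most p only, where f and g agree by
      -- induction; the surviving one has f_0 = g_0 = X, fixed by the Euler operator.
      have e : C (((p : ℂ) + 1) / 2) * (X * ((f (p + 1) - g (p + 1))
          - euler (f (p + 1) - g (p + 1)))) = 0 := by
        have e1 := (hf p).trans (hg p).symm
        rw [pdeCoeff, pdeCoeff, ih p (Nat.lt_succ_self p)] at e1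
        have e2 := sub_eq_zero.mpr (add_left_cancel e1)
        rw [← Finset.sum_sub_distrib, Finset.sum_eq_single_of_mem ((0, p) : ℕ × ℕ) (by simp)] at e2
        · simp only [hf0, hg0, hX] at e2
          rw [map_sub, ← e2]
          ring
        · rintro ⟨i, j⟩ hij hne
          rw [Finset.HasAntidiagonal.mem_antidiagonal] at hij
          simp only at hij
          have hi : i ≠ 0 := by rintro rfl; exact hne (by simp_all)
          simp only [ih i (by omega), ih (j + 1) (by omega), sub_self]
      have hp : C (((p : ℂ) + 1) / 2) ≠ 0 := by
        rw [Ne, C_eq_zero]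
        exact div_ne_zero (Nat.cast_add_one_ne_zero p) two_ne_zero
      have e3 := (mul_eq_zero.mp ((mul_eq_zero.mp e).resolve_left hp)).resolve_left X_ne_zero
      ext n
      by_cases hn : n = 1
      · rw [hn, h1]
      · have e4 := congrArg (fun P => P.coeff n) e3
        simp only [coeff_sub, coeff_euler, coeff_zero] at e4
        -- The operator 1 - y d/dy multiplies y^n by 1 - n, so only n = 1 escapes; that coefficient
        -- is the hypothesis `h1`.
        have hn' : (1 : ℂ) - n ≠ 0 := fun h => hn (by exact_mod_cast (sub_eq_zero.mp h).symm)
        have e5 : (1 - (n : ℂ)) * ((f (p + 1)).coeff n - (g (p + 1)).coeff n) = 0 := by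
          rw [← e4]; ring
        exact sub_eq_zero.mp ((mul_eq_zero.mp e5).resolve_left hn')

theorem sPoly_zero (b d : ℕ → ℕ → ℂ) : sPoly b d 0 = Polynomial.X := by
  have := sPoly_even b d 0
  simpa [dPart_one] using this

open Polynomial in
theorem coeff_sum_C_mul_X_pow (R : Finset ℕ) (a : ℕ → ℕ) (D : ℕ → ℂ) (ha : Set.InjOn a R) {r : ℕ}
    (hr : r ∈ R) : (∑ r ∈ R, C (D r) * X ^ a r).coeff (a r) = D r := by
  rw [finsetSum_coeff, Finset.sum_eq_single_of_mem r hr]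
  · simp
  · intro m hm hmr
    rw [coeff_C_mul_X_pow, if_neg fun h => hmr (ha hm hr h.symm)]

open Polynomial in
theorem coeff_sum_C_mul_X_pow_eq_zero (R : Finset ℕ) (a : ℕ → ℕ) (D : ℕ → ℂ) {n : ℕ}
    (hn : ∀ r ∈ R, a r ≠ n) : (∑ r ∈ R, C (D r) * X ^ a r).coeff n = 0 := by
  rw [finsetSum_coeff]
  refine Finset.sum_eq_zero fun m hm => ?_
  rw [coeff_C_mul_X_pow, if_neg fun h => hn m hm h.symm]

theorem coeff_sPoly_even (b d : ℕ → ℕ → ℂ) {r l : ℕ} (hr : 1 ≤ r) (hl : r ≤ l + 1) :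
    (sPoly b d (2 * l)).coeff (2 * r - 1) = dPart d r l := by
  rw [sPoly_even]
  refine coeff_sum_C_mul_X_pow _ (fun r => 2 * r - 1) _ ?_ (Finset.mem_Icc.mpr ⟨hr, hl⟩)
  intro x hx y hy h
  simp only [Finset.coe_Icc, Set.mem_Icc] at hx hy
  simp only at h; omega

theorem coeff_sPoly_odd (b d : ℕ → ℕ → ℂ) {t l : ℕ} (ht : 1 ≤ t) (hl : t ≤ l + 1) :
    (sPoly b d (2 * l + 1)).coeff (2 * t) = bPart b t l := by
  rw [sPoly_odd]
  refine coeff_sum_C_mul_X_pow _ (fun t => 2 * t) _ ?_ (Finset.mem_Icc.mpr ⟨ht, hl⟩)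
  intro x hx y hy h
  simp only at h; omega

/-- The y^1 coefficient is the Taylor coefficient of cos 2s and does not see the arrays, which
supplies the missing datum in `pdeCoeff_unique`. -/
theorem coeff_one_sPoly (b d b' d' : ℕ → ℕ → ℂ) (p : ℕ) :
    (sPoly b d p).coeff 1 = (sPoly b' d' p).coeff 1 := by
  rcases Nat.even_or_odd' p with ⟨k, rfl | rfl⟩
  · rw [coeff_sPoly_even b d le_rfl (by omega), coeff_sPoly_even b' d' le_rfl (by omega),
      dPart_one, dPart_one]
  · rw [sPoly_odd, sPoly_odd, coeff_sum_C_mul_X_pow_eq_zero, coeff_sum_C_mul_X_pow_eq_zero] <;>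
    · intro r _; omega

theorem sPoly_eq_of_satisfiesRecursion {b d b' d' : ℕ → ℕ → ℂ} (h : SatisfiesRecursion b d)
    (h' : SatisfiesRecursion b' d') (p : ℕ) : sPoly b d p = sPoly b' d' p :=
  pdeCoeff_unique _ _ (sPoly_zero b d) (sPoly_zero b' d') (coeff_one_sPoly b d b' d')
    ((satisfiesRecursion_iff b d).mp h).2.2 ((satisfiesRecursion_iff b' d').mp h').2.2 p

/-- For fixed t, the values at l ≥ t - 1 are, up to nonzero factors, the power moments at the
distinct nodes s^2, so Vandermonde applies. -/
theorem bPart_injective {b b' : ℕ → ℕ → ℂ} {t : ℕ}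
    (h : ∀ l, t ≤ l + 1 → bPart b t l = bPart b' t l) {s : ℕ} (hs : 1 ≤ s) (hst : s ≤ t) :
    b s t = b' s t := by
  have key := eq_zero_of_forall_sum_pow (Finset.Icc 1 t) (fun s => (s : ℂ) ^ 2)
    (fun s => (s : ℂ) ^ 2 * (b s t - b' s t)) (fun x _ y _ hxy => by
      have : ((x ^ 2 : ℕ) : ℂ) = ((y ^ 2 : ℕ) : ℂ) := by simpa using hxy
      exact Nat.pow_left_injective (n := 2) (by norm_num) (by exact_mod_cast this)) fun q => by
        -- With l = t + q - 1 the exponent 2l - 2t + 4 equals 2 + 2q: a fixed weight s^2 times the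
        -- q-th power of the node.
        have h1 := h (t + q - 1) (by omega)
        rw [bPart_eq, bPart_eq] at h1
        have hne : (-1 : ℂ) ^ (t + q - 1) * (2 : ℂ) ^ (4 * ((t + q - 1 : ℕ) : ℤ) - 4)
            / (2 * (t + q - 1) + 1)! ≠ 0 := by
          refine div_ne_zero (mul_ne_zero (by simp) (zpow_ne_zero _ two_ne_zero)) ?_
          exact_mod_cast Nat.factorial_ne_zero _
        have h2 := sub_eq_zero.mpr (mul_left_cancel₀ hne h1)
        rw [bSum, bSum, ← Finset.sum_sub_distrib] at h2
        rw [← h2]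
        refine Finset.sum_congr rfl fun m hm => ?_
        have ht : 1 ≤ t := by have := Finset.mem_Icc.mp hm; omega
        have e : 2 * ((t + q - 1 : ℕ) : ℤ) - 2 * t + 4 = ((2 + 2 * q : ℕ) : ℤ) := by
          rw [Nat.cast_sub (by omega)]; push_cast; ring
        rw [e, zpow_natCast, pow_add, pow_mul]
        ring
  have := key s (Finset.mem_Icc.mpr ⟨hs, hst⟩)
  have hs' : (s : ℂ) ^ 2 ≠ 0 := pow_ne_zero _ (by exact_mod_cast (by omega : s ≠ 0))
  exact sub_eq_zero.mp ((mul_eq_zero.mp this).resolve_left hs')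

theorem dPart_injective {d d' : ℕ → ℕ → ℂ} {r : ℕ} (hr : r ≠ 1)
    (h : ∀ l, r ≤ l + 1 → dPart d r l = dPart d' r l) {m : ℕ} (hm : 1 ≤ m) (hmr : m ≤ r) :
    d m r = d' m r := by
  have hodd : ∀ x : ℕ, (2 * (x : ℂ) - 1) ≠ 0 := by
    intro x hx
    have : ((2 * x : ℕ) : ℂ) = ((1 : ℕ) : ℂ) := by push_cast; exact sub_eq_zero.mp hx
    have : 2 * x = 1 := by exact_mod_cast this
    omega
  have key := eq_zero_of_forall_sum_pow (Finset.Icc 1 r) (fun s => (2 * (s : ℂ) - 1) ^ 2)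
    (fun s => (2 * (s : ℂ) - 1) ^ 2 * ((-1) ^ s * (d s r - d' s r))) (fun x hx y hy hxy => by
      simp only [Finset.coe_Icc, Set.mem_Icc] at hx hy
      have : (((2 * x - 1) ^ 2 : ℕ) : ℂ) = (((2 * y - 1) ^ 2 : ℕ) : ℂ) := by
        push_cast
        rw [Nat.cast_sub (by omega), Nat.cast_sub (by omega)]
        push_cast
        exact hxy
      have := Nat.pow_left_injective (n := 2) (by norm_num) (by exact_mod_cast this)
      omega) fun q => by
        have h1 := h (r + q - 1) (by omega)
        rw [dPart_of_ne_one d hr, dPart_of_ne_one d' hr] at h1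
        have hne : (-1 : ℂ) ^ (r + q - 1 + 1)
            * (2 : ℂ) ^ (2 * ((r + q - 1 : ℕ) : ℤ) + 5 - 2 * r) / (2 * (r + q - 1))! ≠ 0 := by
          refine div_ne_zero (mul_ne_zero (by simp) (zpow_ne_zero _ two_ne_zero)) ?_
          exact_mod_cast Nat.factorial_ne_zero _
        have h2 := sub_eq_zero.mpr (mul_left_cancel₀ hne h1)
        rw [dSum, dSum, ← Finset.sum_sub_distrib] at h2
        rw [← h2]
        refine Finset.sum_congr rfl fun m hm => ?_
        have ht : 1 ≤ r := by have := Finset.mem_Icc.mp hm; omega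
        have e : 2 * ((r + q - 1 : ℕ) : ℤ) - 2 * r + 4 = ((2 + 2 * q : ℕ) : ℤ) := by
          rw [Nat.cast_sub (by omega)]; push_cast; ring
        rw [e, zpow_natCast, pow_add, pow_mul]
        ring
  have := key m (Finset.mem_Icc.mpr ⟨hm, hmr⟩)
  have h2 := (mul_eq_zero.mp this).resolve_left (pow_ne_zero _ (hodd m))
  exact sub_eq_zero.mp ((mul_eq_zero.mp h2).resolve_left (by simp))

theorem recursion_unique {b d b' d' : ℕ → ℕ → ℂ} (h : SatisfiesRecursion b d)
    (h' : SatisfiesRecursion b' d') (i j : ℕ) (hi : 1 ≤ i) (hij : i ≤ j) :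
    b i j = b' i j ∧ d i j = d' i j := by
  have hs := sPoly_eq_of_satisfiesRecursion h h'
  constructor
  · refine bPart_injective (fun l hl => ?_) hi hij
    rw [← coeff_sPoly_odd b d (by omega) hl, hs, coeff_sPoly_odd b' d' (by omega) hl]
  -- The relations involve d only in columns at least 2, so d 1 1 comes from the normalisation
  -- alone.
  · by_cases hj : j = 1
    · obtain rfl : i = 1 := by omega
      rw [hj, h.d_one_one, h'.d_one_one]
    · refine dPart_injective hj (fun l hl => ?_) hi hij
      rw [← coeff_sPoly_even b d (by omega) hl, hs, coeff_sPoly_even b' d' (by omega) hl]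

end

/-! ### Absolutely convergent power series in one variable, and the root of v - v^3 = u. -/

section


open PowerSeries in
/-- Absolute convergence of a power series at radius `r`. -/
def AbsConv (f : ℂ⟦X⟧) (r : ℝ) : Prop :=
  Summable fun n => ‖coeff n f‖ * r ^ n

open PowerSeries in
/-- The sum of a power series at a point. -/
def psum (f : ℂ⟦X⟧) (z : ℂ) : ℂ :=
  ∑' n, coeff n f * z ^ n

open PowerSeries in
/-- The weighted `ℓ¹` norm of the coefficients of a power series. -/
def wnorm (f : ℂ⟦X⟧) (r : ℝ) : ℝ :=
  ∑' n, ‖coeff n f‖ * r ^ n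

open PowerSeries

theorem wnorm_nonneg (f : ℂ⟦X⟧) {r : ℝ} (hr : 0 ≤ r) : 0 ≤ wnorm f r :=
  tsum_nonneg fun _ => by positivity

theorem AbsConv.summable_norm {f : ℂ⟦X⟧} {r : ℝ} (h : AbsConv f r) {z : ℂ} (hz : ‖z‖ ≤ r) :
    Summable fun n => ‖coeff n f * z ^ n‖ := by
  refine Summable.of_nonneg_of_le (fun _ => norm_nonneg _) (fun n => ?_) h
  rw [norm_mul, norm_pow]
  gcongr

theorem AbsConv.hasSum {f : ℂ⟦X⟧} {r : ℝ} (h : AbsConv f r) {z : ℂ} (hz : ‖z‖ ≤ r) :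
    HasSum (fun n => coeff n f * z ^ n) (psum f z) :=
  (h.summable_norm hz).of_norm.hasSum

theorem AbsConv.mono {f : ℂ⟦X⟧} {r r' : ℝ} (h : AbsConv f r) (hr' : 0 ≤ r') (hr : r' ≤ r) :
    AbsConv f r' :=
  Summable.of_nonneg_of_le (fun _ => by positivity) (fun n => by gcongr) h

theorem norm_coeff_mul_le (f g : ℂ⟦X⟧) {r : ℝ} (hr : 0 ≤ r) (n : ℕ) :
    ‖coeff n (f * g)‖ * r ^ n ≤ ∑ ij ∈ Finset.HasAntidiagonal.antidiagonal n,
      (‖coeff ij.1 f‖ * r ^ ij.1) * (‖coeff ij.2 g‖ * r ^ ij.2) := by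
  rw [coeff_mul]
  refine (mul_le_mul_of_nonneg_right (norm_sum_le _ _) (by positivity)).trans_eq ?_
  rw [Finset.sum_mul]
  refine Finset.sum_congr rfl fun ij hij => ?_
  rw [← Finset.HasAntidiagonal.mem_antidiagonal.mp hij, norm_mul, pow_add]
  ring

theorem AbsConv.summable_mul {f g : ℂ⟦X⟧} {r : ℝ} (hr : 0 ≤ r) (hf : AbsConv f r)
    (hg : AbsConv g r) :
    Summable fun x : ℕ × ℕ => (‖coeff x.1 f‖ * r ^ x.1) * (‖coeff x.2 g‖ * r ^ x.2) := by
  have h0 : ∀ (f : ℂ⟦X⟧) (n : ℕ), 0 ≤ ‖coeff n f‖ * r ^ n := fun f n => by positivity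
  have hf' : Summable (fun n => ‖coeff n f‖ * r ^ n) := hf
  have hg' : Summable (fun n => ‖coeff n g‖ * r ^ n) := hg
  exact hf'.mul_of_nonneg hg' (h0 f) (h0 g)

theorem AbsConv.mul {f g : ℂ⟦X⟧} {r : ℝ} (hr : 0 ≤ r) (hf : AbsConv f r) (hg : AbsConv g r) :
    AbsConv (f * g) r :=
  Summable.of_nonneg_of_le (fun _ => by positivity) (norm_coeff_mul_le f g hr)
    (summable_sum_mul_antidiagonal_of_summable_mul (f := fun n => ‖coeff n f‖ * r ^ n)
      (g := fun n => ‖coeff n g‖ * r ^ n) (hf.summable_mul hr hg))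

theorem wnorm_mul_le {f g : ℂ⟦X⟧} {r : ℝ} (hr : 0 ≤ r) (hf : AbsConv f r) (hg : AbsConv g r) :
    wnorm (f * g) r ≤ wnorm f r * wnorm g r := by
  have h := Summable.tsum_mul_tsum_eq_tsum_sum_antidiagonal (f := fun n => ‖coeff n f‖ * r ^ n)
    (g := fun n => ‖coeff n g‖ * r ^ n) hf hg (hf.summable_mul hr hg)
  rw [wnorm, wnorm, wnorm, h]
  exact Summable.tsum_le_tsum (norm_coeff_mul_le f g hr) (hf.mul hr hg)
    (summable_sum_mul_antidiagonal_of_summable_mul (f := fun n => ‖coeff n f‖ * r ^ n)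
      (g := fun n => ‖coeff n g‖ * r ^ n) (hf.summable_mul hr hg))

theorem psum_mul {f g : ℂ⟦X⟧} {r : ℝ} (hf : AbsConv f r) (hg : AbsConv g r) {z : ℂ}
    (hz : ‖z‖ ≤ r) : psum (f * g) z = psum f z * psum g z := by
  rw [psum, psum, psum, tsum_mul_tsum_eq_tsum_sum_antidiagonal_of_summable_norm
    (hf.summable_norm hz) (hg.summable_norm hz)]
  refine tsum_congr fun n => ?_
  rw [coeff_mul, Finset.sum_mul]
  refine Finset.sum_congr rfl fun ij hij => ?_
  rw [← Finset.HasAntidiagonal.mem_antidiagonal.mp hij, pow_add]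
  ring

theorem absConv_of_coeff_eq_zero {f : ℂ⟦X⟧} (N : ℕ) (h : ∀ n, N ≤ n → coeff n f = 0) (r : ℝ) :
    AbsConv f r :=
  summable_of_ne_finset_zero (s := Finset.range N) fun n hn => by
    rw [h n (by simpa using hn)]; simp

theorem absConv_one (r : ℝ) : AbsConv 1 r :=
  absConv_of_coeff_eq_zero 1 (fun n hn => by rw [coeff_one, if_neg (by omega)]) r

theorem absConv_X (r : ℝ) : AbsConv X r :=
  absConv_of_coeff_eq_zero 2 (fun n hn => by rw [coeff_X, if_neg (by omega)]) r

theorem absConv_C (a : ℂ) (r : ℝ) : AbsConv (C a) r :=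
  absConv_of_coeff_eq_zero 1 (fun n hn => by rw [coeff_C, if_neg (by omega)]) r

theorem psum_one (z : ℂ) : psum 1 z = 1 := by
  rw [psum, tsum_eq_single 0 fun n hn => by rw [coeff_one, if_neg hn]; simp]
  simp

theorem psum_C (a z : ℂ) : psum (C a) z = a := by
  rw [psum, tsum_eq_single 0 fun n hn => by rw [coeff_C, if_neg hn]; simp]
  simp

theorem psum_X (z : ℂ) : psum X z = z := by
  rw [psum, tsum_eq_single 1 fun n hn => by rw [coeff_X, if_neg hn]; simp]
  simp

theorem wnorm_one (r : ℝ) : wnorm 1 r = 1 := by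
  rw [wnorm, tsum_eq_single 0 fun n hn => by rw [coeff_one, if_neg hn]; simp]
  simp

theorem AbsConv.pow {f : ℂ⟦X⟧} {r : ℝ} (hr : 0 ≤ r) (hf : AbsConv f r) (n : ℕ) :
    AbsConv (f ^ n) r := by
  induction n with
  | zero => rw [pow_zero]; exact absConv_one r
  | succ n ih => rw [pow_succ]; exact ih.mul hr hf

theorem psum_pow {f : ℂ⟦X⟧} {r : ℝ} (hr : 0 ≤ r) (hf : AbsConv f r) {z : ℂ} (hz : ‖z‖ ≤ r) (n : ℕ) :
    psum (f ^ n) z = psum f z ^ n := by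
  induction n with
  | zero => rw [pow_zero, pow_zero, psum_one]
  | succ n ih => rw [pow_succ, pow_succ, psum_mul (hf.pow hr n) hf hz, ih]

theorem wnorm_pow_le {f : ℂ⟦X⟧} {r : ℝ} (hr : 0 ≤ r) (hf : AbsConv f r) (n : ℕ) :
    wnorm (f ^ n) r ≤ wnorm f r ^ n := by
  induction n with
  | zero => rw [pow_zero, pow_zero, wnorm_one]
  | succ n ih =>
    rw [pow_succ, pow_succ]
    exact (wnorm_mul_le hr (hf.pow hr n) hf).trans
      (mul_le_mul_of_nonneg_right ih (wnorm_nonneg f hr))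

theorem AbsConv.add {f g : ℂ⟦X⟧} {r : ℝ} (hr : 0 ≤ r) (hf : AbsConv f r) (hg : AbsConv g r) :
    AbsConv (f + g) r := by
  refine Summable.of_nonneg_of_le (fun _ => by positivity) (fun n => ?_) (Summable.add hf hg)
  rw [map_add, ← add_mul]
  gcongr
  exact norm_add_le _ _

theorem AbsConv.sub {f g : ℂ⟦X⟧} {r : ℝ} (hr : 0 ≤ r) (hf : AbsConv f r) (hg : AbsConv g r) :
    AbsConv (f - g) r := by
  refine Summable.of_nonneg_of_le (fun _ => by positivity) (fun n => ?_) (Summable.add hf hg)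
  rw [map_sub, ← add_mul]
  gcongr
  exact norm_sub_le _ _

theorem psum_add {f g : ℂ⟦X⟧} {r : ℝ} (hf : AbsConv f r) (hg : AbsConv g r) {z : ℂ}
    (hz : ‖z‖ ≤ r) : psum (f + g) z = psum f z + psum g z := by
  rw [psum, ← ((hf.hasSum hz).add (hg.hasSum hz)).tsum_eq]
  exact tsum_congr fun n => by rw [map_add, add_mul]

theorem psum_sub {f g : ℂ⟦X⟧} {r : ℝ} (hf : AbsConv f r) (hg : AbsConv g r) {z : ℂ}
    (hz : ‖z‖ ≤ r) : psum (f - g) z = psum f z - psum g z := by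
  rw [psum, ← ((hf.hasSum hz).sub (hg.hasSum hz)).tsum_eq]
  exact tsum_congr fun n => by rw [map_sub, sub_mul]

open Filter Topology in
theorem AbsConv.hasFPowerSeriesAt {f : ℂ⟦X⟧} {r : ℝ} (hr : 0 < r) (hf : AbsConv f r) :
    HasFPowerSeriesAt (psum f) (FormalMultilinearSeries.ofScalars ℂ fun n => coeff n f) 0 := by
  rw [hasFPowerSeriesAt_iff]
  filter_upwards [Metric.ball_mem_nhds (0 : ℂ) hr] with z hz
  have hz' : ‖z‖ ≤ r := by simpa using (mem_ball_zero_iff.mp hz).le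
  have := hf.hasSum hz'
  simpa [FormalMultilinearSeries.coeff_ofScalars, mul_comm] using this

open Filter Topology in
theorem AbsConv.eq_zero {f : ℂ⟦X⟧} {r : ℝ} (hr : 0 < r) (hf : AbsConv f r)
    (h : ∀ᶠ z in 𝓝 0, psum f z = 0) : f = 0 := by
  have := (hf.hasFPowerSeriesAt hr).eq_zero_of_eventually h
  ext n
  have h2 : (FormalMultilinearSeries.ofScalars ℂ fun n => coeff n f).coeff n = coeff n f := by
    rw [FormalMultilinearSeries.coeff_ofScalars]
  rw [← h2, this]
  rfl

open Filter Topology in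
theorem exists_powerSeries_of_analyticAt {V : ℂ → ℂ} (hV : AnalyticAt ℂ V 0) :
    ∃ (v : ℂ⟦X⟧) (r : ℝ), 0 < r ∧ AbsConv v r ∧ ∀ᶠ z in 𝓝 0, psum v z = V z := by
  obtain ⟨p, hp⟩ := hV
  obtain ⟨r, hr0, hr⟩ := ENNReal.lt_iff_exists_nnreal_btwn.mp hp.radius_pos
  refine ⟨PowerSeries.mk p.coeff, r, by exact_mod_cast hr0, ?_, ?_⟩
  · have := p.summable_norm_mul_pow hr
    simpa [AbsConv, FormalMultilinearSeries.norm_apply_eq_norm_coef] using this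
  · filter_upwards [hasFPowerSeriesAt_iff.mp hp] with z hz
    rw [zero_add] at hz
    rw [← hz.tsum_eq, psum]
    exact tsum_congr fun n => by rw [coeff_mk, smul_eq_mul, mul_comm]

open Filter Topology in
theorem exists_cubic_series : ∃ (v : ℂ⟦X⟧) (r : ℝ), 0 < r ∧ AbsConv v r ∧
    constantCoeff v = 1 ∧ v - v ^ 3 = X := by
  have hf : AnalyticAt ℂ (fun z : ℂ => z - z ^ 3) 1 := by fun_prop
  have hd : HasDerivAt (fun z : ℂ => z - z ^ 3) (1 - 3) 1 := by
    -- The derivative of z - z^3 at the root 1 is -2, so the branch of the inverse with value 1 at 0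
    -- is analytic.
    refine ((hasDerivAt_id' (1 : ℂ)).fun_sub ((hasDerivAt_id' (1 : ℂ)).fun_pow 3)).congr_deriv ?_
    norm_num
  have hf' : deriv (fun z : ℂ => z - z ^ 3) 1 ≠ 0 := by rw [hd.deriv]; norm_num
  have hV := hf.analyticAt_localInverse hf'
  have hr := HasStrictDerivAt.eventually_right_inverse hf.hasStrictDerivAt hf'
  have h1 : hf.hasStrictDerivAt.localInverse _ _ _ hf' ((1 : ℂ) - 1 ^ 3) = 1 :=
    HasStrictFDerivAt.localInverse_apply_image ..
  have e : (1 : ℂ) - 1 ^ 3 = 0 := by norm_num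
  rw [e] at hV hr h1
  obtain ⟨v, r, hr0, hv, hvV⟩ := exists_powerSeries_of_analyticAt hV
  refine ⟨v, r, hr0, hv, ?_, ?_⟩
  · have h2 : psum v 0 = 1 := hvV.self_of_nhds.trans h1
    rw [← h2, psum, tsum_eq_single 0 fun n hn => by simp [hn]]
    simp
  · rw [← sub_eq_zero]
    have hc := (hv.sub hr0.le (hv.pow hr0.le 3)).sub hr0.le (absConv_X r)
    refine hc.eq_zero hr0 ?_
    filter_upwards [hvV, hr, Metric.ball_mem_nhds (0 : ℂ) hr0] with z h3 h4 hz
    have hz' : ‖z‖ ≤ r := by simpa using (mem_ball_zero_iff.mp hz).le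
    rw [psum_sub (hv.sub hr0.le (hv.pow hr0.le 3)) (absConv_X r) hz',
      psum_sub hv (hv.pow hr0.le 3) hz', psum_pow hr0.le hv hz', psum_X, h3]
    exact sub_eq_zero.mpr h4

end

/-! ### The primitive h of v, and the quadratic identity it satisfies. -/

section


open PowerSeries

/-- `∑ v_n X ^ n / (n + 1)`, the primitive of `v` divided by `X`. -/
def avg (v : ℂ⟦X⟧) : ℂ⟦X⟧ := PowerSeries.mk fun n => coeff n v / (n + 1)

theorem derivative_X_mul_avg (v : ℂ⟦X⟧) : d⁄dX ℂ (X * avg v) = v := by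
  ext n
  rw [coeff_derivative, coeff_succ_X_mul, avg, coeff_mk]
  have : (n : ℂ) + 1 ≠ 0 := Nat.cast_add_one_ne_zero n
  field_simp

theorem derivative_cubic {v : ℂ⟦X⟧} (hv : v - v ^ 3 = X) : d⁄dX ℂ v * (1 - 3 * v ^ 2) = 1 := by
  have h := congrArg (d⁄dX ℂ) hv
  rw [map_sub, derivative_X, Derivation.leibniz_pow] at h
  simp only [smul_eq_mul, nsmul_eq_mul] at h
  push_cast at h
  linear_combination h

/-- Both sides have zero constant term and derivative 4v: on the right it is 4v (1 - 3v^2) v', and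
(1 - 3v^2) v' = 1. -/
theorem four_mul_X_mul_avg {v : ℂ⟦X⟧} (h0 : constantCoeff v = 1) (hv : v - v ^ 3 = X) :
    4 * (X * avg v) = (1 - v ^ 2) * (1 + 3 * v ^ 2) := by
  refine derivative.ext (R := ℂ) ?_ ?_
  · have h3 : d⁄dX ℂ (3 : ℂ⟦X⟧) = 0 := by simpa using (d⁄dX ℂ).map_natCast 3
    have h4 : d⁄dX ℂ (4 : ℂ⟦X⟧) = 0 := by simpa using (d⁄dX ℂ).map_natCast 4
    rw [Derivation.leibniz, derivative_X_mul_avg, Derivation.leibniz, map_sub, map_add,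
      Derivation.leibniz _ 3, Derivation.leibniz_pow, h3, h4, Derivation.map_one_eq_zero]
    simp only [smul_eq_mul, nsmul_eq_mul]
    push_cast
    linear_combination -4 * v * derivative_cubic hv
  · simp [h0]

/-- This is h(u)/u = (1 + 3v^2)/(4v), the source of the closed form of the solution. -/
theorem four_mul_mul_avg {v : ℂ⟦X⟧} (h0 : constantCoeff v = 1) (hv : v - v ^ 3 = X) :
    4 * v * avg v = 1 + 3 * v ^ 2 := by
  have hX : (X : ℂ⟦X⟧) ≠ 0 := X_ne_zero
  refine mul_left_cancel₀ hX ?_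
  have := four_mul_X_mul_avg h0 hv
  linear_combination v * this + (1 + 3 * v ^ 2) * hv

theorem coeff_X_mul_derivative (f : ℂ⟦X⟧) (n : ℕ) :
    coeff n (X * d⁄dX ℂ f) = n * coeff n f := by
  cases n with
  | zero => simp
  | succ n => rw [coeff_succ_X_mul, coeff_derivative]; push_cast; ring

/-- The differential equation a profile h must satisfy for cot(2s) h(y sin 2s) to solve `eq₅`.
Everything is rational in v, so it is an algebraic identity. -/
theorem euler_identity {v : ℂ⟦X⟧} (h0 : constantCoeff v = 1) (hv : v - v ^ 3 = X)
    {h : ℂ⟦X⟧} (hh : h = X * avg v) :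
    X ^ 2 * (9 * (X * d⁄dX ℂ (X * d⁄dX ℂ h)) - 18 * (X * d⁄dX ℂ h) + 8 * h)
      = 4 * ((X * d⁄dX ℂ (X * d⁄dX ℂ h)) * h - (X * d⁄dX ℂ h) * (X * d⁄dX ℂ h)) := by
  have h4 : 4 * h = (1 - v ^ 2) * (1 + 3 * v ^ 2) := by rw [hh, four_mul_X_mul_avg h0 hv]
  have hq := derivative_cubic hv
  have e1 : d⁄dX ℂ h = v := by rw [hh, derivative_X_mul_avg]
  have e2 : d⁄dX ℂ (X * v) = v + X * d⁄dX ℂ v := by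
    rw [Derivation.leibniz, derivative_X]; simp only [smul_eq_mul]; ring
  rw [e1, e2]
  have hne : (1 - 3 * v ^ 2) ≠ 0 := fun h => by rw [h, mul_zero] at hq; exact zero_ne_one hq
  -- Multiplying by 1 - 3v^2 turns v' into 1; afterwards X and h are polynomials in v.
  refine mul_left_cancel₀ hne ?_
  rw [← sub_eq_zero]
  have hX : (X : ℂ⟦X⟧) = v - v ^ 3 := hv.symm
  generalize d⁄dX ℂ v = w at *
  rw [hX]
  linear_combination (9 * (v - v ^ 3) ^ 4 - 4 * h * (v - v ^ 3) ^ 2) * hq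
    + (2 * (v - v ^ 3) ^ 2 * (1 - 3 * v ^ 2) - (v - v ^ 3) * v * (1 - 3 * v ^ 2) - (v - v ^ 3) ^ 2)
        * h4

theorem convolution_identity {v : ℂ⟦X⟧} (h0 : constantCoeff v = 1) (hv : v - v ^ 3 = X) (n : ℕ) :
    1 / 4 * (9 * (n : ℂ) ^ 2 - 18 * n + 8) * coeff n (X * avg v)
      = ∑ ab ∈ Finset.HasAntidiagonal.antidiagonal (n + 2), ((ab.1 : ℂ) ^ 2 - ab.1 * ab.2)
        * (coeff ab.1 (X * avg v) * coeff ab.2 (X * avg v)) := by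
  obtain ⟨h, hh⟩ : ∃ h, h = X * avg v := ⟨_, rfl⟩
  rw [← hh]
  have key := congrArg (coeff (n + 2)) (euler_identity h0 hv hh)
  have h9 : (9 : ℂ⟦X⟧) = C 9 := (map_ofNat C 9).symm
  have h18 : (18 : ℂ⟦X⟧) = C 18 := (map_ofNat C 18).symm
  have h8 : (8 : ℂ⟦X⟧) = C 8 := (map_ofNat C 8).symm
  have h4 : (4 : ℂ⟦X⟧) = C 4 := (map_ofNat C 4).symm
  rw [mul_comm (X ^ 2), coeff_mul_X_pow, h9, h18, h8, h4] at key
  simp only [map_add, map_sub, coeff_C_mul, coeff_X_mul_derivative] at key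
  rw [coeff_mul, coeff_mul] at key
  simp only [coeff_X_mul_derivative] at key
  rw [← Finset.sum_sub_distrib] at key
  have e : ∀ ab : ℕ × ℕ, ((ab.1 : ℂ) ^ 2 - ab.1 * ab.2)
        * (coeff ab.1 h * coeff ab.2 h)
      = ((ab.1 : ℂ) * (ab.1 * coeff ab.1 h)) * coeff ab.2 h
        - (ab.1 * coeff ab.1 h) * (ab.2 * coeff ab.2 h) := fun ab => by ring
  simp only [e]
  linear_combination (1 / 4) * key

/-! ### Formal exponentials -/

/-- The power series of `exp (a s)`. -/
def expS (a : ℂ) : ℂ⟦X⟧ := rescale a (exp ℂ)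

/-- The power series of `sin (a s)`. -/
def sinS (a : ℂ) : ℂ⟦X⟧ := C (1 / (2 * Complex.I)) * (expS (a * Complex.I)
    - expS (-(a * Complex.I)))

/-- The power series of `cos (a s)`. -/
def cosS (a : ℂ) : ℂ⟦X⟧ := C (1 / 2) * (expS (a * Complex.I) + expS (-(a * Complex.I)))

theorem coeff_expS (a : ℂ) (n : ℕ) : coeff n (expS a) = a ^ n / n ! := by
  simp [expS, coeff_rescale, coeff_exp, div_eq_mul_inv]

theorem expS_add (a b : ℂ) : expS (a + b) = expS a * expS b :=
  (exp_mul_exp_eq_exp_add a b).symm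

theorem expS_zero : expS 0 = 1 := by
  ext n
  cases n <;> simp [coeff_expS, coeff_one]

theorem derivative_expS (a : ℂ) : d⁄dX ℂ (expS a) = C a * expS a := by
  ext n
  rw [coeff_derivative, coeff_C_mul, coeff_expS, coeff_expS, Nat.factorial_succ]
  have h1 : (n : ℂ) + 1 ≠ 0 := Nat.cast_add_one_ne_zero n
  have h2 : (n ! : ℂ) ≠ 0 := by exact_mod_cast n.factorial_ne_zero
  push_cast
  field_simp
  ring

theorem C_I_mul_C_I : (C Complex.I : ℂ⟦X⟧) * C Complex.I = -1 := by
  rw [← map_mul, Complex.I_mul_I]; simp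

theorem C_inv_two_I : (C (1 / (2 * Complex.I)) : ℂ⟦X⟧) = -(C (1 / 2) * C Complex.I) := by
  rw [← map_mul, ← map_neg]
  congr 1
  rw [one_div, mul_inv, Complex.inv_I]; ring

theorem two_mul_C_half : (2 : ℂ⟦X⟧) * C (1 / 2) = 1 := by
  have : (2 : ℂ⟦X⟧) = C 2 := (map_ofNat C 2).symm
  rw [this, ← map_mul]; norm_num

theorem derivative_sinS (a : ℂ) : d⁄dX ℂ (sinS a) = C a * cosS a := by
  rw [sinS, Derivation.leibniz, map_sub, derivative_expS, derivative_expS, derivative_C, cosS,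
    C_inv_two_I]
  simp only [smul_eq_mul, map_mul, map_neg]
  linear_combination (-C (1 / 2) * C a * (expS (a * Complex.I) + expS (-(a * Complex.I))))
    * C_I_mul_C_I

theorem derivative_cosS (a : ℂ) : d⁄dX ℂ (cosS a) = -(C a * sinS a) := by
  rw [cosS, Derivation.leibniz, map_add, derivative_expS, derivative_expS, derivative_C, sinS,
    C_inv_two_I]
  simp only [smul_eq_mul, map_mul, map_neg]
  ring

theorem sinS_mul_cosS (a b : ℂ) :
    2 * (sinS a * cosS b) = sinS (a + b) + sinS (a - b) := by
  simp only [sinS, cosS, C_inv_two_I]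
  rw [show (a + b) * Complex.I = a * Complex.I + b * Complex.I by ring,
    show (a - b) * Complex.I = a * Complex.I + -(b * Complex.I) by ring, neg_add, neg_add, neg_neg]
  simp only [expS_add]
  linear_combination (-C Complex.I * C (1 / 2) * (expS (a * Complex.I) - expS (-(a * Complex.I)))
    * (expS (b * Complex.I) + expS (-(b * Complex.I)))) * two_mul_C_half

theorem cosS_mul_cosS (a b : ℂ) :
    2 * (cosS a * cosS b) = cosS (a + b) + cosS (a - b) := by
  simp only [cosS]
  rw [show (a + b) * Complex.I = a * Complex.I + b * Complex.I by ring,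
    show (a - b) * Complex.I = a * Complex.I + -(b * Complex.I) by ring, neg_add, neg_add, neg_neg]
  simp only [expS_add]
  linear_combination (C (1 / 2) * (expS (a * Complex.I) + expS (-(a * Complex.I)))
    * (expS (b * Complex.I) + expS (-(b * Complex.I)))) * two_mul_C_half

theorem sinS_mul_sinS (a b : ℂ) :
    2 * (sinS a * sinS b) = cosS (a - b) - cosS (a + b) := by
  simp only [sinS, cosS, C_inv_two_I]
  rw [show (a + b) * Complex.I = a * Complex.I + b * Complex.I by ring,
    show (a - b) * Complex.I = a * Complex.I + -(b * Complex.I) by ring, neg_add, neg_add, neg_neg]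
  simp only [expS_add]
  linear_combination (-C (1 / 2) * (expS (a * Complex.I) - expS (-(a * Complex.I)))
    * (expS (b * Complex.I) - expS (-(b * Complex.I)))) * two_mul_C_half
    + (2 * C (1 / 2) ^ 2 * (expS (a * Complex.I) - expS (-(a * Complex.I)))
    * (expS (b * Complex.I) - expS (-(b * Complex.I)))) * C_I_mul_C_I

theorem cosS_zero : cosS 0 = 1 := by
  rw [cosS, zero_mul, neg_zero, expS_zero]
  linear_combination two_mul_C_half

theorem sinS_zero : sinS 0 = 0 := by
  rw [sinS, zero_mul, neg_zero, sub_self, mul_zero]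

theorem cosS_neg (a : ℂ) : cosS (-a) = cosS a := by
  rw [cosS, cosS, neg_mul, neg_neg, add_comm]

theorem cosS_sq_add_sinS_sq (a : ℂ) : cosS a ^ 2 + sinS a ^ 2 = 1 := by
  have h1 := cosS_mul_cosS a a
  have h2 := sinS_mul_sinS a a
  rw [sub_self, cosS_zero] at h1 h2
  linear_combination C (1 / 2) * (h1 + h2)
    - (cosS a ^ 2 + sinS a ^ 2 - 1) * two_mul_C_half

theorem coeff_sinS_odd (a : ℂ) (l : ℕ) :
    coeff (2 * l + 1) (sinS a) = (-1) ^ l * a ^ (2 * l + 1) / (2 * l + 1)! := by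
  rw [sinS, coeff_C_mul, map_sub, coeff_expS, coeff_expS, Odd.neg_pow ⟨l, rfl⟩, mul_pow,
    pow_succ Complex.I, pow_mul Complex.I, Complex.I_sq]
  have := Complex.I_ne_zero
  field_simp
  ring

theorem coeff_sinS_even (a : ℂ) (l : ℕ) : coeff (2 * l) (sinS a) = 0 := by
  rw [sinS, coeff_C_mul, map_sub, coeff_expS, coeff_expS, Even.neg_pow ⟨l, by ring⟩, sub_self,
    mul_zero]

theorem coeff_cosS_even (a : ℂ) (l : ℕ) :
    coeff (2 * l) (cosS a) = (-1) ^ l * a ^ (2 * l) / (2 * l)! := by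
  rw [cosS, coeff_C_mul, map_add, coeff_expS, coeff_expS, Even.neg_pow ⟨l, by ring⟩, mul_pow,
    pow_mul Complex.I, Complex.I_sq]
  ring

theorem coeff_cosS_odd (a : ℂ) (l : ℕ) : coeff (2 * l + 1) (cosS a) = 0 := by
  rw [cosS, coeff_C_mul, map_add, coeff_expS, coeff_expS, Odd.neg_pow ⟨l, rfl⟩]
  ring

end

/-! ### The function cot(2s) h(y sin 2s) as a formal solution, and its Fourier expansion. -/

section


open PowerSeries

/-- The coefficient of `y ^ n` in `cot (2 s) h (y sin (2 s))`, as a power series in `s`. -/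
def ySeries (h : ℂ⟦X⟧) (n : ℕ) : ℂ⟦X⟧ :=
  C (coeff n h) * (sinS 2 ^ (n - 1) * cosS 2)

/-- The coefficient of `s ^ p` in `cot (2 s) h (y sin (2 s))`, as a polynomial in `y`. -/
def yPoly (h : ℂ⟦X⟧) (p : ℕ) : Polynomial ℂ :=
  ∑ n ∈ Finset.range (p + 2), Polynomial.C (coeff p (ySeries h n)) * Polynomial.X ^ n

theorem X_dvd_sinS (a : ℂ) : X ∣ sinS a := by
  rw [X_dvd_iff, ← coeff_zero_eq_constantCoeff_apply]
  exact coeff_sinS_even a 0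

/-- The y^n coefficient is divisible by s^(n-1); hence the s^p coefficient is a polynomial in y of
degree at most p + 1. -/
theorem coeff_ySeries_eq_zero (h : ℂ⟦X⟧) {n p : ℕ} (hn : p + 2 ≤ n) :
    coeff p (ySeries h n) = 0 := by
  have : (X : ℂ⟦X⟧) ^ (n - 1) ∣ ySeries h n :=
    (((pow_dvd_pow_of_dvd (X_dvd_sinS 2) (n - 1)).mul_right _)).mul_left _
  exact X_pow_dvd_iff.mp this p (by omega)

theorem coeff_yPoly (h : ℂ⟦X⟧) (n p : ℕ) : (yPoly h p).coeff n = coeff p (ySeries h n) := by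
  rw [yPoly]
  by_cases hn : n < p + 2
  · exact coeff_sum_C_mul_X_pow _ (fun n => n) _ (fun x _ y _ hxy => hxy) (Finset.mem_range.mpr hn)
  · rw [coeff_ySeries_eq_zero h (not_lt.mp hn)]
    refine coeff_sum_C_mul_X_pow_eq_zero _ (fun n => n) _ fun r hr hrn => hn ?_
    have hrn' : r = n := hrn
    rw [← hrn']; exact Finset.mem_range.mp hr

/-- Multiplying by the sine restores the exponent n. For n = 0 the exponent n - 1 is truncated,
which is harmless because h has no constant term. -/
theorem sinS_mul_ySeries (h : ℂ⟦X⟧) (h0 : coeff 0 h = 0) (n : ℕ) :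
    sinS 2 * ySeries h n = C (coeff n h) * (sinS 2 ^ n * cosS 2) := by
  cases n with
  | zero => simp [ySeries, h0]
  | succ n => rw [ySeries, Nat.add_sub_cancel, pow_succ]; ring

theorem sinS_sq_mul_derivative_ySeries (h : ℂ⟦X⟧) (h0 : coeff 0 h = 0) (n : ℕ) :
    sinS 2 ^ 2 * d⁄dX ℂ (ySeries h n)
      = C (coeff n h) * sinS 2 ^ n * (2 * (n - 1) - 2 * n * sinS 2 ^ 2) := by
  have h2 : (C 2 : ℂ⟦X⟧) = 2 := map_ofNat C 2
  have hsq := cosS_sq_add_sinS_sq 2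
  rcases n with _ | _ | n
  · simp [ySeries, h0]
  · rw [ySeries, Derivation.leibniz, derivative_C, Derivation.leibniz, derivative_cosS, zero_add,
      Nat.sub_self, pow_zero, Derivation.map_one_eq_zero, h2]
    simp only [smul_eq_mul]
    push_cast; ring
  · rw [ySeries, Derivation.leibniz, derivative_C, Derivation.leibniz, derivative_cosS,
      Nat.add_sub_cancel, Derivation.leibniz_pow, derivative_sinS, h2]
    simp only [smul_eq_mul, nsmul_eq_mul, Nat.add_sub_cancel]
    push_cast
    linear_combination (2 * (n + 1) * C (coeff (n + 1 + 1) h) * sinS 2 ^ (n + 2)) * hsq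

/-- The weight is ab(a - b), antisymmetric under exchange of a and b. -/
theorem sum_antidiagonal_antisymm (c : ℕ → ℂ) (N : ℕ) :
    ∑ ab ∈ Finset.HasAntidiagonal.antidiagonal N, ((ab.1 : ℂ) ^ 2 - ab.1 * ab.2) * ab.2
      * (c ab.1 * c ab.2) = 0 := by
  have h := Finset.Nat.sum_antidiagonal_swap (n := N) (f := fun ab : ℕ × ℕ =>
    ((ab.1 : ℂ) ^ 2 - ab.1 * ab.2) * ab.2 * (c ab.1 * c ab.2))
  have h2 : ∑ ab ∈ Finset.HasAntidiagonal.antidiagonal N, ((ab.1 : ℂ) ^ 2 - ab.1 * ab.2) * ab.2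
      * (c ab.1 * c ab.2) = -∑ ab ∈ Finset.HasAntidiagonal.antidiagonal N,
      ((ab.1 : ℂ) ^ 2 - ab.1 * ab.2) * ab.2 * (c ab.1 * c ab.2) := by
    conv_lhs => rw [← h]
    rw [← Finset.sum_neg_distrib]
    refine Finset.sum_congr rfl fun ab _ => ?_
    simp only [Prod.fst_swap, Prod.snd_swap]
    ring
  linear_combination (1 / 2) * h2

/-- With S = sin 2s, the derivative of S^(b-1) cos 2s times S^2 is 2 S^b (b (1 - S^2) - 1). The part
proportional to b cancels by antisymmetry, and the constant -1 leaves the convolution of the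
coefficients of h. -/
theorem sum_ySeries_mul_derivative (h : ℂ⟦X⟧) (h0 : coeff 0 h = 0) (N : ℕ) :
    sinS 2 ^ 3 * ∑ ab ∈ Finset.HasAntidiagonal.antidiagonal N,
      C ((ab.1 : ℂ) ^ 2 - ab.1 * ab.2) * (ySeries h ab.1 * d⁄dX ℂ (ySeries h ab.2))
    = -2 * sinS 2 ^ N * cosS 2 * C (∑ ab ∈ Finset.HasAntidiagonal.antidiagonal N,
      ((ab.1 : ℂ) ^ 2 - ab.1 * ab.2) * (coeff ab.1 h * coeff ab.2 h)) := by
  have key : ∀ ab ∈ Finset.HasAntidiagonal.antidiagonal N,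
      sinS 2 ^ 3 * (C ((ab.1 : ℂ) ^ 2 - ab.1 * ab.2)
        * (ySeries h ab.1 * d⁄dX ℂ (ySeries h ab.2)))
      = (2 * sinS 2 ^ N * cosS 2 * (1 - sinS 2 ^ 2))
          * C (((ab.1 : ℂ) ^ 2 - ab.1 * ab.2) * ab.2 * (coeff ab.1 h * coeff ab.2 h))
        + (-2 * sinS 2 ^ N * cosS 2)
          * C (((ab.1 : ℂ) ^ 2 - ab.1 * ab.2) * (coeff ab.1 h * coeff ab.2 h)) := by
    rintro ⟨a, b⟩ hab
    rw [Finset.HasAntidiagonal.mem_antidiagonal] at hab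
    simp only at hab ⊢
    have e1 := sinS_mul_ySeries h h0 a
    have e2 := sinS_sq_mul_derivative_ySeries h h0 b
    rw [← hab, pow_add]
    simp only [map_mul, map_natCast]
    generalize (C ((a : ℂ) ^ 2 - a * b) : ℂ⟦X⟧) = w
    calc sinS 2 ^ 3 * (w * (ySeries h a * d⁄dX ℂ (ySeries h b)))
        = w * (sinS 2 * ySeries h a) * (sinS 2 ^ 2 * d⁄dX ℂ (ySeries h b)) := by ring
      _ = _ := by rw [e1, e2]; ring
  rw [Finset.mul_sum, Finset.sum_congr rfl key, Finset.sum_add_distrib, ← Finset.mul_sum,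
    ← Finset.mul_sum, ← map_sum, ← map_sum, sum_antidiagonal_antisymm (fun n => coeff n h),
        map_zero,
    mul_zero, zero_add]

theorem sinS_ne_zero : sinS 2 ≠ 0 := by
  intro h
  have := coeff_sinS_odd 2 0
  rw [h] at this
  simp at this

/-- The y^(n+2) coefficient of the differential equation, reduced to `convolution_identity` after
multiplication by the cube of the sine. -/
theorem ySeries_pde {v : ℂ⟦X⟧} (h0 : constantCoeff v = 1) (hv : v - v ^ 3 = X) {h : ℂ⟦X⟧}
    (hh : h = X * avg v) (n : ℕ) :
    C (1 / 4 * (9 * (n : ℂ) ^ 2 - 18 * n + 8)) * ySeries h n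
      + C (1 / 2) * ∑ ab ∈ Finset.HasAntidiagonal.antidiagonal (n + 2),
      C ((ab.1 : ℂ) ^ 2 - ab.1 * ab.2) * (ySeries h ab.1 * d⁄dX ℂ (ySeries h ab.2)) = 0 := by
  have hc : coeff 0 h = 0 := by rw [hh]; simp
  refine mul_left_cancel₀ (pow_ne_zero 3 sinS_ne_zero) ?_
  have e1 := sum_ySeries_mul_derivative h hc (n + 2)
  have e2 := sinS_mul_ySeries h hc n
  have e3 := convolution_identity h0 hv n
  rw [← hh] at e3
  rw [← e3, map_mul] at e1
  rw [mul_zero, mul_add, mul_left_comm _ (C (1 / 2)), e1]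
  linear_combination (C (1 / 4 * (9 * (n : ℂ) ^ 2 - 18 * n + 8)) * sinS 2 ^ 2) * e2
    - (sinS 2 ^ (n + 2) * cosS 2 * C (1 / 4 * (9 * (n : ℂ) ^ 2 - 18 * n + 8)) * C (coeff n h))
      * two_mul_C_half

theorem sum_ySeries_of_lt_two (h : ℂ⟦X⟧) (h0 : coeff 0 h = 0) {N : ℕ} (hN : N < 2) :
    ∑ ab ∈ Finset.HasAntidiagonal.antidiagonal N,
      C ((ab.1 : ℂ) ^ 2 - ab.1 * ab.2) * (ySeries h ab.1 * d⁄dX ℂ (ySeries h ab.2)) = 0 := by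
  have hy : ySeries h 0 = 0 := by rw [ySeries, h0]; simp
  refine Finset.sum_eq_zero fun ab hab => ?_
  rw [Finset.HasAntidiagonal.mem_antidiagonal] at hab
  have : ab.1 = 0 ∨ ab.2 = 0 := by omega
  rcases this with h1 | h1 <;> simp [h1, hy]

theorem coeff_bilinear_yPoly (h : ℂ⟦X⟧) (p N : ℕ) :
    (∑ ij ∈ Finset.HasAntidiagonal.antidiagonal p, Polynomial.C (((ij.2 : ℂ) + 1) / 2)
      * (euler (euler (yPoly h ij.1)) * yPoly h (ij.2 + 1)
        - euler (yPoly h ij.1) * euler (yPoly h (ij.2 + 1)))).coeff N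
    = coeff p (C (1 / 2) * ∑ ab ∈ Finset.HasAntidiagonal.antidiagonal N,
      C ((ab.1 : ℂ) ^ 2 - ab.1 * ab.2) * (ySeries h ab.1 * d⁄dX ℂ (ySeries h ab.2))) := by
  rw [Polynomial.finsetSum_coeff, coeff_C_mul, map_sum]
  simp only [Polynomial.coeff_C_mul, Polynomial.coeff_sub, coeff_C_mul]
  simp only [Polynomial.coeff_mul, coeff_euler, coeff_yPoly, coeff_derivative, coeff_mul,
      Finset.mul_sum, ← Finset.sum_sub_distrib]
  rw [Finset.sum_comm]
  refine Finset.sum_congr rfl fun ab _ => Finset.sum_congr rfl fun ij _ => ?_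
  ring

theorem pdeCoeff_yPoly {v : ℂ⟦X⟧} (h0 : constantCoeff v = 1) (hv : v - v ^ 3 = X) {h : ℂ⟦X⟧}
    (hh : h = X * avg v) (p : ℕ) : pdeCoeff (yPoly h) p = 0 := by
  have hc : coeff 0 h = 0 := by rw [hh]; simp
  ext N
  have e9 : (9 : Polynomial ℂ) = Polynomial.C 9 := (map_ofNat Polynomial.C 9).symm
  have e18 : (18 : Polynomial ℂ) = Polynomial.C 18 := (map_ofNat Polynomial.C 18).symm
  have e8 : (8 : Polynomial ℂ) = Polynomial.C 8 := (map_ofNat Polynomial.C 8).symm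
  rw [pdeCoeff, Polynomial.coeff_add, coeff_bilinear_yPoly, Polynomial.coeff_zero, mul_assoc,
    Polynomial.coeff_C_mul, Polynomial.coeff_X_pow_mul', e9, e18, e8]
  by_cases hN : 2 ≤ N
  · obtain ⟨n, rfl⟩ := Nat.exists_eq_add_of_le' hN
    have key := congrArg (coeff p) (ySeries_pde h0 hv hh n)
    rw [map_add, coeff_C_mul, map_zero] at key
    rw [if_pos hN, Nat.add_sub_cancel, ← key]
    simp only [Polynomial.coeff_add, Polynomial.coeff_sub, Polynomial.coeff_C_mul, coeff_euler,
      coeff_yPoly]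
    ring
  · rw [if_neg hN, sum_ySeries_of_lt_two h hc (not_le.mp hN)]
    simp

/-! ### Trigonometric expansions -/

theorem sinS_pow_odd_mul_cosS_mem (k : ℕ) : sinS 2 ^ (2 * k + 1) * cosS 2 ∈
    Submodule.span ℂ ((fun i : ℕ => sinS (4 * i)) '' (Finset.Icc 1 (k + 1) : Finset ℕ)) := by
  have hhalf : (C (1 / 2) : ℂ⟦X⟧) * 2 = 1 := by rw [mul_comm]; exact two_mul_C_half
  induction k with
  | zero =>
    have e : sinS 2 ^ (2 * 0 + 1) * cosS 2 = (1 / 2 : ℂ) • sinS (4 * (1 : ℕ)) := by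
      have := sinS_mul_cosS 2 2
      rw [sub_self, sinS_zero, add_zero] at this
      rw [smul_eq_C_mul, Nat.cast_one, mul_one, show (4 : ℂ) = 2 + 2 by norm_num, ← this,
        ← mul_assoc, hhalf]
      ring
    rw [e]
    exact Submodule.smul_mem _ _ (Submodule.subset_span ⟨1, by simp, rfl⟩)
  | succ k ih =>
    have e : sinS 2 ^ (2 * (k + 1) + 1) * cosS 2
        = LinearMap.mulLeft ℂ (sinS 2 ^ 2) (sinS 2 ^ (2 * k + 1) * cosS 2) := by
      rw [LinearMap.mulLeft_apply]; ring
    rw [e]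
    refine (Submodule.map_span_le _ _ _).mpr ?_ (Submodule.mem_map_of_mem ih)
    rintro _ ⟨i, hi, rfl⟩
    simp only [Finset.coe_Icc, Set.mem_Icc] at hi
    obtain ⟨i, rfl⟩ := Nat.exists_eq_add_of_le' hi.1
    -- Since sin(2s)^2 = (1 - cos 4s)/2, multiplication by it shifts the frequency by 0 or ±4; at
    -- the lower end sin 0 = 0.
    have e1 : LinearMap.mulLeft ℂ (sinS 2 ^ 2) (sinS (4 * ((i + 1 : ℕ) : ℂ)))
        = (1 / 2 : ℂ) • sinS (4 * ((i + 1 : ℕ) : ℂ)) - (1 / 4 : ℂ) • sinS (4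
            * ((i + 1 + 1 : ℕ) : ℂ))
          - (1 / 4 : ℂ) • sinS (4 * (i : ℂ)) := by
      have h1 := sinS_mul_sinS 2 2
      have h2 := sinS_mul_cosS (4 * ((i + 1 : ℕ) : ℂ)) 4
      rw [sub_self, cosS_zero, show (2 : ℂ) + 2 = 4 by norm_num] at h1
      rw [show 4 * ((i + 1 : ℕ) : ℂ) + 4 = 4 * ((i + 1 + 1 : ℕ) : ℂ) by push_cast; ring,
        show 4 * ((i + 1 : ℕ) : ℂ) - 4 = 4 * (i : ℂ) by push_cast; ring] at h2
      rw [LinearMap.mulLeft_apply]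
      simp only [smul_eq_C_mul]
      have h4 : (C (1 / 4) : ℂ⟦X⟧) = C (1 / 2) * C (1 / 2) := by rw [← map_mul]; norm_num
      rw [h4]
      linear_combination (C (1 / 2) * sinS (4 * ((i + 1 : ℕ) : ℂ))) * h1
        - C (1 / 2) * C (1 / 2) * h2
        + (-(sinS 2 ^ 2 * sinS (4 * ((i + 1 : ℕ) : ℂ)))
          + C (1 / 2) * sinS (4 * ((i + 1 : ℕ) : ℂ)) * cosS 4) * two_mul_C_half
    rw [e1]
    have hm : ∀ j : ℕ, j ≤ k + 2 → sinS (4 * (j : ℂ)) ∈ Submodule.span ℂ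
        ((fun i : ℕ => sinS (4 * i)) '' (Finset.Icc 1 (k + 1 + 1) : Finset ℕ)) := by
      intro j hj
      rcases Nat.eq_zero_or_pos j with rfl | hj0
      · rw [Nat.cast_zero, mul_zero, sinS_zero]; exact Submodule.zero_mem _
      · exact Submodule.subset_span ⟨j, by simp; omega, rfl⟩
    exact Submodule.sub_mem _ (Submodule.sub_mem _ (Submodule.smul_mem _ _ (hm _ (by omega)))
      (Submodule.smul_mem _ _ (hm _ (by omega)))) (Submodule.smul_mem _ _ (hm _ (by omega)))

theorem sinS_pow_even_mul_cosS_mem (k : ℕ) : sinS 2 ^ (2 * k) * cosS 2 ∈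
    Submodule.span ℂ ((fun i : ℕ => cosS (4 * i - 2)) '' (Finset.Icc 1 (k + 1) : Finset ℕ)) := by
  induction k with
  | zero =>
    refine Submodule.subset_span ⟨1, by simp, ?_⟩
    simp only [mul_zero, pow_zero, one_mul]
    norm_num
  | succ k ih =>
    have e : sinS 2 ^ (2 * (k + 1)) * cosS 2
        = LinearMap.mulLeft ℂ (sinS 2 ^ 2) (sinS 2 ^ (2 * k) * cosS 2) := by
      rw [LinearMap.mulLeft_apply]; ring
    rw [e]
    refine (Submodule.map_span_le _ _ _).mpr ?_ (Submodule.mem_map_of_mem ih)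
    rintro _ ⟨i, hi, rfl⟩
    simp only [Finset.coe_Icc, Set.mem_Icc] at hi
    obtain ⟨i, rfl⟩ := Nat.exists_eq_add_of_le' hi.1
    -- The same frequency shift; at the lower end cos(-2s) = cos(2s) folds back to i = 1.
    have e1 : LinearMap.mulLeft ℂ (sinS 2 ^ 2) (cosS (4 * ((i + 1 : ℕ) : ℂ) - 2))
        = (1 / 2 : ℂ) • cosS (4 * ((i + 1 : ℕ) : ℂ) - 2)
          - (1 / 4 : ℂ) • cosS (4 * ((i + 1 + 1 : ℕ) : ℂ) - 2)
          - (1 / 4 : ℂ) • cosS (4 * (i : ℂ) - 2) := by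
      have h1 := sinS_mul_sinS 2 2
      have h2 := cosS_mul_cosS (4 * ((i + 1 : ℕ) : ℂ) - 2) 4
      rw [sub_self, cosS_zero, show (2 : ℂ) + 2 = 4 by norm_num] at h1
      rw [show 4 * ((i + 1 : ℕ) : ℂ) - 2 + 4 = 4 * ((i + 1 + 1 : ℕ) : ℂ) - 2 by push_cast; ring,
        show 4 * ((i + 1 : ℕ) : ℂ) - 2 - 4 = 4 * (i : ℂ) - 2 by push_cast; ring] at h2
      rw [LinearMap.mulLeft_apply]
      simp only [smul_eq_C_mul]
      have h4 : (C (1 / 4) : ℂ⟦X⟧) = C (1 / 2) * C (1 / 2) := by rw [← map_mul]; norm_num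
      rw [h4]
      linear_combination (C (1 / 2) * cosS (4 * ((i + 1 : ℕ) : ℂ) - 2)) * h1
        - C (1 / 2) * C (1 / 2) * h2
        + (-(sinS 2 ^ 2 * cosS (4 * ((i + 1 : ℕ) : ℂ) - 2))
          + C (1 / 2) * cosS (4 * ((i + 1 : ℕ) : ℂ) - 2) * cosS 4) * two_mul_C_half
    rw [e1]
    have hm : ∀ j : ℕ, j ≤ k + 2 → cosS (4 * (j : ℂ) - 2) ∈ Submodule.span ℂ
        ((fun i : ℕ => cosS (4 * i - 2)) '' (Finset.Icc 1 (k + 1 + 1) : Finset ℕ)) := by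
      intro j hj
      rcases Nat.eq_zero_or_pos j with rfl | hj0
      · refine Submodule.subset_span ⟨1, by simp, ?_⟩
        simp only [Nat.cast_one, Nat.cast_zero, mul_one, mul_zero, zero_sub, cosS_neg]
        norm_num
      · exact Submodule.subset_span ⟨j, by simp; omega, rfl⟩
    exact Submodule.sub_mem _ (Submodule.sub_mem _ (Submodule.smul_mem _ _ (hm _ (by omega)))
      (Submodule.smul_mem _ _ (hm _ (by omega)))) (Submodule.smul_mem _ _ (hm _ (by omega)))

theorem exists_sinS_expansion (k : ℕ) : ∃ β : ℕ → ℂ,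
    sinS 2 ^ (2 * k + 1) * cosS 2 = ∑ i ∈ Finset.Icc 1 (k + 1), β i • sinS (4 * i) := by
  obtain ⟨β, hβ⟩ := (Submodule.mem_span_image_finset_iff_exists_fun' ℂ).mp
    (sinS_pow_odd_mul_cosS_mem k)
  exact ⟨β, hβ.symm⟩

theorem exists_cosS_expansion (k : ℕ) : ∃ β : ℕ → ℂ,
    sinS 2 ^ (2 * k) * cosS 2 = ∑ i ∈ Finset.Icc 1 (k + 1), β i • cosS (4 * i - 2) := by
  obtain ⟨β, hβ⟩ := (Submodule.mem_span_image_finset_iff_exists_fun' ℂ).mp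
    (sinS_pow_even_mul_cosS_mem k)
  exact ⟨β, hβ.symm⟩

end

/-! ### Existence of the arrays, and identification of the f_p with the formal solution. -/

section


open PowerSeries

theorem coeff_odd_ySeries_odd (h : ℂ⟦X⟧) (k l : ℕ) :
    coeff (2 * l + 1) (ySeries h (2 * k + 1)) = 0 := by
  obtain ⟨β, hβ⟩ := exists_cosS_expansion k
  rw [ySeries, Nat.add_sub_cancel, hβ, coeff_C_mul, map_sum]
  refine mul_eq_zero_of_right _ (Finset.sum_eq_zero fun i _ => ?_)
  rw [smul_eq_C_mul, coeff_C_mul, coeff_cosS_odd, mul_zero]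

theorem coeff_even_ySeries_even (h : ℂ⟦X⟧) (h0 : coeff 0 h = 0) (k l : ℕ) :
    coeff (2 * l) (ySeries h (2 * k)) = 0 := by
  cases k with
  | zero => rw [ySeries, mul_zero, h0]; simp
  | succ k =>
    obtain ⟨β, hβ⟩ := exists_sinS_expansion k
    rw [ySeries, show 2 * (k + 1) - 1 = 2 * k + 1 by omega, hβ, coeff_C_mul, map_sum]
    refine mul_eq_zero_of_right _ (Finset.sum_eq_zero fun i _ => ?_)
    rw [smul_eq_C_mul, coeff_C_mul, coeff_sinS_even, mul_zero]

theorem exists_bPart (h : ℂ⟦X⟧) : ∃ b : ℕ → ℕ → ℂ, ∀ t l, 1 ≤ t →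
    bPart b t l = coeff (2 * l + 1) (ySeries h (2 * t)) := by
  choose β hβ using exists_sinS_expansion
  -- Chosen so that (4s)^(2l+1) splits as 64 s^(2t-3), absorbed into b, times 2^(4l-4) s^(2l-2t+4),
  -- present in `bPart`.
  refine ⟨fun s t => 64 * coeff (2 * t) h * β (t - 1) s * (s : ℂ) ^ (2 * (t : ℤ) - 3), ?_⟩
  intro t l ht
  obtain ⟨k, rfl⟩ := Nat.exists_eq_add_of_le' ht
  rw [ySeries, show 2 * (k + 1) - 1 = 2 * k + 1 by omega, hβ, coeff_C_mul, map_sum, bPart,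
    Nat.add_sub_cancel, Finset.mul_sum, Finset.mul_sum]
  refine Finset.sum_congr rfl fun s hs => ?_
  have hs0 : (s : ℂ) ≠ 0 := by
    have := (Finset.mem_Icc.mp hs).1
    exact_mod_cast (by omega : s ≠ 0)
  rw [smul_eq_C_mul, coeff_C_mul, coeff_sinS_odd, mul_pow]
  have e1 : (s : ℂ) ^ (2 * l + 1) = (s : ℂ) ^ (2 * (l : ℤ) - 2 * ((k + 1 : ℕ) : ℤ) + 4)
      * (s : ℂ) ^ (2 * ((k + 1 : ℕ) : ℤ) - 3) := by
    rw [← zpow_add₀ hs0, ← zpow_natCast]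
    congr 1; push_cast; ring
  have e2 : (4 : ℂ) ^ (2 * l + 1) = 64 * (2 : ℂ) ^ (4 * (l : ℤ) - 4) := by
    rw [zpow_sub₀ two_ne_zero, zpow_mul, zpow_natCast, pow_add, pow_mul]
    norm_num
    ring
  rw [e1, e2]
  ring

theorem exists_dPart (h : ℂ⟦X⟧) (h1 : coeff 1 h = 1) : ∃ d : ℕ → ℕ → ℂ, d 1 1 = 1 ∧
    ∀ r l, dPart d (r + 1) l = coeff (2 * l) (ySeries h (2 * r + 1)) := by
  choose β hβ using exists_cosS_expansion
  -- The same splitting for (4m - 2)^(2l); `dPart` treats r = 1 separately, so that column is free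
  -- to carry the normalisation.
  refine ⟨fun m r => if r = 1 then 1 else (-1) ^ (m + 1) * (2 : ℂ) ^ (2 * (r : ℤ) - 5)
    * coeff (2 * r - 1) h * β (r - 1) m * (2 * (m : ℂ) - 1) ^ (2 * (r : ℤ) - 4), if_pos rfl, ?_⟩
  intro r l
  cases r with
  | zero =>
    rw [zero_add, dPart_one, ySeries, h1, mul_zero, zero_add, Nat.sub_self, pow_zero, one_mul,
      coeff_C_mul, coeff_cosS_even]
    ring
  | succ k =>
    rw [dPart_of_ne_one _ (by omega), ySeries, Nat.add_sub_cancel, hβ, coeff_C_mul, map_sum, dSum,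
      Finset.mul_sum, Finset.mul_sum]
    refine Finset.sum_congr rfl fun m hm => ?_
    have hm0 : (2 * (m : ℂ) - 1) ≠ 0 := by
      have := (Finset.mem_Icc.mp hm).1
      rw [← cast_two_mul_sub_one this]
      exact_mod_cast (by omega : 2 * m - 1 ≠ 0)
    rw [smul_eq_C_mul, coeff_C_mul, coeff_cosS_even, if_neg (by omega), Nat.add_sub_cancel,
      show 2 * (k + 1 + 1) - 1 = 2 * (k + 1) + 1 by omega,
      show 4 * (m : ℂ) - 2 = 2 * (2 * m - 1) by ring, mul_pow]
    have e1 : (2 * (m : ℂ) - 1) ^ (2 * l)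
        = (2 * (m : ℂ) - 1) ^ (2 * (l : ℤ) - 2 * ((k + 1 + 1 : ℕ) : ℤ) + 4)
        * (2 * (m : ℂ) - 1) ^ (2 * ((k + 1 + 1 : ℕ) : ℤ) - 4) := by
      rw [← zpow_add₀ hm0, ← zpow_natCast]
      congr 1; push_cast; ring
    have e2 : (2 : ℂ) ^ (2 * l) = (2 : ℂ) ^ (2 * (l : ℤ) + 5 - 2 * ((k + 1 + 1 : ℕ) : ℤ))
        * (2 : ℂ) ^ (2 * ((k + 1 + 1 : ℕ) : ℤ) - 5) := by
      rw [← zpow_add₀ two_ne_zero, ← zpow_natCast]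
      congr 1; push_cast; ring
    have e3 : ((-1 : ℂ) ^ m) * (-1) ^ m = 1 := by rw [← mul_pow]; norm_num
    rw [e1, e2]
    simp only [pow_succ (-1 : ℂ)]
    linear_combination ((-1 : ℂ) ^ l * (2 : ℂ) ^ (2 * (l : ℤ) + 5 - 2 * ((k + 1 + 1 : ℕ) : ℤ))
        * (2 : ℂ) ^ (2 * ((k + 1 + 1 : ℕ) : ℤ) - 5)
        * ((2 * (m : ℂ) - 1) ^ (2 * (l : ℤ) - 2 * ((k + 1 + 1 : ℕ) : ℤ) + 4)
        * (2 * (m : ℂ) - 1) ^ (2 * ((k + 1 + 1 : ℕ) : ℤ) - 4)) / (2 * l)!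
        * coeff (2 * (k + 1) + 1) h * β (k + 1) m) * e3

theorem sPoly_eq_yPoly {b d : ℕ → ℕ → ℂ} {h : ℂ⟦X⟧} (h0 : coeff 0 h = 0)
    (hb : ∀ t l, 1 ≤ t → bPart b t l = coeff (2 * l + 1) (ySeries h (2 * t)))
    (hd : ∀ r l, dPart d (r + 1) l = coeff (2 * l) (ySeries h (2 * r + 1))) (p : ℕ) :
    sPoly b d p = yPoly h p := by
  ext n
  rw [coeff_yPoly]
  rcases Nat.even_or_odd' p with ⟨l, rfl | rfl⟩ <;> rcases Nat.even_or_odd' n with ⟨k, rfl | rfl⟩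
  · rw [coeff_even_ySeries_even h h0, sPoly_even, coeff_sum_C_mul_X_pow_eq_zero]
    intro r hr
    have := (Finset.mem_Icc.mp hr).1
    omega
  · by_cases hk : k ≤ l
    · rw [← hd, ← coeff_sPoly_even b d (by omega) (by omega)]
      congr 1
    · rw [coeff_ySeries_eq_zero h (by omega), sPoly_even, coeff_sum_C_mul_X_pow_eq_zero]
      intro r hr
      have := (Finset.mem_Icc.mp hr).2
      omega
  · by_cases hk : 1 ≤ k ∧ k ≤ l + 1
    · rw [← hb k l hk.1, coeff_sPoly_odd b d hk.1 hk.2]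
    · rw [sPoly_odd, coeff_sum_C_mul_X_pow_eq_zero]
      · rcases Nat.eq_zero_or_pos k with rfl | hk0
        · rw [ySeries, mul_zero, h0]; simp
        · rw [coeff_ySeries_eq_zero h (by omega)]
      · intro r hr hrk
        have := Finset.mem_Icc.mp hr
        omega
  · rw [coeff_odd_ySeries_odd h, sPoly_odd, coeff_sum_C_mul_X_pow_eq_zero]
    intro r _; omega

theorem coeff_one_cubic {v : ℂ⟦X⟧} (h0 : constantCoeff v = 1) (hv : v - v ^ 3 = X) :
    coeff 1 v = -1 / 2 := by
  have h := congrArg constantCoeff (derivative_cubic hv)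
  have h3 : constantCoeff (3 : ℂ⟦X⟧) = 3 := map_ofNat _ 3
  rw [map_mul, map_sub, map_mul, map_pow, h0, h3, map_one,
    ← coeff_zero_eq_constantCoeff_apply, coeff_derivative] at h
  norm_num at h
  linear_combination (-1 / 2) * h

theorem exists_recursion {v : ℂ⟦X⟧} (h0 : constantCoeff v = 1) (hv : v - v ^ 3 = X) :
    ∃ b d : ℕ → ℕ → ℂ, SatisfiesRecursion b d ∧ ∀ p, sPoly b d p = yPoly (X * avg v) p := by
  have hc0 : coeff 0 (X * avg v) = 0 := by simp
  have hc1 : coeff 1 (X * avg v) = 1 := by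
    rw [show (1 : ℕ) = 0 + 1 from rfl, coeff_succ_X_mul, avg, coeff_mk,
      coeff_zero_eq_constantCoeff_apply, h0]
    simp
  have hc2 : coeff 2 (X * avg v) = -1 / 4 := by
    have := coeff_succ_X_mul 1 (avg v)
    rw [avg, coeff_mk, coeff_one_cubic h0 hv] at this
    rw [avg, this]
    norm_num
  obtain ⟨b, hb⟩ := exists_bPart (X * avg v)
  obtain ⟨d, hd1, hd⟩ := exists_dPart (X * avg v) hc1
  have hs := sPoly_eq_yPoly hc0 hb hd
  refine ⟨b, d, (satisfiesRecursion_iff b d).mpr ⟨?_, hd1, ?_⟩, hs⟩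
  -- The prescribed -8 must agree with the solution: the coefficient of y^2 s is -1/4 times 2, and
  -- `bPart` there is b 1 1 / 16.
  · have e := hb 1 0 le_rfl
    have e2 : coeff 1 (sinS 2 ^ (2 * 1 - 1) * cosS 2) = 2 := by
      have h1 := sinS_mul_cosS 2 2
      rw [sub_self, sinS_zero, add_zero] at h1
      have h2 := congrArg (coeff 1) h1
      have h3 : (2 : ℂ⟦X⟧) = C 2 := (map_ofNat C 2).symm
      have h4 := coeff_sinS_odd (2 + 2) 0
      rw [mul_zero, zero_add] at h4
      rw [h3, coeff_C_mul, h4] at h2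
      norm_num at h2 ⊢
      linear_combination (1 / 2) * h2
    rw [ySeries, mul_zero, zero_add, coeff_C_mul, e2, mul_one, hc2, bPart] at e
    norm_num at e
    linear_combination 16 * e
  · intro p
    rw [show sPoly b d = yPoly (X * avg v) from funext hs]
    exact pdeCoeff_yPoly h0 hv rfl p

/-- Uniqueness turns an arbitrary solution of the recursion into the explicit one. -/
theorem sPoly_eq_of_recursion {v : ℂ⟦X⟧} (h0 : constantCoeff v = 1) (hv : v - v ^ 3 = X)
    {b d : ℕ → ℕ → ℂ} (h : SatisfiesRecursion b d) (p : ℕ) :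
    sPoly b d p = yPoly (X * avg v) p := by
  obtain ⟨b', d', h', hs⟩ := exists_recursion h0 hv
  rw [sPoly_eq_of_satisfiesRecursion h h', hs]

theorem aCoeff_eq_moment (b d : ℕ → ℕ → ℂ) (p q : ℕ) :
    aCoeff b d p q = moment q (sPoly b d p) := by
  have hq : (q ! : ℂ) ≠ 0 := by exact_mod_cast q.factorial_ne_zero
  have h2 : (2 : ℂ) ≠ 0 := two_ne_zero
  rcases Nat.even_or_odd' p with ⟨l, rfl | rfl⟩
  · have hl : ((2 * l)! : ℂ) ≠ 0 := by exact_mod_cast (2 * l).factorial_ne_zero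
    rw [aCoeff, if_neg (by simp), sPoly_even, map_sum]
    simp only [moment_C_mul_X_pow]
    rw [sum_Icc_one_succ, dPart_one, show 2 * l / 2 = l by omega, mul_add, add_div,
      add_comm]
    congr 1
    · rw [zpow_sub₀ h2, zpow_sub₀ h2]
      push_cast
      simp only [zpow_natCast, zpow_mul, zpow_ofNat, pow_mul]
      norm_num
      field_simp
      rw [← mul_pow]; norm_num
    · rw [Finset.mul_sum, Finset.sum_div]
      refine Finset.sum_congr rfl fun r hr => ?_
      have hr2 := (Finset.mem_Icc.mp hr).1
      rw [dPart_of_ne_one d (ne_one_of_mem_Icc_two hr), cast_two_mul_sub_one (by omega)]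
      have e : ∀ i : ℕ, (-1 : ℂ) ^ (i + 1) * (4 * (i : ℂ) - 2) ^ (-2 * (r : ℤ) + ((2 * l : ℕ) : ℤ)
          + 4)
          * d i r = -(2 : ℂ) ^ (2 * (l : ℤ) - 2 * r + 4) * ((-1) ^ i
            * (2 * (i : ℂ) - 1) ^ (2 * (l : ℤ) - 2 * r + 4) * d i r) := by
        intro i
        rw [show 4 * (i : ℂ) - 2 = 2 * (2 * i - 1) by ring, mul_zpow,
          show -2 * (r : ℤ) + ((2 * l : ℕ) : ℤ) + 4 = 2 * (l : ℤ) - 2 * r + 4 by push_cast; ring]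
        ring
      simp only [e, ← Finset.mul_sum]
      rw [← dSum_def]
      generalize dSum d r l = w
      simp only [zpow_add₀ h2, zpow_sub₀ h2, zpow_natCast, zpow_mul, zpow_ofNat, div_pow]
      field_simp
      ring
  · have hl : ((2 * l + 1)! : ℂ) ≠ 0 := by exact_mod_cast (2 * l + 1).factorial_ne_zero
    rw [aCoeff, if_pos ⟨l, rfl⟩, sPoly_odd, map_sum]
    simp only [moment_C_mul_X_pow]
    rw [show (2 * l + 1 - 1) / 2 = l by omega, show (2 * l + 1 + 1) / 2 = l + 1 by omega,
      Finset.mul_sum, Finset.sum_div]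
    refine Finset.sum_congr rfl fun t _ => ?_
    rw [bPart_eq, bSum]
    rw [show -2 * (t : ℤ) + ((2 * l + 1 : ℕ) : ℤ) + 3 = 2 * (l : ℤ) - 2 * t + 4 by push_cast; ring,
      show 2 * ((2 * l + 1 : ℕ) : ℤ) - 6 = 4 * (l : ℤ) - 4 by push_cast; ring,
      show ((2 * t : ℕ) : ℂ) / 2 = t by push_cast; ring]
    ring

end

/-! ### Convergence near the origin, and summation to a closed form. -/

section


open PowerSeries

theorem absConv_expS (a : ℂ) {r : ℝ} : AbsConv (expS a) r := by
  refine (Real.summable_pow_div_factorial (‖a‖ * r)).congr fun n => ?_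
  rw [coeff_expS, norm_div, norm_pow, mul_pow, Complex.norm_natCast]
  ring

theorem psum_expS (a z : ℂ) : psum (expS a) z = Complex.exp (a * z) := by
  rw [psum, Complex.exp_eq_exp_ℂ, NormedSpace.exp_eq_tsum_div]
  refine tsum_congr fun n => ?_
  rw [coeff_expS, mul_pow]
  ring

theorem absConv_sinS (a : ℂ) {r : ℝ} (hr : 0 ≤ r) : AbsConv (sinS a) r :=
  (absConv_C _ r).mul hr ((absConv_expS _).sub hr (absConv_expS _))

theorem absConv_cosS (a : ℂ) {r : ℝ} (hr : 0 ≤ r) : AbsConv (cosS a) r :=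
  (absConv_C _ r).mul hr ((absConv_expS _).add hr (absConv_expS _))

theorem psum_sinS (a z : ℂ) : psum (sinS a) z = Complex.sin (a * z) := by
  have h0 : 0 ≤ ‖z‖ := norm_nonneg z
  have hI := Complex.I_ne_zero
  rw [sinS, psum_mul (absConv_C _ _) ((absConv_expS _).sub h0 (absConv_expS _)) le_rfl,
    psum_sub (absConv_expS _) (absConv_expS _) le_rfl, psum_C, psum_expS, psum_expS, Complex.sin,
    show a * Complex.I * z = a * z * Complex.I by ring,
    show -(a * Complex.I) * z = -(a * z) * Complex.I by ring]
  have hI2 := Complex.I_sq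
  field_simp
  rw [hI2]; ring

theorem psum_cosS (a z : ℂ) : psum (cosS a) z = Complex.cos (a * z) := by
  have h0 : 0 ≤ ‖z‖ := norm_nonneg z
  rw [cosS, psum_mul (absConv_C _ _) ((absConv_expS _).add h0 (absConv_expS _)) le_rfl,
    psum_add (absConv_expS _) (absConv_expS _) le_rfl, psum_C, psum_expS, psum_expS, Complex.cos,
    show a * Complex.I * z = a * z * Complex.I by ring,
    show -(a * Complex.I) * z = -(a * z) * Complex.I by ring]
  ring

/-- Used for the sine: its weighted norm tends to 0 with the radius, so y sin 2s stays in the disc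
of convergence of v. -/
theorem wnorm_le_mul {f : ℂ⟦X⟧} (h0 : coeff 0 f = 0) (hf : AbsConv f 1) {σ : ℝ} (hσ : 0 ≤ σ)
    (hσ1 : σ ≤ 1) : wnorm f σ ≤ σ * wnorm f 1 := by
  rw [wnorm, wnorm, ← tsum_mul_left]
  refine Summable.tsum_le_tsum (fun n => ?_) (hf.mono hσ hσ1) (Summable.mul_left σ hf)
  cases n with
  | zero => simp [h0]
  | succ n =>
    rw [one_pow, mul_one, mul_comm]
    refine mul_le_mul_of_nonneg_right ?_ (norm_nonneg _)
    exact pow_le_of_le_one hσ hσ1 (Nat.succ_ne_zero n)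

theorem absConv_avg {v : ℂ⟦X⟧} {r : ℝ} (hr : 0 ≤ r) (hv : AbsConv v r) : AbsConv (avg v) r := by
  refine Summable.of_nonneg_of_le (fun _ => by positivity) (fun n => ?_) hv
  rw [avg, coeff_mk, norm_div]
  refine mul_le_mul_of_nonneg_right (div_le_self (norm_nonneg _) ?_) (by positivity)
  have : (n : ℂ) + 1 = ((n + 1 : ℕ) : ℂ) := by push_cast; rfl
  rw [this, Complex.norm_natCast]
  exact_mod_cast Nat.succ_le_succ (Nat.zero_le n)

/-- The terms of `∑ g_m y ^ (m + 1) sin (2 s) ^ m cos (2 s)`, expanded in `s` and `x`,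
`y = e ^ (x / 2)`. -/
def tripleTerm (g : ℂ⟦X⟧) (s x : ℂ) (z : ℕ × (ℕ × ℕ)) : ℂ :=
  coeff z.1 g * ((coeff z.2.1 (sinS 2 ^ z.1 * cosS 2) * s ^ z.2.1)
    * ((((z.1 : ℂ) + 1) / 2 * x) ^ z.2.2 / (z.2.2 ! : ℂ)))

theorem summable_exp_term (w : ℂ) : Summable fun q : ℕ => ‖w ^ q / (q ! : ℂ)‖ := by
  refine (Real.summable_pow_div_factorial ‖w‖).congr fun n => ?_
  rw [norm_div, norm_pow, Complex.norm_natCast]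

theorem absConv_sin_pow_mul_cos (m : ℕ) {σ : ℝ} (hσ : 0 ≤ σ) :
    AbsConv (sinS 2 ^ m * cosS 2) σ :=
  ((absConv_sinS 2 hσ).pow hσ m).mul hσ (absConv_cosS 2 hσ)

theorem tsum_norm_exp_term (w : ℂ) : ∑' q : ℕ, ‖w ^ q / (q ! : ℂ)‖ = Real.exp ‖w‖ := by
  rw [Real.exp_eq_exp_ℝ, NormedSpace.exp_eq_tsum_div]
  refine tsum_congr fun q => ?_
  rw [norm_div, norm_pow, Complex.norm_natCast]

/-- Summing over the two expansion indices first bounds the m-th block by a constant times |g_m|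
(‖sin‖ e^(ρ/2))^m, where ‖sin‖ is the weighted norm; `hg` then gives summability in m. -/
theorem summable_tripleTerm {g : ℂ⟦X⟧} {r σ ρ : ℝ} (hg : AbsConv g r) (hσ : 0 ≤ σ)
    (h : wnorm (sinS 2) σ * Real.exp (ρ / 2) ≤ r) {s x : ℂ} (hs : ‖s‖ ≤ σ) (hx : ‖x‖ ≤ ρ) :
    Summable fun z => ‖tripleTerm g s x z‖ := by
  have hA := fun m => (absConv_sin_pow_mul_cos m hσ).summable_norm hs
  have hE := fun m : ℕ => summable_exp_term (((m : ℂ) + 1) / 2 * x)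
  have hin : ∀ m : ℕ, Summable fun pq : ℕ × ℕ => ‖tripleTerm g s x (m, pq)‖ := by
    intro m
    have := ((hA m).mul_of_nonneg (hE m) (fun _ => norm_nonneg _) (fun _ => norm_nonneg _)).mul_left
      ‖coeff m g‖
    exact this.congr fun pq => by simp only [tripleTerm, norm_mul]
  refine (summable_prod_of_nonneg (fun _ => norm_nonneg _)).mpr ⟨hin, ?_⟩
  have hW := wnorm_nonneg (sinS 2) hσ
  have hK := wnorm_nonneg (cosS 2) hσ
  refine Summable.of_nonneg_of_le (fun m => tsum_nonneg fun _ => norm_nonneg _) (fun m => ?_)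
    (Summable.mul_left (wnorm (cosS 2) σ * Real.exp (ρ / 2)) hg)
  have e1 : ∑' pq : ℕ × ℕ, ‖tripleTerm g s x (m, pq)‖
      = ‖coeff m g‖ * ((∑' p, ‖coeff p (sinS 2 ^ m * cosS 2) * s ^ p‖)
        * ∑' q : ℕ, ‖(((m : ℂ) + 1) / 2 * x) ^ q / (q ! : ℂ)‖) := by
    rw [(hA m).tsum_mul_tsum (hE m)
      ((hA m).mul_of_nonneg (hE m) (fun _ => norm_nonneg _) (fun _ => norm_nonneg _)),
      ← tsum_mul_left]
    exact tsum_congr fun pq => by simp only [tripleTerm, norm_mul]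
  have e2 : ∑' p, ‖coeff p (sinS 2 ^ m * cosS 2) * s ^ p‖
      ≤ wnorm (sinS 2) σ ^ m * wnorm (cosS 2) σ := by
    refine (Summable.tsum_le_tsum (fun p => ?_) (hA m) (absConv_sin_pow_mul_cos m hσ)).trans
      ((wnorm_mul_le hσ ((absConv_sinS 2 hσ).pow hσ m) (absConv_cosS 2 hσ)).trans
        (mul_le_mul_of_nonneg_right (wnorm_pow_le hσ (absConv_sinS 2 hσ) m) hK))
    rw [norm_mul, norm_pow]
    gcongr
  have e3 : Real.exp ‖((m : ℂ) + 1) / 2 * x‖ ≤ Real.exp (ρ / 2) ^ m * Real.exp (ρ / 2) := by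
    rw [← Real.exp_nat_mul, ← Real.exp_add, Real.exp_le_exp]
    have e4 : ((m : ℂ) + 1) / 2 = (((m : ℝ) + 1) / 2 : ℝ) := by push_cast; rfl
    rw [norm_mul, e4, Complex.norm_real, Real.norm_of_nonneg (by positivity)]
    nlinarith [(Nat.cast_nonneg m : (0 : ℝ) ≤ m)]
  rw [e1, tsum_norm_exp_term]
  calc _ ≤ ‖coeff m g‖ * ((wnorm (sinS 2) σ ^ m * wnorm (cosS 2) σ)
        * (Real.exp (ρ / 2) ^ m * Real.exp (ρ / 2))) := by gcongr
    _ = wnorm (cosS 2) σ * Real.exp (ρ / 2)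
        * (‖coeff m g‖ * (wnorm (sinS 2) σ * Real.exp (ρ / 2)) ^ m) := by rw [mul_pow]; ring
    _ ≤ _ := by gcongr

/-- The sum over m is finite because s^m divides sin(2s)^m. The factor X in X * g matches y^(m+1)
with g_m, and the y^0 term vanishes. -/
theorem moment_yPoly (g : ℂ⟦X⟧) (p q : ℕ) (s x : ℂ) :
    moment q (yPoly (X * g) p) * s ^ p * x ^ q = ∑' m, tripleTerm g s x (m, (p, q)) := by
  have h0 : ∀ m ∉ Finset.range (p + 1), tripleTerm g s x (m, (p, q)) = 0 := by
    intro m hm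
    have h1 : coeff p (sinS 2 ^ m * cosS 2) = 0 :=
      X_pow_dvd_iff.mp ((pow_dvd_pow_of_dvd (X_dvd_sinS 2) m).mul_right _) p
        (by simpa [Nat.lt_succ_iff] using hm)
    simp [tripleTerm, h1]
  rw [tsum_eq_sum h0, yPoly, Finset.sum_range_succ', map_add, map_sum, moment_C_mul_X_pow,
    show coeff p (ySeries (X * g) 0) = 0 by simp [ySeries], zero_mul, add_zero, Finset.sum_mul,
    Finset.sum_mul]
  refine Finset.sum_congr rfl fun m _ => ?_
  rw [moment_C_mul_X_pow, ySeries, coeff_C_mul, coeff_succ_X_mul, tripleTerm, Nat.add_sub_cancel,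
    mul_pow]
  push_cast
  ring

theorem hasSum_moment_yPoly {g : ℂ⟦X⟧} {r σ ρ : ℝ} (hg : AbsConv g r) (hσ : 0 ≤ σ)
    (h : wnorm (sinS 2) σ * Real.exp (ρ / 2) ≤ r) {s x : ℂ} (hs : ‖s‖ ≤ σ) (hx : ‖x‖ ≤ ρ) :
    (Summable fun pq : ℕ × ℕ => ‖moment pq.2 (yPoly (X * g) pq.1) * s ^ pq.1 * x ^ pq.2‖) ∧
    ∑' pq : ℕ × ℕ, moment pq.2 (yPoly (X * g) pq.1) * s ^ pq.1 * x ^ pq.2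
      = Complex.exp (x / 2) * Complex.cos (2 * s)
        * psum g (Complex.exp (x / 2) * Complex.sin (2 * s)) := by
  have hT := summable_tripleTerm hg hσ h hs hx
  have hT' : Summable fun z : (ℕ × ℕ) × ℕ => ‖tripleTerm g s x (z.2, z.1)‖ :=
    (Equiv.prodComm (ℕ × ℕ) ℕ).summable_iff.mpr hT
  refine ⟨?_, ?_⟩
  · refine Summable.of_nonneg_of_le (fun _ => norm_nonneg _) (fun pq => ?_) hT'.prod
    rw [moment_yPoly]
    exact norm_tsum_le_tsum_norm (hT'.prod_factor pq)
  · have e1 : ∑' pq : ℕ × ℕ, moment pq.2 (yPoly (X * g) pq.1) * s ^ pq.1 * x ^ pq.2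
        = ∑' pq : ℕ × ℕ, ∑' m, tripleTerm g s x (m, pq) :=
      tsum_congr fun pq => moment_yPoly g pq.1 pq.2 s x
    rw [e1, ← Summable.tsum_comm (f := fun pq m => tripleTerm g s x (m, pq)) hT'.of_norm, psum,
      ← tsum_mul_left]
    refine tsum_congr fun m => ?_
    have hA := (absConv_sin_pow_mul_cos m hσ).summable_norm hs
    have hE := summable_exp_term (((m : ℂ) + 1) / 2 * x)
    have e2 : ∑' pq : ℕ × ℕ, tripleTerm g s x (m, pq)
        = coeff m g * ((∑' p, coeff p (sinS 2 ^ m * cosS 2) * s ^ p)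
          * ∑' q : ℕ, (((m : ℂ) + 1) / 2 * x) ^ q / (q ! : ℂ)) := by
      rw [tsum_mul_tsum_of_summable_norm hA hE, ← tsum_mul_left]
      rfl
    have e3 : ∑' q : ℕ, (((m : ℂ) + 1) / 2 * x) ^ q / (q ! : ℂ)
        = Complex.exp (x / 2) ^ m * Complex.exp (x / 2) := by
      rw [← Complex.exp_nat_mul, ← Complex.exp_add, Complex.exp_eq_exp_ℂ,
        NormedSpace.exp_eq_tsum_div]
      refine tsum_congr fun q => ?_
      congr 2
      ring
    have e4 : ∑' p, coeff p (sinS 2 ^ m * cosS 2) * s ^ p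
        = Complex.sin (2 * s) ^ m * Complex.cos (2 * s) := by
      have := psum_mul ((absConv_sinS 2 hσ).pow hσ m) (absConv_cosS 2 hσ) hs
      rw [psum_pow hσ (absConv_sinS 2 hσ) hs, psum_sinS, psum_cosS] at this
      exact this
    rw [e2, e3, e4, mul_pow]
    ring

end

/-! ### Analyticity of absolutely convergent double power series. -/

section


/-- The sum of a double power series. -/
def doubleSum (a : ℕ → ℕ → ℂ) (z : ℂ × ℂ) : ℂ :=
  ∑' pq : ℕ × ℕ, a pq.1 pq.2 * z.1 ^ pq.1 * z.2 ^ pq.2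

/-- The monomial `z.1 ^ i * z.2 ^ (n - i)` as a multilinear map. -/
def monomialMap (n i : ℕ) : ContinuousMultilinearMap ℂ (fun _ : Fin n => ℂ × ℂ) ℂ :=
  (ContinuousMultilinearMap.mkPiAlgebraFin ℂ n ℂ).compContinuousLinearMap fun k =>
    if (k : ℕ) < i then ContinuousLinearMap.fst ℂ ℂ ℂ else ContinuousLinearMap.snd ℂ ℂ ℂ

theorem norm_monomialMap_le (n i : ℕ) : ‖monomialMap n i‖ ≤ 1 := by
  refine (ContinuousMultilinearMap.norm_compContinuousLinearMap_le _ _).trans ?_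
  rw [ContinuousMultilinearMap.norm_mkPiAlgebraFin, one_mul]
  refine Finset.prod_le_one (fun _ _ => norm_nonneg _) fun k _ => ?_
  split_ifs
  · exact ContinuousLinearMap.norm_fst_le ℂ ℂ ℂ
  · exact ContinuousLinearMap.norm_snd_le ℂ ℂ ℂ

theorem monomialMap_apply {n i j : ℕ} (h : i + j = n) (z : ℂ × ℂ) :
    monomialMap n i (fun _ => z) = z.1 ^ i * z.2 ^ j := by
  subst h
  rw [monomialMap, ContinuousMultilinearMap.compContinuousLinearMap_apply,
    ContinuousMultilinearMap.mkPiAlgebraFin_apply, List.prod_ofFn, Fin.prod_univ_add]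
  simp

/-- The formal multilinear series with coefficients `a i j`. -/
def doubleSeries (a : ℕ → ℕ → ℂ) : FormalMultilinearSeries ℂ (ℂ × ℂ) ℂ := fun n =>
  ∑ ij ∈ Finset.HasAntidiagonal.antidiagonal n, a ij.1 ij.2 • monomialMap n ij.1

theorem hasSum_antidiagonal {E : Type*} [NormedAddCommGroup E] {f : ℕ × ℕ → E} {S : E}
    (h : HasSum f S) :
    HasSum (fun n => ∑ ij ∈ Finset.HasAntidiagonal.antidiagonal n, f ij) S := by
  refine ((Finset.HasAntidiagonal.sigmaAntidiagonalEquivProd.hasSum_iff).mpr h).sigma fun n => ?_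
  have := hasSum_fintype (fun ij : Finset.HasAntidiagonal.antidiagonal n => f ij)
  rwa [Finset.sum_coe_sort _ f] at this

/-- Monomial maps have norm at most 1, so the degree-n term is bounded by an antidiagonal sum of a
summable family. The norm on the product is the maximum, so the unit ball is the unit polydisc. -/
theorem hasFPowerSeriesOnBall_doubleSum {a : ℕ → ℕ → ℂ}
    (h : Summable fun pq : ℕ × ℕ => ‖a pq.1 pq.2‖) :
    HasFPowerSeriesOnBall (doubleSum a) (doubleSeries a) 0 1 := by
  have hs : Summable fun n => ∑ ij ∈ Finset.HasAntidiagonal.antidiagonal n, ‖a ij.1 ij.2‖ :=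
    (hasSum_antidiagonal h.hasSum).summable
  refine ⟨?_, one_pos, ?_⟩
  · refine FormalMultilinearSeries.le_radius_of_summable_norm (r := 1) _ ?_
    refine Summable.of_nonneg_of_le (fun _ => by positivity) (fun n => ?_) hs
    simp only [NNReal.coe_one, one_pow, mul_one]
    refine (norm_sum_le _ _).trans (Finset.sum_le_sum fun ij _ => ?_)
    rw [norm_smul]
    exact mul_le_of_le_one_right (norm_nonneg _) (norm_monomialMap_le _ _)
  · intro z hz
    have hz1 : ‖z‖ < 1 := by
      rwa [Metric.mem_eball, edist_zero_right, ← ofReal_norm, ENNReal.ofReal_lt_one] at hz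
    have h1 : ‖z.1‖ ≤ 1 := (norm_fst_le z).trans hz1.le
    have h2 : ‖z.2‖ ≤ 1 := (norm_snd_le z).trans hz1.le
    have hsum : Summable fun pq : ℕ × ℕ => a pq.1 pq.2 * z.1 ^ pq.1 * z.2 ^ pq.2 := by
      refine Summable.of_norm (Summable.of_nonneg_of_le (fun _ => norm_nonneg _) (fun pq => ?_) h)
      rw [norm_mul, norm_mul, norm_pow, norm_pow, mul_assoc]
      exact mul_le_of_le_one_right (norm_nonneg _) (mul_le_one₀ (pow_le_one₀ (norm_nonneg _) h1)
        (by positivity) (pow_le_one₀ (norm_nonneg _) h2))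
    rw [zero_add]
    refine (hasSum_antidiagonal hsum.hasSum).congr_fun fun n => ?_
    rw [doubleSeries, sum_apply]
    refine Finset.sum_congr rfl fun ij hij => ?_
    rw [smul_apply,
      monomialMap_apply (Finset.HasAntidiagonal.mem_antidiagonal.mp hij), smul_eq_mul, mul_assoc]

theorem analyticOnNhd_doubleSum {a : ℕ → ℕ → ℂ} {σ ρ : ℝ} (hσ : 0 < σ) (hρ : 0 < ρ)
    (h : Summable fun pq : ℕ × ℕ => ‖a pq.1 pq.2‖ * σ ^ pq.1 * ρ ^ pq.2) :
    AnalyticOnNhd ℂ (doubleSum a) {z | ‖z.1‖ < σ ∧ ‖z.2‖ < ρ} := by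
  -- Rescaling the two variables reduces to radii 1.
  set a' : ℕ → ℕ → ℂ := fun p q => a p q * (σ : ℂ) ^ p * (ρ : ℂ) ^ q
  have ha : Summable fun pq : ℕ × ℕ => ‖a' pq.1 pq.2‖ := by
    refine h.congr fun pq => ?_
    simp [a', abs_of_pos hσ, abs_of_pos hρ]
  have hσ' : (σ : ℂ) ≠ 0 := by exact_mod_cast hσ.ne'
  have hρ' : (ρ : ℂ) ≠ 0 := by exact_mod_cast hρ.ne'
  have he : doubleSum a = doubleSum a' ∘ fun z => (z.1 / (σ : ℂ), z.2 / (ρ : ℂ)) := by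
    funext z
    refine tsum_congr fun pq => ?_
    simp only [a', div_pow]
    field_simp
  intro z hz
  rw [he]
  refine AnalyticAt.comp ?_
    ((analyticAt_fst.div_const).prod (analyticAt_snd.div_const))
  refine (hasFPowerSeriesOnBall_doubleSum ha).analyticAt_of_mem ?_
  rw [Metric.mem_eball, edist_zero_right, ← ofReal_norm, ENNReal.ofReal_lt_one, Prod.norm_def]
  simp [abs_of_pos hσ, abs_of_pos hρ, div_lt_one, hσ, hρ, hz.1, hz.2]

end

/-! ### The closed form of the double series near the origin. -/

section


open Topology Filter

theorem psum_zero (f : PowerSeries ℂ) : psum f 0 = PowerSeries.constantCoeff f := by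
  rw [psum, tsum_eq_single 0 fun n hn => by rw [zero_pow hn, mul_zero]]
  simp

/-- The formal identities become identities of functions near 0, where v is close to 1 and 1 - 3v^2
close to -2. The derivative follows by differentiating v - v^3 = u. -/
theorem eventually_psum_cubic {v : PowerSeries ℂ} {r : ℝ} (hr : 0 < r) (hvr : AbsConv v r)
    (h0 : PowerSeries.constantCoeff v = 1) (hv : v - v ^ 3 = PowerSeries.X) :
    ∀ᶠ u in 𝓝 (0 : ℂ), psum v u ≠ 0 ∧ 1 - 3 * psum v u ^ 2 ≠ 0 ∧ psum v u - psum v u ^ 3 = u ∧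
      4 * psum v u * psum (avg v) u = 1 + 3 * psum v u ^ 2 ∧
      HasDerivAt (psum v) (1 / (1 - 3 * psum v u ^ 2)) u := by
  have han := (hvr.hasFPowerSeriesAt hr).analyticAt
  have hc : ∀ᶠ u in 𝓝 (0 : ℂ), psum v u - psum v u ^ 3 = u := by
    filter_upwards [Metric.ball_mem_nhds (0 : ℂ) hr] with u hu
    have hu' : ‖u‖ ≤ r := (mem_ball_zero_iff.mp hu).le
    rw [← psum_pow hr.le hvr hu', ← psum_sub hvr (hvr.pow hr.le 3) hu', hv, psum_X]
  have hval : psum v 0 = 1 := by rw [psum_zero, h0]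
  have hne : ∀ᶠ u in 𝓝 (0 : ℂ), psum v u ≠ 0 :=
    han.continuousAt.eventually_ne (by rw [hval]; exact one_ne_zero)
  have hne' : ∀ᶠ u in 𝓝 (0 : ℂ), 1 - 3 * psum v u ^ 2 ≠ 0 :=
    (continuousAt_const.sub (continuousAt_const.mul (han.continuousAt.pow 2))).eventually_ne
      (by simp only [Pi.sub_apply, Pi.mul_apply, Pi.pow_apply, hval]; norm_num)
  filter_upwards [hne, hne', hc, hc.eventually_nhds, han.eventually_analyticAt,
    Metric.ball_mem_nhds (0 : ℂ) hr] with u h1 h2 h3 h4 h5 hu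
  have hu' : ‖u‖ ≤ r := (mem_ball_zero_iff.mp hu).le
  refine ⟨h1, h2, h3, ?_, ?_⟩
  · have hg := absConv_avg hr.le hvr
    have h := congrArg (fun f => psum f u) (four_mul_mul_avg h0 hv)
    have e4 : (4 : PowerSeries ℂ) = PowerSeries.C 4 := (map_ofNat PowerSeries.C 4).symm
    have e3 : (3 : PowerSeries ℂ) = PowerSeries.C 3 := (map_ofNat PowerSeries.C 3).symm
    simp only [e4, e3] at h
    rw [psum_mul ((absConv_C 4 r).mul hr.le hvr) hg hu', psum_mul (absConv_C 4 r) hvr hu',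
      psum_add (absConv_one r) ((absConv_C 3 r).mul hr.le (hvr.pow hr.le 2)) hu',
      psum_mul (absConv_C 3 r) (hvr.pow hr.le 2) hu', psum_pow hr.le hvr hu', psum_one, psum_C,
      psum_C] at h
    exact h
  · have hd := h5.differentiableAt.hasDerivAt
    have h6 := (hd.fun_sub (hd.fun_pow 3)).unique
      ((hasDerivAt_id' u).congr_of_eventuallyEq h4)
    refine hd.congr_deriv ?_
    rw [eq_div_iff h2]
    simp only [Nat.cast_ofNat] at h6
    linear_combination h6

theorem exists_convergesAt_and_eventually_eq {b d : ℕ → ℕ → ℂ} (h : SatisfiesRecursion b d) :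
    (∃ r : ℝ, 0 < r ∧ ConvergesAt b d r r) ∧
    ∃ W : ℂ × ℂ → ℂ, ∀ᶠ z in 𝓝 (0 : ℂ × ℂ), W z ≠ 0 ∧ 1 - 3 * W z ^ 2 ≠ 0 ∧
      W z - W z ^ 3 = Complex.exp (z.2 / 2) * Complex.sin (2 * z.1) ∧
      doubleSum (aCoeff b d) z = Complex.exp (z.2 / 2) * Complex.cos (2 * z.1)
        * (1 + 3 * W z ^ 2) / (4 * W z) ∧
      HasDerivAt (fun w => W (w, z.2))
        (2 * Complex.exp (z.2 / 2) * Complex.cos (2 * z.1) / (1 - 3 * W z ^ 2)) z.1 ∧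
      HasDerivAt (fun w => W (z.1, w)) (1 / 2 * (W z - W z ^ 3) / (1 - 3 * W z ^ 2)) z.2 := by
  obtain ⟨v, r, hr, hvr, h0, hv⟩ := exists_cubic_series
  have hcoeff : ∀ p q, aCoeff b d p q = moment q (yPoly (PowerSeries.X * avg v) p) := fun p q => by
    rw [aCoeff_eq_moment, sPoly_eq_of_recursion h0 hv h p]
  have hg := absConv_avg hr.le hvr
  set K := wnorm (sinS 2) 1
  have hK : 0 ≤ K := wnorm_nonneg _ zero_le_one
  -- The bound δ ≤ 1 allows `wnorm_le_mul` and e^(δ/2) ≤ e^(1/2); K + 1 replaces K to keep the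
  -- denominator positive.
  set δ := min 1 (r / ((K + 1) * Real.exp (1 / 2)))
  have hδ : 0 < δ := lt_min one_pos (by positivity)
  have hδ1 : δ ≤ 1 := min_le_left _ _
  have hδr : wnorm (sinS 2) δ * Real.exp (δ / 2) ≤ r := by
    have h1 : wnorm (sinS 2) δ ≤ δ * (K + 1) :=
      (wnorm_le_mul (coeff_sinS_even 2 0) (absConv_sinS 2 zero_le_one) hδ.le hδ1).trans
        (mul_le_mul_of_nonneg_left (by linarith) hδ.le)
    have h2 : δ * ((K + 1) * Real.exp (1 / 2)) ≤ r :=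
      (le_div_iff₀ (by positivity)).mp (min_le_right _ _)
    calc _ ≤ δ * (K + 1) * Real.exp (1 / 2) := by gcongr
      _ ≤ r := by linarith
  refine ⟨⟨δ, hδ, ?_⟩, fun z => psum v (Complex.exp (z.2 / 2) * Complex.sin (2 * z.1)), ?_⟩
  · have hn : ‖(δ : ℂ)‖ ≤ δ := by simp [abs_of_pos hδ]
    refine (hasSum_moment_yPoly hg hδ.le hδr hn hn).1.congr fun pq => ?_
    rw [hcoeff]
    simp [abs_of_pos hδ]
  · have hcont : Tendsto (fun z : ℂ × ℂ => Complex.exp (z.2 / 2) * Complex.sin (2 * z.1)) (𝓝 0)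
        (𝓝 0) := by
      have : Continuous fun z : ℂ × ℂ => Complex.exp (z.2 / 2) * Complex.sin (2 * z.1) := by
        fun_prop
      simpa using this.tendsto 0
    filter_upwards [hcont.eventually (eventually_psum_cubic hr hvr h0 hv),
      Metric.ball_mem_nhds (0 : ℂ × ℂ) hδ] with z ⟨h1, h2, h3, h4, h5⟩ hz
    have hz' : ‖z‖ < δ := mem_ball_zero_iff.mp hz
    refine ⟨h1, h2, h3, ?_, ?_, ?_⟩
    · have := (hasSum_moment_yPoly hg hδ.le hδr ((norm_fst_le z).trans hz'.le)
        ((norm_snd_le z).trans hz'.le)).2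
      simp only [doubleSum, hcoeff]
      rw [this, eq_div_iff (mul_ne_zero (by norm_num) h1), ← h4]
      ring
    · have e : HasDerivAt (fun w : ℂ => Complex.exp (z.2 / 2) * Complex.sin (2 * w))
          (Complex.exp (z.2 / 2) * (Complex.cos (2 * z.1) * (2 * 1))) z.1 :=
        (((hasDerivAt_id' z.1).const_mul 2).csin).const_mul _
      have h6 := HasDerivAt.comp z.1 (h₂ := psum v) h5 e
      exact h6.congr_deriv (by ring)
    · have e : HasDerivAt (fun w : ℂ => Complex.exp (w / 2) * Complex.sin (2 * z.1))
          (Complex.exp (z.2 / 2) * (1 / 2) * Complex.sin (2 * z.1)) z.2 :=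
        (((hasDerivAt_id' z.2).div_const 2).cexp).mul_const _
      have h6 := HasDerivAt.comp z.2 (h₂ := psum v) h5 e
      refine h6.congr_deriv ?_
      rw [h3]; ring

end

/-! ### Partial derivatives of the closed form, and the reduced equations near the origin. -/

section


open Topology Filter

/-- The partial derivative in the first variable. -/
def derivFst (f : ℂ × ℂ → ℂ) (z : ℂ × ℂ) : ℂ := deriv (fun w => f (w, z.2)) z.1

/-- The partial derivative in the second variable. -/
def derivSnd (f : ℂ × ℂ → ℂ) (z : ℂ × ℂ) : ℂ := deriv (fun w => f (z.1, w)) z.2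

theorem derivFst_eq {f : ℂ × ℂ → ℂ} {z : ℂ × ℂ} (h : DifferentiableAt ℂ f z) :
    derivFst f z = fderiv ℂ f z (1, 0) :=
  (h.hasFDerivAt.comp_hasDerivAt (x := z.1) (f := fun w => (w, z.2))
    ((hasDerivAt_id' z.1).prodMk (hasDerivAt_const z.1 z.2))).deriv

theorem derivSnd_eq {f : ℂ × ℂ → ℂ} {z : ℂ × ℂ} (h : DifferentiableAt ℂ f z) :
    derivSnd f z = fderiv ℂ f z (0, 1) :=
  (h.hasFDerivAt.comp_hasDerivAt (x := z.2) (f := fun w => (z.1, w))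
    ((hasDerivAt_const z.2 z.1).prodMk (hasDerivAt_id' z.2))).deriv

theorem hasDerivAt_comp_prodMk {f : ℂ × ℂ → ℂ} {u w : ℂ → ℂ} {u' w' x : ℂ}
    (h : DifferentiableAt ℂ f (u x, w x)) (hu : HasDerivAt u u' x) (hw : HasDerivAt w w' x) :
    HasDerivAt (fun x => f (u x, w x))
      (u' * derivFst f (u x, w x) + w' * derivSnd f (u x, w x)) x := by
  refine (h.hasFDerivAt.comp_hasDerivAt (f := fun x => (u x, w x)) x
    (hu.prodMk hw)).congr_deriv ?_
  rw [derivFst_eq h, derivSnd_eq h, ← smul_eq_mul, ← smul_eq_mul, ← map_smul, ← map_smul,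
    ← map_add]
  simp

theorem analyticOnNhd_derivFst {f : ℂ × ℂ → ℂ} {D : Set (ℂ × ℂ)} (h : AnalyticOnNhd ℂ f D)
    (hD : IsOpen D) : AnalyticOnNhd ℂ (derivFst f) D :=
  AnalyticOnNhd.congr hD
    (((ContinuousLinearMap.apply ℂ ℂ ((1, 0) : ℂ × ℂ)).analyticOnNhd Set.univ).comp h.fderiv
      (Set.mapsTo_univ _ _)) fun z hz => (derivFst_eq (h z hz).differentiableAt).symm

theorem analyticOnNhd_derivSnd {f : ℂ × ℂ → ℂ} {D : Set (ℂ × ℂ)} (h : AnalyticOnNhd ℂ f D)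
    (hD : IsOpen D) : AnalyticOnNhd ℂ (derivSnd f) D :=
  AnalyticOnNhd.congr hD
    (((ContinuousLinearMap.apply ℂ ℂ ((0, 1) : ℂ × ℂ)).analyticOnNhd Set.univ).comp h.fderiv
      (Set.mapsTo_univ _ _)) fun z hz => (derivSnd_eq (h z hz).differentiableAt).symm

theorem derivFst_eventuallyEq {f F F' : ℂ × ℂ → ℂ} {a : ℂ × ℂ} (h : f =ᶠ[𝓝 a] F)
    (h' : ∀ᶠ z in 𝓝 a, HasDerivAt (fun w => F (w, z.2)) (F' z) z.1) :
    derivFst f =ᶠ[𝓝 a] F' := by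
  filter_upwards [h.eventually_nhds, h'] with z h1 h2
  have hc : Tendsto (fun w => (w, z.2)) (𝓝 z.1) (𝓝 z) :=
    Continuous.tendsto (by fun_prop) z.1
  exact (h2.congr_of_eventuallyEq (hc.eventually h1)).deriv

theorem derivSnd_eventuallyEq {f F F' : ℂ × ℂ → ℂ} {a : ℂ × ℂ} (h : f =ᶠ[𝓝 a] F)
    (h' : ∀ᶠ z in 𝓝 a, HasDerivAt (fun w => F (z.1, w)) (F' z) z.2) :
    derivSnd f =ᶠ[𝓝 a] F' := by
  filter_upwards [h.eventually_nhds, h'] with z h1 h2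
  have hc : Tendsto (fun w => (z.1, w)) (𝓝 z.2) (𝓝 z) :=
    Continuous.tendsto (by fun_prop) z.2
  exact (h2.congr_of_eventuallyEq (hc.eventually h1)).deriv

/-- The differential equations for `Ψ(s, x)` that are equivalent to the open WDVV equations for
`s t^1 + (t^2)^2 Ψ(s, t^3 - 3 log t^2)`. -/
structure ReducedEquations (Ψ : ℂ × ℂ → ℂ) (z : ℂ × ℂ) : Prop where
  symm : derivSnd (derivFst Ψ) z = derivFst (derivSnd Ψ) z
  eq₁ : derivFst (derivSnd Ψ) z - (2 * derivFst Ψ z - 3 * derivFst (derivSnd Ψ) z)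
    + (2 * Ψ z - 9 * derivSnd Ψ z + 9 * derivSnd (derivSnd Ψ) z) * derivFst (derivFst Ψ) z
    = (2 * derivFst Ψ z - 3 * derivFst (derivSnd Ψ) z) ^ 2
  eq₂ : Complex.exp z.2
    + (2 * derivSnd Ψ z - 3 * derivSnd (derivSnd Ψ) z) * derivFst (derivFst Ψ) z
    = (2 * derivFst Ψ z - 3 * derivFst (derivSnd Ψ) z) * derivFst (derivSnd Ψ) z
  eq₃ : Complex.exp z.2 * (2 * derivFst Ψ z - 3 * derivFst (derivSnd Ψ) z) + Complex.exp z.2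
    + derivSnd (derivSnd Ψ) z * derivFst (derivFst Ψ) z = derivFst (derivSnd Ψ) z ^ 2
  eq₄ : derivSnd (derivSnd Ψ) z - (2 * derivSnd Ψ z - 3 * derivSnd (derivSnd Ψ) z)
    + (2 * Ψ z - 9 * derivSnd Ψ z + 9 * derivSnd (derivSnd Ψ) z) * derivFst (derivSnd Ψ) z
    = (2 * derivSnd Ψ z - 3 * derivSnd (derivSnd Ψ) z)
      * (2 * derivFst Ψ z - 3 * derivFst (derivSnd Ψ) z)
  eq₅ : (2 * derivSnd Ψ z - 3 * derivSnd (derivSnd Ψ) z) * derivFst (derivSnd Ψ) z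
    = Complex.exp z.2 * (2 * Ψ z - 9 * derivSnd Ψ z + 9 * derivSnd (derivSnd Ψ) z)
      + derivSnd (derivSnd Ψ) z * (2 * derivFst Ψ z - 3 * derivFst (derivSnd Ψ) z)

/-- All derivatives up to order two are rational in W, y = e^(x/2) and c = cos 2s. Modulo y^2 c^2 =
y^2 - (W - W^3)^2 each equation is an identity of rational functions. -/
theorem eventually_reducedEquations {Ψ W : ℂ × ℂ → ℂ}
    (hW : ∀ᶠ z in 𝓝 (0 : ℂ × ℂ), W z ≠ 0 ∧ 1 - 3 * W z ^ 2 ≠ 0 ∧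
      W z - W z ^ 3 = Complex.exp (z.2 / 2) * Complex.sin (2 * z.1) ∧
      Ψ z = Complex.exp (z.2 / 2) * Complex.cos (2 * z.1) * (1 + 3 * W z ^ 2) / (4 * W z) ∧
      HasDerivAt (fun w => W (w, z.2))
        (2 * Complex.exp (z.2 / 2) * Complex.cos (2 * z.1) / (1 - 3 * W z ^ 2)) z.1 ∧
      HasDerivAt (fun w => W (z.1, w)) (1 / 2 * (W z - W z ^ 3) / (1 - 3 * W z ^ 2)) z.2) :
    ∀ᶠ z in 𝓝 (0 : ℂ × ℂ), ReducedEquations Ψ z := by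
  have hy : ∀ x : ℂ, HasDerivAt (fun w : ℂ => Complex.exp (w / 2))
      (Complex.exp (x / 2) * (1 / 2)) x := fun x => ((hasDerivAt_id' x).div_const 2).cexp
  have hC : ∀ s : ℂ, HasDerivAt (fun w : ℂ => Complex.cos (2 * w))
      (-Complex.sin (2 * s) * (2 * 1)) s := fun s => ((hasDerivAt_id' s).const_mul 2).ccos
  have hT : ∀ z : ℂ × ℂ, W z - W z ^ 3 = Complex.exp (z.2 / 2) * Complex.sin (2 * z.1) →
      Complex.exp (z.2 / 2) ^ 2 * Complex.cos (2 * z.1) ^ 2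
        = Complex.exp (z.2 / 2) ^ 2 - (W z - W z ^ 3) ^ 2 := by
    intro z h
    rw [h, mul_pow, Complex.cos_sq']
    ring
  have e0 : Ψ =ᶠ[𝓝 0] fun z => Complex.exp (z.2 / 2) * Complex.cos (2 * z.1)
      * (1 + 3 * W z ^ 2) / (4 * W z) := hW.mono fun z h => h.2.2.2.1
  have ex : derivSnd Ψ =ᶠ[𝓝 0]
      fun z => Complex.exp (z.2 / 2) * Complex.cos (2 * z.1) * W z / 2 := by
    refine derivSnd_eventuallyEq e0 (hW.mono fun z ⟨h1, h2, h3, _, _, h6⟩ => ?_)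
    have key := ((((hy z.2).mul_const (Complex.cos (2 * z.1))).fun_mul
        (((h6.fun_pow 2).const_mul 3).const_add 1)).fun_div
      (h6.const_mul 4) (mul_ne_zero (by norm_num) h1))
    refine key.congr_deriv ?_
    simp only [Prod.mk.eta]
    generalize W z = v at *
    -- Keeping the denominator as an atom known to be nonzero lets fractions be cleared; it is
    -- expanded only for the final polynomial identity.
    generalize hQ : 1 - 3 * v ^ 2 = Q at *
    field_simp
    subst hQ
    ring
  have es : derivFst Ψ =ᶠ[𝓝 0]
      fun z => 2 * W z ^ 4 - 2 * W z ^ 2 - Complex.exp (z.2 / 2) ^ 2 / (2 * W z ^ 2) := by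
    refine derivFst_eventuallyEq e0 (hW.mono fun z ⟨h1, h2, h3, _, h5, _⟩ => ?_)
    have key := ((((hC z.1).const_mul (Complex.exp (z.2 / 2))).fun_mul
        (((h5.fun_pow 2).const_mul 3).const_add 1)).fun_div
      (h5.const_mul 4) (mul_ne_zero (by norm_num) h1))
    refine key.congr_deriv ?_
    have hT := hT z h3
    simp only [Prod.mk.eta]
    generalize W z = v at *
    generalize hQ : 1 - 3 * v ^ 2 = Q at *
    linear_combination (norm := (field_simp; subst hQ; ring)) (1 + 3 * v ^ 2) / (2 * v) * h3
      - 1 / (2 * v ^ 2) * hT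
  have exx : derivSnd (derivSnd Ψ) =ᶠ[𝓝 0] fun z => Complex.exp (z.2 / 2) * Complex.cos (2 * z.1)
      * W z * (1 - 2 * W z ^ 2) / (2 * (1 - 3 * W z ^ 2)) := by
    refine derivSnd_eventuallyEq ex (hW.mono fun z ⟨h1, h2, h3, _, _, h6⟩ => ?_)
    have key := ((((hy z.2).mul_const (Complex.cos (2 * z.1))).fun_mul h6).div_const 2)
    refine key.congr_deriv ?_
    simp only [Prod.mk.eta]
    generalize W z = v at *
    generalize hQ : 1 - 3 * v ^ 2 = Q at *
    field_simp
    subst hQ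
    ring
  have exs : derivFst (derivSnd Ψ) =ᶠ[𝓝 0] fun z => -(W z - W z ^ 3) * W z
      + (Complex.exp (z.2 / 2) ^ 2 - (W z - W z ^ 3) ^ 2) / (1 - 3 * W z ^ 2) := by
    refine derivFst_eventuallyEq ex (hW.mono fun z ⟨h1, h2, h3, _, h5, _⟩ => ?_)
    have key := ((((hC z.1).const_mul (Complex.exp (z.2 / 2))).fun_mul h5).div_const 2)
    refine key.congr_deriv ?_
    have hT := hT z h3
    simp only [Prod.mk.eta]
    generalize W z = v at *
    generalize hQ : 1 - 3 * v ^ 2 = Q at *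
    linear_combination (norm := (field_simp; subst hQ; ring)) v * h3 + 1 / Q * hT
  have esx : derivSnd (derivFst Ψ) =ᶠ[𝓝 0] fun z => -(W z - W z ^ 3) * W z
      + (Complex.exp (z.2 / 2) ^ 2 - (W z - W z ^ 3) ^ 2) / (1 - 3 * W z ^ 2) := by
    refine derivSnd_eventuallyEq es (hW.mono fun z ⟨h1, h2, h3, _, _, h6⟩ => ?_)
    have key := ((((h6.fun_pow 4).const_mul 2).fun_sub ((h6.fun_pow 2).const_mul 2)).fun_sub
      (((hy z.2).fun_pow 2).fun_div ((h6.fun_pow 2).const_mul 2)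
        (mul_ne_zero two_ne_zero (pow_ne_zero 2 h1))))
    refine key.congr_deriv ?_
    simp only [Prod.mk.eta, Nat.cast_ofNat]
    generalize W z = v at *
    generalize hQ : 1 - 3 * v ^ 2 = Q at *
    field_simp
    subst hQ
    ring
  have ess : derivFst (derivFst Ψ) =ᶠ[𝓝 0] fun z => (8 * W z ^ 3 - 4 * W z
      + Complex.exp (z.2 / 2) ^ 2 / W z ^ 3)
        * (2 * Complex.exp (z.2 / 2) * Complex.cos (2 * z.1)) / (1 - 3 * W z ^ 2) := by
    refine derivFst_eventuallyEq es (hW.mono fun z ⟨h1, h2, h3, _, h5, _⟩ => ?_)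
    have key := ((((h5.fun_pow 4).const_mul 2).fun_sub ((h5.fun_pow 2).const_mul 2)).fun_sub
      ((hasDerivAt_const z.1 (Complex.exp (z.2 / 2) ^ 2)).fun_div ((h5.fun_pow 2).const_mul 2)
        (mul_ne_zero two_ne_zero (pow_ne_zero 2 h1))))
    refine key.congr_deriv ?_
    simp only [Prod.mk.eta, Nat.cast_ofNat]
    generalize W z = v at *
    generalize hQ : 1 - 3 * v ^ 2 = Q at *
    field_simp
    subst hQ
    ring
  filter_upwards [hW, e0, ex, es, exx, exs, esx, ess] with
    z ⟨h1, h2, h3, _⟩ a0 ax as axx axs asx ass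
  have hexp : Complex.exp z.2 = Complex.exp (z.2 / 2) ^ 2 := by
    rw [← Complex.exp_nat_mul]; congr 1; push_cast; ring
  have hT := hT z h3
  refine ⟨by rw [axs, asx], ?_, ?_, ?_, ?_, ?_⟩ <;>
    simp only [a0, ax, as, axx, axs, ass, hexp] <;>
    generalize W z = v at * <;>
    generalize hQ : 1 - 3 * v ^ 2 = Q at * <;>
    generalize Complex.exp (z.2 / 2) = y at * <;>
    generalize Complex.cos (2 * z.1) = c at *
  -- In `eq₁`, `eq₂` and `eq₃`, c^2 appears only in the product with Ψ_ss. The multiplier of `hT` is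
  -- the coefficient of yc in the other factor times the one in Ψ_ss.
  · linear_combination (norm := (field_simp; subst hQ; ring))
      ((1 + 3 * v ^ 2) / (2 * v) - 9 * v / 2 + 9 * v * (1 - 2 * v ^ 2) / (2 * Q))
        * ((8 * v ^ 3 - 4 * v + y ^ 2 / v ^ 3) * 2 / Q) * hT
  · linear_combination (norm := (field_simp; subst hQ; ring))
      (v - 3 * v * (1 - 2 * v ^ 2) / (2 * Q))
        * ((8 * v ^ 3 - 4 * v + y ^ 2 / v ^ 3) * 2 / Q) * hT
  · linear_combination (norm := (field_simp; subst hQ; ring))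
      (v * (1 - 2 * v ^ 2) / (2 * Q))
        * ((8 * v ^ 3 - 4 * v + y ^ 2 / v ^ 3) * 2 / Q) * hT
  -- In `eq₄` and `eq₅` every term is linear in c, so the relation for c^2 is not needed.
  · field_simp
    subst hQ
    ring
  · field_simp
    subst hQ
    ring

end

/-! ### Extension of the reduced equations to the whole polydisc. -/

section


open Topology Filter

/-- The identity theorem, one equation at a time: both sides are analytic on a preconnected set. -/
theorem ReducedEquations.of_eventually {Ψ : ℂ × ℂ → ℂ} {D : Set (ℂ × ℂ)} {z₀ : ℂ × ℂ}
    (hΨ : AnalyticOnNhd ℂ Ψ D) (hD : IsOpen D) (hD' : IsPreconnected D) (h0 : z₀ ∈ D)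
    (h : ∀ᶠ z in 𝓝 z₀, ReducedEquations Ψ z) {z : ℂ × ℂ} (hz : z ∈ D) : ReducedEquations Ψ z := by
  have hs := analyticOnNhd_derivFst hΨ hD
  have hx := analyticOnNhd_derivSnd hΨ hD
  have hss := analyticOnNhd_derivFst hs hD
  have hxs := analyticOnNhd_derivFst hx hD
  have hsx := analyticOnNhd_derivSnd hs hD
  have hxx := analyticOnNhd_derivSnd hx hD
  have he : AnalyticOnNhd ℂ (fun z : ℂ × ℂ => Complex.exp z.2) D := fun z _ => analyticAt_snd.cexp
  have hc : ∀ c : ℂ, AnalyticOnNhd ℂ (fun _ : ℂ × ℂ => c) D := fun c => analyticOnNhd_const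
  have h22 := (((hc 2).mul hΨ).sub ((hc 9).mul hx)).add ((hc 9).mul hxx)
  have h23 := ((hc 2).mul hx).sub ((hc 3).mul hxx)
  have h2s := ((hc 2).mul hs).sub ((hc 3).mul hxs)
  refine ⟨?_, ?_, ?_, ?_, ?_, ?_⟩
  · exact hsx.eqOn_of_preconnected_of_eventuallyEq hxs hD' h0 (h.mono fun _ h => h.symm) hz
  · exact ((hxs.sub h2s).add (h22.mul hss)).eqOn_of_preconnected_of_eventuallyEq (h2s.pow 2) hD' h0
      (h.mono fun _ h => h.eq₁) hz
  · exact (he.add (h23.mul hss)).eqOn_of_preconnected_of_eventuallyEq (h2s.mul hxs) hD' h0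
      (h.mono fun _ h => h.eq₂) hz
  · exact (((he.mul h2s).add he).add (hxx.mul hss)).eqOn_of_preconnected_of_eventuallyEq (hxs.pow 2)
      hD' h0 (h.mono fun _ h => h.eq₃) hz
  · exact ((hxx.sub h23).add (h22.mul hxs)).eqOn_of_preconnected_of_eventuallyEq (h23.mul h2s)
      hD' h0 (h.mono fun _ h => h.eq₄) hz
  · exact (h23.mul hxs).eqOn_of_preconnected_of_eventuallyEq ((he.mul h22).add (hxx.mul h2s))
      hD' h0 (h.mono fun _ h => h.eq₅) hz

/-- The polydisc around the origin with radii `σ`, `ρ`. -/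
def polydisc (σ ρ : ℝ) : Set (ℂ × ℂ) := {z | ‖z.1‖ < σ ∧ ‖z.2‖ < ρ}

theorem polydisc_eq (σ ρ : ℝ) : polydisc σ ρ = Metric.ball 0 σ ×ˢ Metric.ball 0 ρ := by
  ext z
  simp [polydisc]

theorem isOpen_polydisc (σ ρ : ℝ) : IsOpen (polydisc σ ρ) := by
  rw [polydisc_eq]
  exact Metric.isOpen_ball.prod Metric.isOpen_ball

theorem isPreconnected_polydisc (σ ρ : ℝ) : IsPreconnected (polydisc σ ρ) := by
  rw [polydisc_eq]
  exact ((convex_ball (0 : ℂ) σ).prod (convex_ball (0 : ℂ) ρ)).isPreconnected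

theorem reducedEquations_of_satisfiesRecursion {b d : ℕ → ℕ → ℂ} (h : SatisfiesRecursion b d)
    {σ ρ : ℝ} (hσ : 0 < σ) (hρ : 0 < ρ) (hc : ConvergesAt b d σ ρ) {z : ℂ × ℂ}
    (hz : z ∈ polydisc σ ρ) : ReducedEquations (doubleSum (aCoeff b d)) z := by
  obtain ⟨W, hW⟩ := (exists_convergesAt_and_eventually_eq h).2
  exact ReducedEquations.of_eventually (analyticOnNhd_doubleSum hσ hρ hc) (isOpen_polydisc σ ρ)
    (isPreconnected_polydisc σ ρ) ⟨by simpa using hσ, by simpa using hρ⟩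
        (eventually_reducedEquations hW) hz

end

/-! ### Third derivatives of the potential, and the inverse metric. -/

section


theorem pd_zero_potentialA2 : pd 0 potentialA2 = fun t => t 0 * t 2 + (t 1) ^ 2 / 2 := by
  funext t
  have h := (((((hasDerivAt_id' (t 0)).fun_pow 2).mul_const (t 2)).div_const 2).fun_add
    (((hasDerivAt_id' (t 0)).mul_const ((t 1) ^ 2)).div_const 2)).sub_const ((t 1) ^ 4 / 24)
      |>.add_const (t 1 * Complex.exp (t 2))
  refine HasDerivAt.deriv ((h.congr_deriv ?_).congr_of_eventuallyEq
    (Filter.Eventually.of_forall fun z => ?_))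
  · push_cast
    ring
  · simp [potentialA2]

theorem pd_one_potentialA2 :
    pd 1 potentialA2 = fun t => t 0 * t 1 - (t 1) ^ 3 / 6 + Complex.exp (t 2) := by
  funext t
  have h := (((((hasDerivAt_id' (t 1)).fun_pow 2).const_mul (t 0)).div_const 2).const_add
    ((t 0) ^ 2 * t 2 / 2)).fun_sub (((hasDerivAt_id' (t 1)).fun_pow 4).div_const 24)
      |>.fun_add ((hasDerivAt_id' (t 1)).mul_const (Complex.exp (t 2)))
  refine HasDerivAt.deriv ((h.congr_deriv ?_).congr_of_eventuallyEq
    (Filter.Eventually.of_forall fun z => ?_))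
  · push_cast
    ring
  · simp [potentialA2]

theorem pd_two_potentialA2 :
    pd 2 potentialA2 = fun t => (t 0) ^ 2 / 2 + t 1 * Complex.exp (t 2) := by
  funext t
  have h := (((((hasDerivAt_id' (t 2)).const_mul ((t 0) ^ 2)).div_const 2).add_const
    (t 0 * (t 1) ^ 2 / 2)).sub_const ((t 1) ^ 4 / 24)).fun_add
      ((hasDerivAt_id' (t 2)).cexp.const_mul (t 1))
  refine HasDerivAt.deriv ((h.congr_deriv ?_).congr_of_eventuallyEq
    (Filter.Eventually.of_forall fun z => ?_))
  · ring
  · simp [potentialA2]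

theorem pd_pd_potentialA2 (α β : Fin 3) : pd α (pd β potentialA2) = fun t =>
    (!![t 2, t 1, t 0; t 1, t 0 - (t 1) ^ 2 / 2, Complex.exp (t 2);
      t 0, Complex.exp (t 2), t 1 * Complex.exp (t 2)] : Matrix (Fin 3) (Fin 3) ℂ) α β := by
  funext t
  have e : ∀ x y : ℂ, deriv (fun z : ℂ => x * z - z ^ 3 / 6) y = x - y ^ 2 / 2 := by
    intro x y
    have h := ((hasDerivAt_id' y).const_mul x).fun_sub (((hasDerivAt_id' y).fun_pow 3).div_const 6)
    rw [h.deriv]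
    simp only [Nat.cast_ofNat]
    ring
  fin_cases α <;> fin_cases β <;>
    simp [pd_zero_potentialA2, pd_one_potentialA2, pd_two_potentialA2] <;> simp [pd, e]

/-- The third derivatives of `potentialA2`. -/
def thirdDerivA2 (t : Fin 3 → ℂ) : Fin 3 → Matrix (Fin 3) (Fin 3) ℂ :=
  ![!![0, 0, 1; 0, 1, 0; 1, 0, 0], !![0, 1, 0; 1, -t 1, 0; 0, 0, Complex.exp (t 2)],
    !![1, 0, 0; 0, 0, Complex.exp (t 2); 0, Complex.exp (t 2), t 1 * Complex.exp (t 2)]]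

theorem pd_pd_pd_potentialA2 (t : Fin 3 → ℂ) (α β μ : Fin 3) :
    pd α (pd β (pd μ potentialA2)) t = thirdDerivA2 t α β μ := by
  rw [pd_pd_potentialA2]
  fin_cases α <;> fin_cases β <;> fin_cases μ <;> simp [pd, thirdDerivA2]

theorem metricA2_inv : metricA2⁻¹ = metricA2 := by
  refine Matrix.inv_eq_left_inv ?_
  ext i j
  fin_cases i <;> fin_cases j <;> simp [metricA2, Matrix.mul_apply, Fin.sum_univ_three]

end

/-! ### Branches of the logarithm and derivatives of quasi-homogeneous functions. -/

section


open Topology Filter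

theorem IsLogBranchOn.ne_zero {L : ℂ → ℂ} {U : Set ℂ} (h : IsLogBranchOn L U) {z : ℂ}
    (hz : z ∈ U) : z ≠ 0 := by
  rw [← h.exp_eq z hz]
  exact Complex.exp_ne_zero _

theorem IsLogBranchOn.hasDerivAt {L : ℂ → ℂ} {U : Set ℂ} (h : IsLogBranchOn L U) {z : ℂ}
    (hz : z ∈ U) : HasDerivAt L z⁻¹ z := by
  have hd := Complex.hasDerivAt_exp (L z)
  rw [h.exp_eq z hz] at hd
  exact HasDerivAt.of_local_left_inverse (h.continuousOn.continuousAt (h.isOpen.mem_nhds hz)) hd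
    (h.ne_zero hz) (Filter.mem_of_superset (h.isOpen.mem_nhds hz) h.exp_eq)

theorem IsLogBranchOn.analyticOnNhd {L : ℂ → ℂ} {U : Set ℂ} (h : IsLogBranchOn L U) :
    AnalyticOnNhd ℂ L U :=
  DifferentiableOn.analyticOnNhd
    (fun _ hz => (h.hasDerivAt hz).differentiableAt.differentiableWithinAt) h.isOpen

theorem mem_domainA2_iff {U : Set ℂ} {L : ℂ → ℂ} {σ ρ : ℝ} {y : (Fin 3 → ℂ) × ℂ} :
    y ∈ domainA2 U L σ ρ ↔ y.1 1 ∈ U ∧ (y.2, y.1 2 - 3 * L (y.1 1)) ∈ polydisc σ ρ :=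
  Iff.rfl

theorem isOpen_domainA2 {U : Set ℂ} {L : ℂ → ℂ} (h : IsLogBranchOn L U) (σ ρ : ℝ) :
    IsOpen (domainA2 U L σ ρ) := by
  have hU : IsOpen {y : (Fin 3 → ℂ) × ℂ | y.1 1 ∈ U} := h.isOpen.preimage (by fun_prop)
  have hL : ContinuousOn (fun y : (Fin 3 → ℂ) × ℂ => L (y.1 1)) {y | y.1 1 ∈ U} :=
    h.continuousOn.comp (by fun_prop) fun _ hy => hy
  have hc : ContinuousOn (fun y : (Fin 3 → ℂ) × ℂ => (y.2, y.1 2 - 3 * L (y.1 1)))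
      {y | y.1 1 ∈ U} :=
    continuousOn_snd.prodMk (ContinuousOn.sub (by fun_prop) (continuousOn_const.mul hL))
  exact hc.isOpen_inter_preimage hU (isOpen_polydisc σ ρ)

theorem pdt_congr {N : ℕ} {G H : (Fin N → ℂ) → ℂ → ℂ} {D : Set ((Fin N → ℂ) × ℂ)} (hD : IsOpen D)
    (h : ∀ t s, (t, s) ∈ D → G t s = H t s) (α : Fin N) {t : Fin N → ℂ} {s : ℂ}
    (ht : (t, s) ∈ D) : pdt α G t s = pdt α H t s := by
  refine Filter.EventuallyEq.deriv_eq ?_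
  have hc : Tendsto (fun z => (Function.update t α z, s)) (𝓝 (t α)) (𝓝 (t, s)) := by
    have : Continuous fun z => (Function.update t α z, s) := by fun_prop
    simpa using this.tendsto (t α)
  exact (hc.eventually (hD.mem_nhds ht)).mono fun z hz => h _ _ hz

theorem pds_congr {N : ℕ} {G H : (Fin N → ℂ) → ℂ → ℂ} {D : Set ((Fin N → ℂ) × ℂ)} (hD : IsOpen D)
    (h : ∀ t s, (t, s) ∈ D → G t s = H t s) {t : Fin N → ℂ} {s : ℂ} (ht : (t, s) ∈ D) :
    pds G t s = pds H t s := by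
  refine Filter.EventuallyEq.deriv_eq ?_
  have hc : Tendsto (fun z : ℂ => (t, z)) (𝓝 s) (𝓝 (t, s)) := by
    have : Continuous fun z : ℂ => (t, z) := by fun_prop
    exact this.tendsto s
  exact (hc.eventually (hD.mem_nhds ht)).mono fun z hz => h _ _ hz

/-- The function `(t^2) ^ k * Φ(s, t^3 - 3 log t^2)`. -/
def weighted (L : ℂ → ℂ) (k : ℕ) (Φ : ℂ × ℂ → ℂ) (t : Fin 3 → ℂ) (s : ℂ) : ℂ :=
  t 1 ^ k * Φ (s, t 2 - 3 * L (t 1))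

section

variable {L : ℂ → ℂ} {U : Set ℂ} {σ ρ : ℝ} {Φ : ℂ × ℂ → ℂ} {t : Fin 3 → ℂ} {s : ℂ}

/-- The derivative -3/t^2 of the inner argument costs one power of t^2, as does differentiating the
monomial, so the result is again `weighted` with exponent one lower. -/
theorem hasDerivAt_weighted_one (hL : IsLogBranchOn L U) (hΦ : AnalyticOnNhd ℂ Φ (polydisc σ ρ))
    (ht : (t, s) ∈ domainA2 U L σ ρ) (k : ℕ) :
    HasDerivAt (fun z => weighted L (k + 1) Φ (Function.update t 1 z) s)
      (weighted L k (fun z => (k + 1) * Φ z - 3 * derivSnd Φ z) t s) (t 1) := by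
  have ht' := mem_domainA2_iff.mp ht
  have h1 := hasDerivAt_comp_prodMk (u := fun _ => s) (w := fun z => t 2 - 3 * L z) (x := t 1)
    (hΦ _ ht'.2).differentiableAt (hasDerivAt_const _ s)
    (((hL.hasDerivAt ht'.1).const_mul 3).const_sub (t 2))
  have h2 := ((hasDerivAt_id' (t 1)).fun_pow (k + 1)).fun_mul h1
  refine (h2.congr_deriv ?_).congr_of_eventuallyEq (Filter.Eventually.of_forall fun z => ?_)
  · have := hL.ne_zero ht'.1
    simp only [weighted, Nat.add_sub_cancel]
    push_cast
    field_simp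
    ring
  · simp [weighted]

theorem hasDerivAt_weighted_two (hΦ : AnalyticOnNhd ℂ Φ (polydisc σ ρ))
    (ht : (t, s) ∈ domainA2 U L σ ρ) (k : ℕ) :
    HasDerivAt (fun z => weighted L k Φ (Function.update t 2 z) s)
      (weighted L k (derivSnd Φ) t s) (t 2) := by
  have ht' := mem_domainA2_iff.mp ht
  have h1 := hasDerivAt_comp_prodMk (u := fun _ => s) (w := fun z => z - 3 * L (t 1)) (x := t 2)
    (hΦ _ ht'.2).differentiableAt (hasDerivAt_const _ s)
    ((hasDerivAt_id' (t 2)).sub_const (3 * L (t 1)))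
  refine ((h1.const_mul (t 1 ^ k)).congr_deriv ?_).congr_of_eventuallyEq
    (Filter.Eventually.of_forall fun z => ?_)
  · simp [weighted]
  · simp [weighted]

theorem hasDerivAt_weighted_s (hΦ : AnalyticOnNhd ℂ Φ (polydisc σ ρ))
    (ht : (t, s) ∈ domainA2 U L σ ρ) (k : ℕ) :
    HasDerivAt (fun z => weighted L k Φ t z) (weighted L k (derivFst Φ) t s) s := by
  have ht' := mem_domainA2_iff.mp ht
  have h1 := hasDerivAt_comp_prodMk (u := fun z => z) (w := fun _ => t 2 - 3 * L (t 1)) (x := s)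
    (hΦ _ ht'.2).differentiableAt (hasDerivAt_id' s) (hasDerivAt_const _ _)
  refine ((h1.const_mul (t 1 ^ k)).congr_deriv ?_).congr_of_eventuallyEq
    (Filter.Eventually.of_forall fun z => ?_)
  · simp [weighted]
  · simp [weighted]

theorem weighted_update_zero (k : ℕ) (z : ℂ) :
    weighted L k Φ (Function.update t 0 z) s = weighted L k Φ t s := by
  simp [weighted]

theorem analyticAt_weighted (hL : IsLogBranchOn L U) (hΦ : AnalyticOnNhd ℂ Φ (polydisc σ ρ))
    {y : (Fin 3 → ℂ) × ℂ} (hy : y ∈ domainA2 U L σ ρ) (k : ℕ) :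
    AnalyticAt ℂ (fun y : (Fin 3 → ℂ) × ℂ => weighted L k Φ y.1 y.2) y := by
  have hy' := mem_domainA2_iff.mp hy
  have hp : ∀ i : Fin 3, AnalyticAt ℂ (fun y : (Fin 3 → ℂ) × ℂ => y.1 i) y := fun i =>
    ((ContinuousLinearMap.proj i : (Fin 3 → ℂ) →L[ℂ] ℂ).comp
      (ContinuousLinearMap.fst ℂ (Fin 3 → ℂ) ℂ)).analyticAt y
  have hL' : AnalyticAt ℂ (fun y : (Fin 3 → ℂ) × ℂ => L (y.1 1)) y :=
    AnalyticAt.comp (hL.analyticOnNhd _ hy'.1) (hp 1)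
  have hz : AnalyticAt ℂ (fun y : (Fin 3 → ℂ) × ℂ => (y.2, y.1 2 - 3 * L (y.1 1))) y :=
    analyticAt_snd.prod ((hp 2).sub (analyticAt_const.mul hL'))
  exact ((hp 1).pow k).mul (AnalyticAt.comp (hΦ _ hy'.2) hz)

end

end

/-! ### Reduction of the open WDVV equations to the equations for Ψ. -/

section


open Topology Filter

theorem derivFst_linear {f g : ℂ × ℂ → ℂ} {z : ℂ × ℂ} (hf : DifferentiableAt ℂ f z)
    (hg : DifferentiableAt ℂ g z) (a b : ℂ) :
    derivFst (fun z => a * f z - b * g z) z = a * derivFst f z - b * derivFst g z := by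
  have h := (hf.hasFDerivAt.const_mul a).fun_sub (hg.hasFDerivAt.const_mul b)
  rw [derivFst_eq h.differentiableAt, derivFst_eq hf, derivFst_eq hg, h.fderiv]
  simp

theorem derivSnd_linear {f g : ℂ × ℂ → ℂ} {z : ℂ × ℂ} (hf : DifferentiableAt ℂ f z)
    (hg : DifferentiableAt ℂ g z) (a b : ℂ) :
    derivSnd (fun z => a * f z - b * g z) z = a * derivSnd f z - b * derivSnd g z := by
  have h := (hf.hasFDerivAt.const_mul a).fun_sub (hg.hasFDerivAt.const_mul b)
  rw [derivSnd_eq h.differentiableAt, derivSnd_eq hf, derivSnd_eq hg, h.fderiv]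
  simp

/-- The function `s t^1 + (t^2)^2 Φ(s, t^3 - 3 log t^2)`. -/
def openPotential (L : ℂ → ℂ) (Φ : ℂ × ℂ → ℂ) (t : Fin 3 → ℂ) (s : ℂ) : ℂ :=
  s * t 0 + weighted L 2 Φ t s

section

variable {L : ℂ → ℂ} {U : Set ℂ} {σ ρ : ℝ} {Φ : ℂ × ℂ → ℂ} {t : Fin 3 → ℂ} {s : ℂ}

theorem pdt_zero_openPotential (t : Fin 3 → ℂ) (s : ℂ) : pdt 0 (openPotential L Φ) t s = s := by
  have h := ((hasDerivAt_id' (t 0)).const_mul s).add_const (weighted L 2 Φ t s)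
  rw [mul_one] at h
  refine HasDerivAt.deriv (h.congr_of_eventuallyEq (Filter.Eventually.of_forall fun z => ?_))
  simp [openPotential, weighted_update_zero]

theorem pdt_one_openPotential (hL : IsLogBranchOn L U) (hΦ : AnalyticOnNhd ℂ Φ (polydisc σ ρ))
    (ht : (t, s) ∈ domainA2 U L σ ρ) : pdt 1 (openPotential L Φ) t s
      = weighted L 1 (fun z => 2 * Φ z - 3 * derivSnd Φ z) t s := by
  have h := (hasDerivAt_weighted_one hL hΦ ht 1).const_add (s * t 0)
  simp only [Nat.cast_one, one_add_one_eq_two] at h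
  refine HasDerivAt.deriv (h.congr_of_eventuallyEq (Filter.Eventually.of_forall fun z => ?_))
  simp [openPotential]

theorem pdt_two_openPotential (hΦ : AnalyticOnNhd ℂ Φ (polydisc σ ρ))
    (ht : (t, s) ∈ domainA2 U L σ ρ) :
    pdt 2 (openPotential L Φ) t s = weighted L 2 (derivSnd Φ) t s := by
  have h := (hasDerivAt_weighted_two hΦ ht 2).const_add (s * t 0)
  refine HasDerivAt.deriv (h.congr_of_eventuallyEq (Filter.Eventually.of_forall fun z => ?_))
  simp [openPotential]

theorem pds_openPotential (hΦ : AnalyticOnNhd ℂ Φ (polydisc σ ρ))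
    (ht : (t, s) ∈ domainA2 U L σ ρ) :
    pds (openPotential L Φ) t s = t 0 + weighted L 2 (derivFst Φ) t s := by
  have h := ((hasDerivAt_id' s).mul_const (t 0)).fun_add (hasDerivAt_weighted_s hΦ ht 2)
  rw [one_mul] at h
  exact h.deriv

theorem pdt_pdt_openPotential (hL : IsLogBranchOn L U) (hΦ : AnalyticOnNhd ℂ Φ (polydisc σ ρ))
    (ht : (t, s) ∈ domainA2 U L σ ρ) {z : ℂ × ℂ} (hz : z = (s, t 2 - 3 * L (t 1))) (α β : Fin 3) :
    pdt α (pdt β (openPotential L Φ)) t s =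
      (!![0, 0, 0;
        0, 2 * Φ z - 9 * derivSnd Φ z + 9 * derivSnd (derivSnd Φ) z,
          t 1 * (2 * derivSnd Φ z - 3 * derivSnd (derivSnd Φ) z);
        0, t 1 * (2 * derivSnd Φ z - 3 * derivSnd (derivSnd Φ) z),
          t 1 ^ 2 * derivSnd (derivSnd Φ) z] : Matrix (Fin 3) (Fin 3) ℂ) α β := by
  have hD := isOpen_domainA2 hL σ ρ
  have hP := isOpen_polydisc σ ρ
  have hx := analyticOnNhd_derivSnd hΦ hP
  have h1 : AnalyticOnNhd ℂ (fun z => 2 * Φ z - 3 * derivSnd Φ z) (polydisc σ ρ) :=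
    (analyticOnNhd_const.mul hΦ).sub (analyticOnNhd_const.mul hx)
  have ht' := (mem_domainA2_iff.mp ht).2
  rw [← hz] at ht'
  have hl := derivSnd_linear (hΦ z ht').differentiableAt (hx z ht').differentiableAt 2 3
  have e0 : ∀ α, pdt α (pdt 0 (openPotential L Φ)) t s = 0 := fun α => by
    rw [pdt_congr hD (H := fun _ s => s) (fun t s _ => pdt_zero_openPotential t s) α ht]
    simp [pdt]
  have e1 := fun α => pdt_congr hD (fun t s h => pdt_one_openPotential hL hΦ h) α ht
  have e2 := fun α => pdt_congr hD (fun t s h => pdt_two_openPotential hΦ h) α ht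
  have e01 : pdt 0 (weighted L 1 (fun z => 2 * Φ z - 3 * derivSnd Φ z)) t s = 0 := by
    simp [pdt, weighted_update_zero]
  have e02 : pdt 0 (weighted L 2 (derivSnd Φ)) t s = 0 := by
    simp [pdt, weighted_update_zero]
  have e11 := (hasDerivAt_weighted_one hL h1 ht 0).deriv
  have e21 := (hasDerivAt_weighted_two h1 ht 1).deriv
  have e12 := (hasDerivAt_weighted_one hL hx ht 1).deriv
  have e22 := (hasDerivAt_weighted_two hx ht 2).deriv
  simp only [weighted, ← hz] at e11 e21 e12 e22
  rw [hl] at e11 e21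
  fin_cases β
  · fin_cases α <;> simp [e0]
  · fin_cases α
    · simpa using! (e1 0).trans e01
    · refine (e1 1).trans (Eq.trans e11 ?_)
      simp
      ring
    · refine (e1 2).trans (Eq.trans e21 ?_)
      simp
  · fin_cases α
    · simpa using! (e2 0).trans e02
    · refine (e2 1).trans (Eq.trans e12 ?_)
      simp [one_add_one_eq_two]
    · refine (e2 2).trans (Eq.trans e22 ?_)
      simp

theorem pds_pdt_openPotential (hL : IsLogBranchOn L U) (hΦ : AnalyticOnNhd ℂ Φ (polydisc σ ρ))
    (ht : (t, s) ∈ domainA2 U L σ ρ) {z : ℂ × ℂ} (hz : z = (s, t 2 - 3 * L (t 1))) (α : Fin 3) :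
    pds (pdt α (openPotential L Φ)) t s =
      ![1, t 1 * (2 * derivFst Φ z - 3 * derivFst (derivSnd Φ) z),
        t 1 ^ 2 * derivFst (derivSnd Φ) z] α := by
  have hD := isOpen_domainA2 hL σ ρ
  have hP := isOpen_polydisc σ ρ
  have hx := analyticOnNhd_derivSnd hΦ hP
  have h1 : AnalyticOnNhd ℂ (fun z => 2 * Φ z - 3 * derivSnd Φ z) (polydisc σ ρ) :=
    (analyticOnNhd_const.mul hΦ).sub (analyticOnNhd_const.mul hx)
  have ht' := (mem_domainA2_iff.mp ht).2
  rw [← hz] at ht'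
  have hl := derivFst_linear (hΦ z ht').differentiableAt (hx z ht').differentiableAt 2 3
  have e1 := (hasDerivAt_weighted_s h1 ht 1).deriv
  have e2 := (hasDerivAt_weighted_s hx ht 2).deriv
  simp only [weighted, ← hz] at e1 e2
  rw [hl] at e1
  fin_cases α
  · refine (pds_congr hD (H := fun _ s => s) (fun t s _ => pdt_zero_openPotential t s) ht).trans ?_
    simp [pds]
  · refine (pds_congr hD (fun t s h => pdt_one_openPotential hL hΦ h) ht).trans (Eq.trans e1 ?_)
    simp
  · refine (pds_congr hD (fun t s h => pdt_two_openPotential hΦ h) ht).trans (Eq.trans e2 ?_)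
    simp

theorem pdt_pds_openPotential (hL : IsLogBranchOn L U) (hΦ : AnalyticOnNhd ℂ Φ (polydisc σ ρ))
    (ht : (t, s) ∈ domainA2 U L σ ρ) {z : ℂ × ℂ} (hz : z = (s, t 2 - 3 * L (t 1))) (α : Fin 3) :
    pdt α (pds (openPotential L Φ)) t s =
      ![1, t 1 * (2 * derivFst Φ z - 3 * derivSnd (derivFst Φ) z),
        t 1 ^ 2 * derivSnd (derivFst Φ) z] α := by
  have hD := isOpen_domainA2 hL σ ρ
  have hP := isOpen_polydisc σ ρ
  have hs := analyticOnNhd_derivFst hΦ hP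
  have e1 := ((hasDerivAt_weighted_one hL hs ht 1).const_add (t 0)).deriv
  have e2 := ((hasDerivAt_weighted_two hs ht 2).const_add (t 0)).deriv
  simp only [weighted, ← hz] at e1 e2
  refine (pdt_congr hD (H := fun t s => t 0 + weighted L 2 (derivFst Φ) t s)
    (fun t s h => pds_openPotential hΦ h) α ht).trans ?_
  fin_cases α
  · simp [pdt, weighted_update_zero]
  · refine Eq.trans ?_ (Eq.trans e1 ?_)
    · simp [pdt, weighted]
    · simp [one_add_one_eq_two]
  · refine Eq.trans ?_ (Eq.trans e2 ?_)
    · simp [pdt, weighted]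
    · simp

theorem pds_pds_openPotential (hL : IsLogBranchOn L U) (hΦ : AnalyticOnNhd ℂ Φ (polydisc σ ρ))
    (ht : (t, s) ∈ domainA2 U L σ ρ) {z : ℂ × ℂ} (hz : z = (s, t 2 - 3 * L (t 1))) :
    pds (pds (openPotential L Φ)) t s = t 1 ^ 2 * derivFst (derivFst Φ) z := by
  have hs := analyticOnNhd_derivFst hΦ (isOpen_polydisc σ ρ)
  have e := ((hasDerivAt_weighted_s hs ht 2).const_add (t 0)).deriv
  refine (pds_congr (isOpen_domainA2 hL σ ρ)
    (H := fun t s => t 0 + weighted L 2 (derivFst Φ) t s)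
    (fun t s h => pds_openPotential hΦ h) ht).trans (Eq.trans e ?_)
  rw [weighted, hz]

theorem isOpenWDVVSolutionOn_openPotential (hL : IsLogBranchOn L U)
    (hΦ : AnalyticOnNhd ℂ Φ (polydisc σ ρ)) (h : ∀ z ∈ polydisc σ ρ, ReducedEquations Φ z) :
    IsOpenWDVVSolutionOn metricA2 potentialA2 (openPotential L Φ) (domainA2 U L σ ρ) := by
  -- This makes every equation homogeneous in t^2, and it is where the coefficient 3 of the
  -- logarithm is needed.
  have hE : ∀ t s, (t, s) ∈ domainA2 U L σ ρ →
      Complex.exp (t 2) = t 1 ^ 3 * Complex.exp (t 2 - 3 * L (t 1)) := by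
    intro t s ht
    have hτ : Complex.exp (L (t 1)) = t 1 := hL.exp_eq _ ht.1
    rw [show t 1 ^ 3 = Complex.exp (L (t 1)) ^ 3 by rw [hτ], ← Complex.exp_nat_mul,
        ← Complex.exp_add]
    congr 1
    push_cast
    ring
  refine ⟨isOpen_domainA2 hL σ ρ, fun y hy => ?_, ?_, ?_⟩
  · have hp : AnalyticAt ℂ (fun y : (Fin 3 → ℂ) × ℂ => y.1 0) y :=
      ((ContinuousLinearMap.proj 0 : (Fin 3 → ℂ) →L[ℂ] ℂ).comp
        (ContinuousLinearMap.fst ℂ (Fin 3 → ℂ) ℂ)).analyticAt y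
    exact (analyticAt_snd.mul hp).add (analyticAt_weighted hL hΦ hy 2)
  · intro t s ht α β γ
    obtain ⟨_, _, _, _, h4, h5⟩ := h _ (mem_domainA2_iff.mp ht).2
    have hE := hE t s ht
    simp only [Fin.sum_univ_three, pd_pd_pd_potentialA2, metricA2_inv,
      pdt_pdt_openPotential hL hΦ ht rfl, pds_pdt_openPotential hL hΦ ht rfl]
    simp only at h4 h5
    -- The equations are antisymmetric in α and γ and trivial if an index is that of t^1. With {α,
    -- γ} those of t^2 and t^3, β gives `eq₄` or `eq₅`, up to sign and a power of t^2.
    fin_cases α <;> fin_cases β <;> fin_cases γ <;> simp [thirdDerivA2, metricA2, hE] <;>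
      first
      | ring1
      | linear_combination t 1 ^ 2 * h4
      | linear_combination -t 1 ^ 2 * h4
      | linear_combination t 1 ^ 3 * h5
      | linear_combination -t 1 ^ 3 * h5
  · intro t s ht α β
    obtain ⟨h0, h1, h2, h3, _, _⟩ := h _ (mem_domainA2_iff.mp ht).2
    have hE := hE t s ht
    simp only [Fin.sum_univ_three, pd_pd_pd_potentialA2, metricA2_inv,
      pdt_pdt_openPotential hL hΦ ht rfl, pds_pdt_openPotential hL hΦ ht rfl,
      pdt_pds_openPotential hL hΦ ht rfl, pds_pds_openPotential hL hΦ ht rfl, h0]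
    simp only at h1 h2 h3
    -- The index pairs (t^2, t^2), (t^2, t^3), (t^3, t^3) give `eq₁`, `eq₂`, `eq₃`; pairs containing
    -- t^1 are identities.
    fin_cases α <;> fin_cases β <;> simp [thirdDerivA2, metricA2, hE] <;>
      first
      | ring1
      | linear_combination t 1 ^ 2 * h1
      | linear_combination t 1 ^ 3 * h2
      | linear_combination t 1 ^ 4 * h3

end

end

end OpenWDVV

end

theorem mainTheorem2 :
    (∃ b d : ℕ → ℕ → ℂ, OpenWDVV.SatisfiesRecursion b d) ∧
    (∀ b d b' d' : ℕ → ℕ → ℂ,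
      OpenWDVV.SatisfiesRecursion b d → OpenWDVV.SatisfiesRecursion b' d' →
        ∀ i j : ℕ, 1 ≤ i → i ≤ j → b i j = b' i j ∧ d i j = d' i j) ∧
    (∀ b d : ℕ → ℕ → ℂ, OpenWDVV.SatisfiesRecursion b d →
      (∃ r : ℝ, 0 < r ∧ OpenWDVV.ConvergesAt b d r r) ∧
      ∀ σ ρ : ℝ, 0 < σ → 0 < ρ → OpenWDVV.ConvergesAt b d σ ρ →
        ∀ (U : Set ℂ) (L : ℂ → ℂ), OpenWDVV.IsLogBranchOn L U →
          OpenWDVV.IsOpenWDVVSolutionOn OpenWDVV.metricA2 OpenWDVV.potentialA2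
            (OpenWDVV.openPotentialA2 b d L) (OpenWDVV.domainA2 U L σ ρ) ∧
          (∀ t s, (t, s) ∈ OpenWDVV.domainA2 U L σ ρ →
            t 0 * OpenWDVV.pdt 0 (OpenWDVV.openPotentialA2 b d L) t s
              + 1 / 2 * t 1 * OpenWDVV.pdt 1 (OpenWDVV.openPotentialA2 b d L) t s
              + 3 / 2 * OpenWDVV.pdt 2 (OpenWDVV.openPotentialA2 b d L) t s
              = OpenWDVV.openPotentialA2 b d L t s) ∧
          (∀ t s, (t, s) ∈ OpenWDVV.domainA2 U L σ ρ →
            (∀ α : Fin 3,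
              OpenWDVV.pdt 0 (OpenWDVV.pdt α (OpenWDVV.openPotentialA2 b d L)) t s = 0) ∧
            OpenWDVV.pdt 0 (OpenWDVV.pds (OpenWDVV.openPotentialA2 b d L)) t s = 1)) := by
  obtain ⟨v, r, -, -, h0, hv⟩ := OpenWDVV.exists_cubic_series
  obtain ⟨b, d, hbd, -⟩ := OpenWDVV.exists_recursion h0 hv
  refine ⟨⟨b, d, hbd⟩, fun _ _ _ _ h h' i j hi hij => OpenWDVV.recursion_unique h h' i j hi hij,
    fun b d h => ⟨(OpenWDVV.exists_convergesAt_and_eventually_eq h).1,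
      fun σ ρ hσ hρ hc U L hL => ?_⟩⟩
  have hΦ : AnalyticOnNhd ℂ (OpenWDVV.doubleSum (OpenWDVV.aCoeff b d)) (OpenWDVV.polydisc σ ρ) :=
    OpenWDVV.analyticOnNhd_doubleSum hσ hρ hc
  have hG : OpenWDVV.openPotentialA2 b d L
      = OpenWDVV.openPotential L (OpenWDVV.doubleSum (OpenWDVV.aCoeff b d)) := rfl
  rw [hG]
  refine ⟨OpenWDVV.isOpenWDVVSolutionOn_openPotential hL hΦ fun _ hz =>
    OpenWDVV.reducedEquations_of_satisfiesRecursion h hσ hρ hc hz, fun t s ht => ?_,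
    fun t s ht => ⟨fun α => ?_, ?_⟩⟩
  · rw [OpenWDVV.pdt_zero_openPotential, OpenWDVV.pdt_one_openPotential hL hΦ ht,
      OpenWDVV.pdt_two_openPotential hΦ ht]
    -- Homogeneity: the x-derivative of Ψ enters with -3/2 from t^2 and +3/2 from t^3, and cancels.
    simp only [OpenWDVV.openPotential, OpenWDVV.weighted]
    ring
  · rw [OpenWDVV.pdt_pdt_openPotential hL hΦ ht rfl]
    fin_cases α <;> simp
  · rw [OpenWDVV.pdt_pds_openPotential hL hΦ ht rfl]
    simp
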